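/- Let $\nu>0$ and $\alpha\in\mathbb R$, and let $S=[0,1]\times\mathbb R\subset\mathbb C$. Let $L^{2,\nu}_{\Gamma,\alpha}$ ($\Gamma=\mathbb Z$) be the space of measurable functions $f:\mathbb C\to\mathbb C$, modulo equality almost everywhere, such that $$f(z+m)=e^{2i\pi\alpha m}e^{\nu(z+\frac m2)m}f(z)\quad\text{for all } m\in\mathbb Z \text{ and almost all } z\in\mathbb C,\qquad \int_S|f(z)|^2e^{-\nu|z|^2}dx\,dy<\infty ,$$ with the scalar product $\langle f,g\rangle=\int_S f\,\overline g\,e^{-\nu|z|^2}dx\,dy$, $z=x+iy$. Let $\mathcal O^{2,\nu}_{\Gamma,\alpha}$ be the subspace of those elements that are represented by an entire function satisfying the functional equation everywhere. Put $A^*=-\frac{\partial}{\partial z}+\nu\bar z$ and $$\Delta_\nu=-\frac{\partial^2}{\partial z\,\partial\bar z}+\nu\bar z\frac{\partial}{\partial\bar z},$$ where $\Delta_\nu$ is regarded as the unbounded operator on $L^{2,\nu}_{\Gamma,\alpha}$ whose domain consists of all $f$ for which $\Delta_\nu f$, taken in the sense of distributions on $\mathbb C$, belongs to $L^{2,\nu}_{\Gamma,\alpha}$.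 For $\lambda\in\mathbb C$ let $\mathcal E^{\nu,\lambda}_{\Gamma,\alpha}=\{f\in L^{2,\nu}_{\Gamma,\alpha}:\Delta_\nu f=\nu\lambda f\}$. For $m\in\mathbb Z_{\ge0}$ and $n\in\mathbb Z$ put $$\psi_n^{\alpha,\nu}(z)=\Big(\frac{2\nu}{\pi}\Big)^{1/4}e^{\frac\nu2z^2-\frac{\pi^2}{\nu}(n+\alpha)^2+2i\pi(\alpha+n)z},$$ $$\psi_{m,n}^{\alpha,\nu}(z,\bar z)=(2^mm!)^{-1/2}\,\psi_n^{\alpha,\nu}(z)\,H_m\Big(\sqrt{2\nu}\,y+\sqrt{\tfrac2\nu}\,\pi(n+\alpha)\Big),$$ where $H_m$ is the Hermite polynomial given by $H_0=1$, $H_{m+1}(x)=2xH_m(x)-H_m'(x)$. Then: 1. $L^{2,\nu}_{\Gamma,\alpha}$ is a Hilbert space, and the spectrum of $\Delta_\nu$ on it is exactly $\{\nu m: m=0,1,2,\dots\}$. 2. For $\lambda\in\mathbb C$, the space $\mathcal E^{\nu,\lambda}_{\Gamma,\alpha}$ is non-zero if and only if $\lambda=m$ for some $m\in\{0,1,2,\dots\}$,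 and each $\mathcal E^{\nu,m}_{\Gamma,\alpha}$ is infinite-dimensional. 3. For every $\lambda\in\mathbb C$, an element of $L^{2,\nu}_{\Gamma,\alpha}$ belongs to $\mathcal E^{\nu,\lambda}_{\Gamma,\alpha}$ if and only if it is represented by a $C^\infty$ function $g$ on $\mathbb C$ that satisfies the functional equation everywhere and $\Delta_\nu g=\nu\lambda g$ pointwise. 4. $\mathcal E^{\nu,0}_{\Gamma,\alpha}=\mathcal O^{2,\nu}_{\Gamma,\alpha}$, and $L^{2,\nu}_{\Gamma,\alpha}$ is the Hilbert (orthogonal) sum of the spaces $\mathcal E^{\nu,m}_{\Gamma,\alpha}$, $m\ge0$; that is, $$L^{2,\nu}_{\Gamma,\alpha}=\mathcal O^{2,\nu}_{\Gamma,\alpha}\oplus\bigoplus_{m\ge1}\mathcal E^{\nu,m}_{\Gamma,\alpha}.$$ 5. For all $m\ge0$, $n\in\mathbb Z$ and $z\in\mathbb C$, $\big[(\nu^mm!)^{-1/2}(iA^*)^m\psi_n^{\alpha,\nu}\big](z)=\psi_{m,n}^{\alpha,\nu}(z,\bar z)$, and for each $m\ge0$ the family $(\psi_{m,n}^{\alpha,\nu})_{n\in\mathbb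 Z}$ is an orthonormal (Hilbert) basis of $\mathcal E^{\nu,m}_{\Gamma,\alpha}$. -/

import Mathlib

open MeasureTheory Complex
open scoped ContDiff ComplexConjugate

noncomputable section

namespace RankOneTheta

/-! ### Quasi-periodic functions and the weighted inner product -/

/-- The automorphy factor `e^{2iπαm} e^{ν (z + m/2) m}`. -/
def factor (ν α : ℝ) (m : ℤ) (z : ℂ) : ℂ :=
  exp (2 * I * Real.pi * α * m) * exp (ν * (z + m / 2) * m)

/-- The fundamental strip `S = [0,1] × ℝ`. -/
def strip : Set ℂ := {z | 0 ≤ z.re ∧ z.re ≤ 1}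

/-- The Gaussian weight `e^{-ν|z|²}`. -/
def weight (ν : ℝ) (z : ℂ) : ℝ := Real.exp (-ν * ‖z‖ ^ 2)

/-- The functional equation `f(z+m) = e^{2iπαm} e^{ν(z+m/2)m} f(z)`, for every `z` and `m`. -/
def IsQuasiPeriodic (ν α : ℝ) (f : ℂ → ℂ) : Prop :=
  ∀ (m : ℤ) (z : ℂ), f (z + m) = factor ν α m z * f z

/-- The functional equation for every `m` and almost every `z`. -/
def IsQuasiPeriodicAE (ν α : ℝ) (f : ℂ → ℂ) : Prop :=
  ∀ m : ℤ, ∀ᵐ z : ℂ, f (z + m) = factor ν α m z * f z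

/-- `∫_S |f(z)|² e^{-ν|z|²} dm(z) < ∞`. -/
def IsSquareIntegrable (ν : ℝ) (f : ℂ → ℂ) : Prop :=
  IntegrableOn (fun z => ‖f z‖ ^ 2 * weight ν z) strip

lemma continuous_weight (ν : ℝ) : Continuous (weight ν) := by
  unfold weight; fun_prop

lemma weight_pos (ν : ℝ) (z : ℂ) : 0 < weight ν z := Real.exp_pos _

lemma ae_translate (m : ℤ) {p : ℂ → Prop} (h : ∀ᵐ z : ℂ, p z) : ∀ᵐ z : ℂ, p (z + m) :=
  (measurePreserving_add_right (volume : Measure ℂ) (m : ℂ)).quasiMeasurePreserving.ae h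

/-- The quasi-periodic functions with finite norm, modulo equality almost everywhere. -/
def l2Submodule (ν α : ℝ) : Submodule ℂ (ℂ →ₘ[volume] ℂ) where
  carrier := {f | IsQuasiPeriodicAE ν α f ∧ IsSquareIntegrable ν f}
  zero_mem' := by
    have h0 : ((0 : ℂ →ₘ[volume] ℂ) : ℂ → ℂ) =ᵐ[volume] 0 := AEEqFun.coeFn_zero
    refine ⟨fun m => ?_, ?_⟩
    · filter_upwards [h0, ae_translate m h0] with z h1 h2
      simp [h1, h2]
    · refine (integrable_zero ℂ ℝ _).congr (ae_restrict_of_ae ?_)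
      filter_upwards [h0] with z h1
      simp [h1]
  add_mem' := by
    rintro f g ⟨hf, hf2⟩ ⟨hg, hg2⟩
    have ha := AEEqFun.coeFn_add f g
    refine ⟨fun m => ?_, ?_⟩
    · filter_upwards [ha, ae_translate m ha, hf m, hg m] with z h1 h2 h3 h4
      simp only [h1, h2, Pi.add_apply, h3, h4]; ring
    · refine ((hf2.add hg2).const_mul 2).mono' ?_ (ae_restrict_of_ae ?_)
      · exact (((f + g).aestronglyMeasurable.norm.pow 2).mul
          (continuous_weight ν).aestronglyMeasurable).mono_measure Measure.restrict_le_self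
      · filter_upwards [ha] with z h1
        have hw := weight_pos ν z
        rw [Real.norm_of_nonneg (by positivity), h1]
        have h3 : ‖f z + g z‖ ≤ ‖f z‖ + ‖g z‖ := norm_add_le _ _
        have h4 : ‖f z + g z‖ ^ 2 ≤ 2 * (‖f z‖ ^ 2 + ‖g z‖ ^ 2) := by
          nlinarith [norm_nonneg (f z + g z), sq_nonneg (‖f z‖ - ‖g z‖)]
        simp only [Pi.add_apply]
        nlinarith
  smul_mem' := by
    rintro c f ⟨hf, hf2⟩
    have ha := AEEqFun.coeFn_smul c f
    refine ⟨fun m => ?_, ?_⟩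
    · filter_upwards [ha, ae_translate m ha, hf m] with z h1 h2 h3
      simp only [h1, h2, Pi.smul_apply, h3, smul_eq_mul]; ring
    · refine (hf2.const_mul (‖c‖ ^ 2)).congr (ae_restrict_of_ae ?_)
      filter_upwards [ha] with z h1
      simp only [h1, Pi.smul_apply, smul_eq_mul, norm_mul]; ring

/-- The space `L^{2,ν}_{Γ,α}`, `Γ = ℤ`. -/
def L2Space (ν α : ℝ) : Type := l2Submodule ν α

instance (ν α : ℝ) : AddCommGroup (L2Space ν α) := inferInstanceAs (AddCommGroup (l2Submodule ν α))
instance (ν α : ℝ) : Module ℂ (L2Space ν α) := inferInstanceAs (Module ℂ (l2Submodule ν α))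

/-- The function underlying an element of `L^{2,ν}_{Γ,α}`, defined up to equality a.e. -/
def L2Space.toFun {ν α : ℝ} (f : L2Space ν α) : ℂ → ℂ := (f.1 : ℂ → ℂ)

instance (ν α : ℝ) : CoeFun (L2Space ν α) (fun _ => ℂ → ℂ) := ⟨L2Space.toFun⟩

variable {ν α : ℝ}

lemma coeFn_add (f g : L2Space ν α) : ∀ᵐ z, (f + g) z = f z + g z := AEEqFun.coeFn_add f.1 g.1

lemma coeFn_smul (c : ℂ) (f : L2Space ν α) : ∀ᵐ z, (c • f) z = c * f z :=
  AEEqFun.coeFn_smul c f.1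

lemma aesm (f : L2Space ν α) : AEStronglyMeasurable f volume := f.1.aestronglyMeasurable

lemma quasiPeriodic (f : L2Space ν α) : IsQuasiPeriodicAE ν α f := f.2.1

lemma squareIntegrable (f : L2Space ν α) : IsSquareIntegrable ν f := f.2.2

lemma integrableOn_inner (f g : L2Space ν α) :
    IntegrableOn (fun z => g z * conj (f z) * weight ν z) strip := by
  refine ((squareIntegrable f).add (squareIntegrable g)).mono' ?_ (ae_of_all _ fun z => ?_)
  · exact (((aesm g).mul (continuous_conj.comp_aestronglyMeasurable (aesm f))).mul
      (continuous_ofReal.comp (continuous_weight ν)).aestronglyMeasurable).mono_measure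
        Measure.restrict_le_self
  · have hw := weight_pos ν z
    simp only [norm_mul, Complex.norm_real, Real.norm_of_nonneg hw.le, Pi.add_apply]
    rw [RCLike.norm_conj]
    have : ‖g z‖ * ‖f z‖ ≤ ‖f z‖ ^ 2 + ‖g z‖ ^ 2 := by
      nlinarith [sq_nonneg (‖f z‖ - ‖g z‖), sq_nonneg (‖f z‖), sq_nonneg (‖g z‖)]
    nlinarith

/-- If `f` vanishes a.e. on the strip, it vanishes a.e. -/
lemma ae_zero_of_strip (f : L2Space ν α) (h : ∀ᵐ z, z ∈ strip → f z = 0) : f = 0 := by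
  have key : ∀ᵐ z, f z = 0 := by
    have h1 : ∀ᵐ z : ℂ, ∀ m : ℤ, (z + m ∈ strip → f (z + m) = 0) ∧
        f (z + m) = factor ν α m z * f z :=
      ae_all_iff.2 fun m => (ae_translate m h).and (quasiPeriodic f m)
    filter_upwards [h1] with z hz
    obtain ⟨ha, hb⟩ := hz (-⌊z.re⌋)
    have hs : z + ((-⌊z.re⌋ : ℤ) : ℂ) ∈ strip := by
      simp only [strip, Set.mem_ofPred_eq, add_re, intCast_re]
      push_cast
      constructor <;> linarith [Int.floor_le z.re, Int.lt_floor_add_one z.re]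
    rw [ha hs] at hb
    exact (mul_eq_zero.1 hb.symm).resolve_left (mul_ne_zero (exp_ne_zero _) (exp_ne_zero _))
  refine Subtype.ext (AEEqFun.ext ?_)
  filter_upwards [key, (AEEqFun.coeFn_zero : ((0 : ℂ →ₘ[volume] ℂ) : ℂ → ℂ) =ᵐ[volume] 0)]
    with z h1 h2
  exact h1.trans h2.symm

lemma measurableSet_strip : MeasurableSet strip :=
  (measurableSet_le measurable_const measurable_re).inter
    (measurableSet_le measurable_re measurable_const)

/-- The scalar product `⟨f₁, f₂⟩ = ∫_S f₁ \bar{f₂} e^{-ν|z|²} dm`. As everywhere in Mathlib,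
`inner ℂ f g` is linear in `g`, so that `inner ℂ f g = ⟨g, f⟩`. -/
@[reducible] def innerCore (ν α : ℝ) : InnerProductSpace.Core ℂ (L2Space ν α) where
  inner f g := ∫ z in strip, g z * conj (f z) * weight ν z
  conj_inner_symm f g := by
    rw [← integral_conj]
    refine integral_congr_ae (ae_of_all _ fun z => ?_)
    simp only [map_mul, conj_conj, conj_ofReal]; ring
  re_inner_nonneg f := by
    have : ∀ z, f z * conj (f z) * weight ν z = ((‖f z‖ ^ 2 * weight ν z : ℝ) : ℂ) := fun z => by
      rw [mul_conj, normSq_eq_norm_sq]; push_cast; ring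
    simp only [this]
    rw [integral_complex_ofReal]
    exact integral_nonneg fun z => mul_nonneg (sq_nonneg _) (weight_pos ν z).le
  add_left f g h := by
    rw [← integral_add (integrableOn_inner f h) (integrableOn_inner g h)]
    refine integral_congr_ae (ae_restrict_of_ae ?_)
    filter_upwards [coeFn_add f g] with z hz
    rw [hz, map_add]; ring
  smul_left f g c := by
    rw [← integral_const_mul]
    refine integral_congr_ae (ae_restrict_of_ae ?_)
    filter_upwards [coeFn_smul c f] with z hz
    rw [hz, map_mul]; ring
  definite f hf := by
    have : ∀ z, f z * conj (f z) * weight ν z = ((‖f z‖ ^ 2 * weight ν z : ℝ) : ℂ) := fun z => by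
      rw [mul_conj, normSq_eq_norm_sq]; push_cast; ring
    simp only [this] at hf
    rw [integral_complex_ofReal, ofReal_eq_zero,
      integral_eq_zero_iff_of_nonneg
        (fun z => mul_nonneg (sq_nonneg _) (weight_pos ν z).le) (squareIntegrable f)] at hf
    refine ae_zero_of_strip f ?_
    filter_upwards [(ae_restrict_iff' measurableSet_strip).1 hf] with z hz hs
    have := hz hs
    simpa [(weight_pos ν z).ne'] using this

instance (ν α : ℝ) : NormedAddCommGroup (L2Space ν α) := (innerCore ν α).toNormedAddCommGroup

instance (ν α : ℝ) : InnerProductSpace ℂ (L2Space ν α) :=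
  InnerProductSpace.ofCore (innerCore ν α).toCore

lemma inner_def (f g : L2Space ν α) :
    inner ℂ f g = ∫ z in strip, g z * conj (f z) * weight ν z := rfl

/-- Elements of `L^{2,ν}_{Γ,α}` are locally integrable on the plane. -/
lemma locallyIntegrable (f : L2Space ν α) : LocallyIntegrable f volume := by
  set N : ℂ → ℝ := fun z => ‖f z‖ ^ 2 * weight ν z with hN
  have hper : ∀ m : ℤ, ∀ᵐ z : ℂ, N (z + m) = N z := by
    intro m
    filter_upwards [quasiPeriodic f m] with z hz
    have e1 : (2 * I * Real.pi * α * m : ℂ).re = 0 := by simp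
    have e2 : ((ν : ℂ) * (z + m / 2) * m).re = ν * (z.re + m / 2) * m := by
      simp [mul_re]
    have e3 : ‖factor ν α m z‖ = Real.exp (ν * (z.re + m / 2) * m) := by
      rw [factor, norm_mul, norm_exp, norm_exp, e1, e2, Real.exp_zero, one_mul]
    have e4 : weight ν (z + m) * Real.exp (ν * (z.re + m / 2) * m) ^ 2 = weight ν z := by
      rw [weight, weight, ← Real.exp_nat_mul, ← Real.exp_add, ← normSq_eq_norm_sq,
        ← normSq_eq_norm_sq, normSq_apply, normSq_apply]
      simp only [add_re, add_im, intCast_re, intCast_im, add_zero]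
      congr 1
      push_cast; ring
    simp only [hN, hz, norm_mul, e3]
    rw [← e4]; ring
  have hshift : ∀ m : ℤ, IntegrableOn N ((fun z : ℂ => z + (m : ℂ)) ⁻¹' strip) := by
    intro m
    have h1 := ((measurePreserving_add_right (volume : Measure ℂ) (m : ℂ)).integrableOn_comp_preimage
      (Homeomorph.addRight (m : ℂ)).measurableEmbedding (f := N) (s := strip)).2
        (squareIntegrable f)
    exact h1.congr (ae_restrict_of_ae (hper m))
  have hloc : LocallyIntegrable N volume := by
    refine locallyIntegrable_iff.2 fun K hK => ?_
    obtain ⟨R, hR⟩ := hK.isBounded.subset_closedBall 0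
    have hu : IntegrableOn N (⋃ m ∈ Finset.Icc (-(⌈R⌉ + 1)) (⌈R⌉ + 1),
        (fun z : ℂ => z + (m : ℤ)) ⁻¹' strip) :=
      integrableOn_finset_iUnion.2 fun m _ => hshift m
    refine hu.mono_set fun z hz => ?_
    have h1 : ‖z‖ ≤ R := by simpa using hR hz
    have h2 := abs_le.1 ((abs_re_le_norm z).trans h1)
    have h3 := Int.le_ceil R
    have h4 := Int.floor_le z.re
    have h5 := Int.lt_floor_add_one z.re
    simp only [Set.mem_iUnion, Set.mem_preimage, strip, Set.mem_ofPred_eq, Finset.mem_Icc,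
      add_re, intCast_re]
    refine ⟨-⌊z.re⌋, ⟨?_, ?_⟩, ?_, ?_⟩
    · have : (⌊z.re⌋ : ℝ) ≤ ⌈R⌉ := by linarith
      have := Int.cast_le.1 this
      omega
    · have : (-⌈R⌉ - 1 : ℝ) ≤ ⌊z.re⌋ := by linarith
      have : -⌈R⌉ - 1 ≤ ⌊z.re⌋ := by exact_mod_cast this
      omega
    · push_cast; linarith
    · push_cast; linarith
  have hsq : LocallyIntegrable (fun z => 1 + N z * (weight ν z)⁻¹) volume := by
    refine (continuous_const (y := (1 : ℝ))).locallyIntegrable.add ?_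
    refine locallyIntegrable_iff.2 fun K hK => ?_
    exact (locallyIntegrable_iff.1 hloc K hK).mul_continuousOn
      ((continuous_weight ν).inv₀ fun z => (weight_pos ν z).ne').continuousOn hK
  refine hsq.mono (aesm f) (ae_of_all _ fun z => ?_)
  have hw := weight_pos ν z
  have : 1 + N z * (weight ν z)⁻¹ = 1 + ‖f z‖ ^ 2 := by
    simp only [hN]; field_simp
  rw [this, Real.norm_of_nonneg (by positivity)]
  nlinarith [sq_nonneg (‖f z‖ - 1), sq_nonneg (‖f z‖)]

/-! ### The differential operators -/

/-- `∂/∂z = (∂/∂x - i ∂/∂y) / 2`. -/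
def dz (f : ℂ → ℂ) (z : ℂ) : ℂ := (fderiv ℝ f z 1 - I * fderiv ℝ f z I) / 2

/-- `A = ∂/∂z̄ = (∂/∂x + i ∂/∂y) / 2`. -/
def opA (f : ℂ → ℂ) (z : ℂ) : ℂ := (fderiv ℝ f z 1 + I * fderiv ℝ f z I) / 2

/-- `A* = -∂/∂z + ν z̄`. -/
def opAStar (ν : ℝ) (f : ℂ → ℂ) (z : ℂ) : ℂ := -dz f z + ν * conj z * f z

/-- `Δ_ν = -∂²/∂z∂z̄ + ν z̄ ∂/∂z̄`, that is `A* A`, on smooth functions. -/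
def landau (ν : ℝ) (f : ℂ → ℂ) (z : ℂ) : ℂ := -dz (opA f) z + ν * conj z * opA f z

/-- `Δ_ν f = g` in the sense of distributions on the plane. The test functions are written
`φ̄ e^{-ν|z|²}` with `φ` smooth and compactly supported, which are all the smooth compactly
supported functions; the transpose of `Δ_ν` sends `φ̄ e^{-ν|z|²}` to `\overline{Δ_ν φ} e^{-ν|z|²}`,
because `A*` is the formal adjoint of `A` for the measure `e^{-ν|z|²} dm`. -/
def IsWeakLandau (ν : ℝ) (f g : ℂ → ℂ) : Prop :=
  ∀ φ : ℂ → ℂ, ContDiff ℝ ∞ φ → HasCompactSupport φ →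
    ∫ z, f z * conj (landau ν φ z) * weight ν z = ∫ z, g z * conj (φ z) * weight ν z

lemma integrable_test (f : L2Space ν α) {φ : ℂ → ℂ} (hφ : Continuous φ)
    (hc : HasCompactSupport φ) : Integrable (fun z => f z * conj (φ z) * weight ν z) := by
  have h := (locallyIntegrable f).integrable_smul_left_of_hasCompactSupport
    (g := fun z => conj (φ z) * weight ν z)
    ((continuous_conj.comp hφ).mul (continuous_ofReal.comp (continuous_weight ν)))
    ((hc.comp_left (g := conj) (map_zero _)).mul_right)
  refine h.congr (ae_of_all _ fun z => ?_)
  simp only [smul_eq_mul]; ring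

lemma contDiff_opA {f : ℂ → ℂ} (hf : ContDiff ℝ ∞ f) : ContDiff ℝ ∞ (opA f) := by
  have h := hf.fderiv_right (m := ∞) (by simp)
  unfold opA
  fun_prop

lemma contDiff_dz {f : ℂ → ℂ} (hf : ContDiff ℝ ∞ f) : ContDiff ℝ ∞ (dz f) := by
  have h := hf.fderiv_right (m := ∞) (by simp)
  unfold dz
  fun_prop

lemma compact_opA {f : ℂ → ℂ} (hf : HasCompactSupport f) : HasCompactSupport (opA f) := by
  refine (hf.fderiv ℝ).mono fun z hz => ?_
  contrapose! hz
  simp only [Function.mem_support, not_not] at hz ⊢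
  simp [opA, hz]

lemma compact_dz {f : ℂ → ℂ} (hf : HasCompactSupport f) : HasCompactSupport (dz f) := by
  refine (hf.fderiv ℝ).mono fun z hz => ?_
  contrapose! hz
  simp only [Function.mem_support, not_not] at hz ⊢
  simp [dz, hz]

lemma continuous_landau {φ : ℂ → ℂ} (hφ : ContDiff ℝ ∞ φ) : Continuous (landau ν φ) :=
  ((contDiff_dz (contDiff_opA hφ)).continuous.neg).add
    ((continuous_const.mul continuous_conj).mul (contDiff_opA hφ).continuous)

lemma compact_landau {φ : ℂ → ℂ} (hφ : HasCompactSupport φ) : HasCompactSupport (landau ν φ) :=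
  (compact_dz (compact_opA hφ)).neg.add ((compact_opA hφ).mul_left)

/-- The graph of `Δ_ν` in `L^{2,ν}_{Γ,α}`: the pairs `(f, g)` with `Δ_ν f = g`. -/
def landauGraph (ν α : ℝ) : Submodule ℂ (L2Space ν α × L2Space ν α) where
  carrier := {p | IsWeakLandau ν p.1 p.2}
  zero_mem' := by
    intro φ _ _
    have h0 : ∀ᵐ z, (0 : L2Space ν α) z = 0 := AEEqFun.coeFn_zero
    refine integral_congr_ae ?_
    filter_upwards [h0] with z hz
    simp [hz]
  add_mem' := by
    rintro ⟨f, g⟩ ⟨f', g'⟩ h h' φ hφ hc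
    have e1 := integral_add (integrable_test f (continuous_landau (ν := ν) hφ) (compact_landau hc))
      (integrable_test f' (continuous_landau (ν := ν) hφ) (compact_landau hc))
    have e2 := integral_add (integrable_test g hφ.continuous hc)
      (integrable_test g' hφ.continuous hc)
    calc _ = _ := integral_congr_ae (by
              filter_upwards [coeFn_add f f'] with z hz
              simp only [Prod.mk_add_mk, hz]; ring)
      _ = _ := e1
      _ = _ := congrArg₂ (· + ·) (h φ hφ hc) (h' φ hφ hc)
      _ = _ := e2.symm
      _ = _ := integral_congr_ae (by
              filter_upwards [coeFn_add g g'] with z hz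
              simp only [Prod.mk_add_mk, hz]; ring)
  smul_mem' := by
    rintro c ⟨f, g⟩ h φ hφ hc
    have e := congrArg (c * ·) (h φ hφ hc)
    simp only [← integral_const_mul] at e
    calc _ = _ := integral_congr_ae (by
              filter_upwards [coeFn_smul c f] with z hz
              simp only [Prod.smul_mk, hz]; ring)
      _ = _ := e
      _ = _ := integral_congr_ae (by
              filter_upwards [coeFn_smul c g] with z hz
              simp only [Prod.smul_mk, hz]; ring)

/-- The Landau operator `Δ_ν` acting on `L^{2,ν}_{Γ,α}`, as an unbounded operator: its domain
is the set of all `f` for which the distribution `Δ_ν f` belongs to `L^{2,ν}_{Γ,α}`. -/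
def landauOperator (ν α : ℝ) : L2Space ν α →ₗ.[ℂ] L2Space ν α := (landauGraph ν α).toLinearPMap

/-- A distribution `Δ_ν f` is represented by at most one element of `L^{2,ν}_{Γ,α}`. -/
lemma landauGraph_snd_eq_zero (p : L2Space ν α × L2Space ν α) (hp : p ∈ landauGraph ν α)
    (h0 : p.1 = 0) : p.2 = 0 := by
  obtain ⟨f, g⟩ := p
  simp only at h0
  subst h0
  have hz : ∀ᵐ z, (0 : L2Space ν α) z = 0 := AEEqFun.coeFn_zero
  have hli : LocallyIntegrable (fun z => (weight ν z : ℂ) * g z) volume := by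
    refine locallyIntegrable_iff.2 fun K hK => ?_
    exact (locallyIntegrable_iff.1 (locallyIntegrable g) K hK).continuousOn_mul
      (continuous_ofReal.comp (continuous_weight ν)).continuousOn hK
  have key : ∀ᵐ z, (weight ν z : ℂ) * g z = 0 := by
    refine ae_eq_zero_of_integral_contDiff_smul_eq_zero hli fun φ hφ hc => ?_
    have := hp (fun z => (φ z : ℂ)) (ofRealCLM.contDiff.comp hφ)
      (hc.comp_left (g := ((↑) : ℝ → ℂ)) ofReal_zero)
    have e1 : ∫ z, (0 : L2Space ν α) z * conj (landau ν (fun z => (φ z : ℂ)) z) * weight ν z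
        = 0 := by
      rw [← integral_zero ℂ ℂ (μ := volume)]
      refine integral_congr_ae ?_
      filter_upwards [hz] with z h
      simp [h]
    refine Eq.trans (integral_congr_ae (ae_of_all _ fun z => ?_)) (this.symm.trans e1)
    simp only [real_smul, conj_ofReal]; ring
  refine ae_zero_of_strip g ?_
  filter_upwards [key] with z h _
  exact (mul_eq_zero.1 h).resolve_left (by exact_mod_cast (weight_pos ν z).ne')

lemma mem_graph_landauOperator (p : L2Space ν α × L2Space ν α) :
    p ∈ (landauOperator ν α).graph ↔ IsWeakLandau ν p.1 p.2 := by
  rw [landauOperator, Submodule.toLinearPMap_graph_eq _ landauGraph_snd_eq_zero]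
  rfl

/-- The spectrum of an unbounded operator `T`: the complement of the set of `μ` for which
`T - μ` is a bijection from the domain of `T` onto the space, with a bounded inverse. -/
def unboundedSpectrum {H : Type*} [NormedAddCommGroup H] [NormedSpace ℂ H]
    (T : H →ₗ.[ℂ] H) : Set ℂ :=
  {μ | ∃ R : H →L[ℂ] H, (∀ h : H, ∃ hd : R h ∈ T.domain, T ⟨R h, hd⟩ - μ • R h = h) ∧
    ∀ f : T.domain, R (T f - μ • (f : H)) = f}ᶜ

/-- `E^{ν,λ}_{Γ,α} = {f ∈ L^{2,ν}_{Γ,α} ; Δ_ν f = ν λ f}`. -/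
def eigenspace (ν α : ℝ) (lam : ℂ) : Submodule ℂ (L2Space ν α) where
  carrier := {f | ∃ hd : f ∈ (landauOperator ν α).domain,
    landauOperator ν α ⟨f, hd⟩ = ((ν : ℂ) * lam) • f}
  zero_mem' := ⟨Submodule.zero_mem _, by
    rw [smul_zero]; exact (landauOperator ν α).toFun.map_zero⟩
  add_mem' := by
    rintro f g ⟨hf, hf'⟩ ⟨hg, hg'⟩
    refine ⟨Submodule.add_mem _ hf hg, ?_⟩
    rw [smul_add, ← hf', ← hg']
    exact (landauOperator ν α).toFun.map_add ⟨f, hf⟩ ⟨g, hg⟩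
  smul_mem' := by
    rintro c f ⟨hf, hf'⟩
    refine ⟨Submodule.smul_mem _ c hf, ?_⟩
    rw [smul_comm, ← hf']
    exact (landauOperator ν α).toFun.map_smul c ⟨f, hf⟩

/-- `O^{2,ν}_{Γ,α}`: the elements of `L^{2,ν}_{Γ,α}` that are (represented by) an entire function
satisfying the functional equation everywhere. -/
def holomorphicSpace (ν α : ℝ) : Submodule ℂ (L2Space ν α) where
  carrier := {f | ∃ g : ℂ → ℂ, Differentiable ℂ g ∧ IsQuasiPeriodic ν α g ∧ ∀ᵐ z, f z = g z}
  zero_mem' := ⟨fun _ => 0, differentiable_const 0, fun m z => by simp, AEEqFun.coeFn_zero⟩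
  add_mem' := by
    rintro f f' ⟨g, hg, hq, he⟩ ⟨g', hg', hq', he'⟩
    refine ⟨fun z => g z + g' z, hg.add hg', fun m z => ?_, ?_⟩
    · simp only [hq m z, hq' m z]; ring
    · filter_upwards [coeFn_add f f', he, he'] with z h1 h2 h3
      rw [h1, h2, h3]
  smul_mem' := by
    rintro c f ⟨g, hg, hq, he⟩
    refine ⟨fun z => c * g z, hg.const_mul c, fun m z => ?_, ?_⟩
    · simp only [hq m z]; ring
    · filter_upwards [coeFn_smul c f, he] with z h1 h2
      rw [h1, h2]

/-! ### The explicit functions -/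

/-- The (physicists') Hermite polynomials: `H_0 = 1`, `H_{m+1} = 2 X H_m - H_m'`. -/
def hermitePoly : ℕ → Polynomial ℝ
  | 0 => 1
  | m + 1 => 2 * Polynomial.X * hermitePoly m - Polynomial.derivative (hermitePoly m)

/-- `ψ_n^{α,ν}(z) = (2ν/π)^{1/4} e^{ν z²/2} e^{-π²(n+α)²/ν + 2iπ(α+n)z}`. -/
def psi (ν α : ℝ) (n : ℤ) (z : ℂ) : ℂ :=
  ((2 * ν / Real.pi) ^ (1 / 4 : ℝ) : ℝ) * exp (ν / 2 * z ^ 2) *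
    exp (-(Real.pi ^ 2 / ν) * (n + α) ^ 2 + 2 * I * Real.pi * (α + n) * z)

/-- `ψ_{m,n}^{α,ν}(z, z̄) = (2^m m!)^{-1/2} (2ν/π)^{1/4} e^{-π²(α+n)²/ν} e^{ν z²/2 + 2iπ(α+n)z}
H_m(√(2ν) y + √(2/ν) π (n+α))`, `z = x + iy`. -/
def psiHermite (ν α : ℝ) (m : ℕ) (n : ℤ) (z : ℂ) : ℂ :=
  ((((2 : ℝ) ^ m * m.factorial) ^ (-(1 / 2) : ℝ) * (2 * ν / Real.pi) ^ (1 / 4 : ℝ) *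
      Real.exp (-(Real.pi ^ 2 / ν) * (α + n) ^ 2) : ℝ) : ℂ) *
    exp (ν / 2 * z ^ 2 + 2 * I * Real.pi * (α + n) * z) *
    (((hermitePoly m).eval (√(2 * ν) * z.im + √(2 / ν) * Real.pi * (n + α)) : ℝ) : ℂ)

end RankOneTheta

end

noncomputable section

namespace RankOneTheta

/-! ### Hermite polynomials -/

/-! In the functions `ψ_n P(t_n)`, with `t_n` affine in `y`, the Landau operator becomes Hermite's
operator. Since `ψ_n` is entire, `A` only differentiates `P`; since `A* ψ_n = -i √(2ν) t_n ψ_n`,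
`A*` sends `P` to a multiple of `2XP - P'`. Hence `A* A` acts on polynomials as `(ν/2)(2X d/dX -
d²/dX²)`, with eigenvalue `νm` at `H_m`. Completing the square, `ψ_n \bar{ψ_k} e^{-ν|z|²}` is a
constant times `e^{2πi(n-k)x} e^{-t_n²/2} e^{-t_k²/2}`, so orthonormality of the `ψ_{m,n}` is
Fourier orthogonality in `x` and Hermite orthogonality in `y` (`orthonormal_psiVec`).

The system is complete (`eq_zero_of_inner_psiVec`): if `f` is orthogonal to it, then for each `n`
the `n`-th Fourier coefficient in `x` of a twist of `f`, times an exponential in `y`, has all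
moments zero. It also has exponential moments, so it vanishes, and then so does `f`. The space
itself is complete because restriction to the strip identifies it with an `L²` space.

The key statement is `isWeakLandau_iff`: `Δ_ν f = g` as distributions if and only if each `(m,n)`
coefficient of `g` is `νm` times that of `f`. For the forward direction the distribution is tested
against cutoffs of `ψ_{m,n}`. The cutoff in `x` is a partition of unity under integer translations,
so its derivatives disappear after unfolding to the strip; the cutoff in `y` is dilated away. The
converse holds because the graph is closed (`isClosed_landauGraph`) and contains the basis vectors
paired with their images. Thus the distributional operator is the maximal diagonal operator, from
which the spectrum, the eigenspaces and the Hilbert sum are read off.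

Smoothness comes from theta series: an element of the `m`-th eigenspace is `∑ c_n ψ_{m,n}` with
bounded `c_n`, and this converges locally uniformly to a polynomial in `y` with entire coefficients
(`tsum_psiPoly`). -/

lemma derivative_hermitePoly (m : ℕ) :
    Polynomial.derivative (hermitePoly (m + 1)) = (2 * (m + 1) : ℝ) • hermitePoly m := by
  induction m with
  | zero =>
    simp only [hermitePoly, mul_one, Polynomial.derivative_one, sub_zero, Polynomial.derivative_mul,
      Polynomial.derivative_X, Polynomial.derivative_ofNat, zero_mul, zero_add]
    rw [Polynomial.smul_eq_C_mul]; simp [← Polynomial.C_ofNat]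
  | succ m ih =>
    rw [hermitePoly, Polynomial.derivative_sub, Polynomial.derivative_mul, ih,
      Polynomial.derivative_smul]
    have h : hermitePoly (m + 1) =
        2 * Polynomial.X * hermitePoly m - Polynomial.derivative (hermitePoly m) := rfl
    simp only [Polynomial.derivative_mul, Polynomial.derivative_ofNat, Polynomial.derivative_X,
      Polynomial.smul_eq_C_mul]
    rw [h]
    simp only [map_mul, map_add, map_natCast, map_one, map_ofNat]
    push_cast
    ring

/-- Hermite's differential equation. -/
lemma hermitePoly_ode (m : ℕ) :
    2 * Polynomial.X * Polynomial.derivative (hermitePoly m)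
      - Polynomial.derivative (Polynomial.derivative (hermitePoly m))
      = (2 * m : ℝ) • hermitePoly m := by
  cases m with
  | zero => simp [hermitePoly]
  | succ m =>
    rw [derivative_hermitePoly, Polynomial.derivative_smul]
    have h : hermitePoly (m + 1) =
        2 * Polynomial.X * hermitePoly m - Polynomial.derivative (hermitePoly m) := rfl
    -- With `2(m+1)` factored out, the left-hand side is the recursion that defines `hermitePoly (m
    -- + 1)`.
    rw [h, mul_smul_comm, ← smul_sub]
    push_cast; rfl

lemma natDegree_hermitePoly_le (m : ℕ) : (hermitePoly m).natDegree ≤ m := by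
  induction m with
  | zero => simp [hermitePoly]
  | succ m ih =>
    refine (Polynomial.natDegree_sub_le _ _).trans (max_le ?_ ?_)
    · refine Polynomial.natDegree_mul_le.trans ?_
      have : (2 * Polynomial.X : Polynomial ℝ).natDegree ≤ 1 := by
        refine Polynomial.natDegree_mul_le.trans ?_
        simp [Polynomial.natDegree_X]
      omega
    · exact (Polynomial.natDegree_derivative_le _).trans (by omega)

lemma iterate_derivative_hermitePoly (m : ℕ) :
    Polynomial.derivative^[m] (hermitePoly m) = Polynomial.C (2 ^ m * m.factorial : ℝ) := by
  induction m with
  | zero => simp [hermitePoly]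
  | succ m ih =>
    rw [Function.iterate_succ_apply, derivative_hermitePoly, Polynomial.iterate_derivative_smul, ih,
      Polynomial.smul_C]
    congr 1
    rw [Nat.factorial_succ]; push_cast; simp only [smul_eq_mul]; ring

/-- The span contains `1` and is stable under multiplication by `X`, because `X H_m = (H_{m+1} +
H_m')/2` and `H_m'` is a multiple of the preceding Hermite polynomial. -/
lemma span_hermitePoly : Submodule.span ℝ (Set.range hermitePoly) = ⊤ := by
  have hmem : ∀ m, hermitePoly m ∈ Submodule.span ℝ (Set.range hermitePoly) :=
    fun m => Submodule.subset_span ⟨m, rfl⟩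
  have hX : ∀ p ∈ Submodule.span ℝ (Set.range hermitePoly),
      Polynomial.X * p ∈ Submodule.span ℝ (Set.range hermitePoly) := by
    intro p hp
    induction hp using Submodule.span_induction with
    | mem p hp =>
      obtain ⟨m, rfl⟩ := hp
      have h1 : Polynomial.derivative (hermitePoly m) ∈
          Submodule.span ℝ (Set.range hermitePoly) := by
        cases m with
        | zero => simp [hermitePoly]
        | succ m => rw [derivative_hermitePoly]; exact Submodule.smul_mem _ _ (hmem m)
      have h2 : Polynomial.X * hermitePoly m =
          (1 / 2 : ℝ) • (hermitePoly (m + 1) + Polynomial.derivative (hermitePoly m)) := by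
        have h3 : (Polynomial.C (1 / 2 : ℝ)) * 2 = 1 := by
          rw [← Polynomial.C_ofNat, ← map_mul]; norm_num
        rw [hermitePoly, Polynomial.smul_eq_C_mul]
        linear_combination (- Polynomial.X * hermitePoly m) * h3
      rw [h2]
      exact Submodule.smul_mem _ _ (Submodule.add_mem _ (hmem _) h1)
    | zero => simp
    | add p q _ _ h1 h2 => rw [mul_add]; exact Submodule.add_mem _ h1 h2
    | smul c p _ h => rw [mul_smul_comm]; exact Submodule.smul_mem _ _ h
  rw [eq_top_iff]
  rintro p -
  have hpow : ∀ n : ℕ, (Polynomial.X ^ n : Polynomial ℝ) ∈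
      Submodule.span ℝ (Set.range hermitePoly) := by
    intro n
    induction n with
    | zero => simpa [hermitePoly] using hmem 0
    | succ n ih => rw [pow_succ']; exact hX _ ih
  induction p using Polynomial.induction_on' with
  | add p q hp hq => exact Submodule.add_mem _ hp hq
  | monomial n a =>
    rw [← Polynomial.C_mul_X_pow_eq_monomial, ← Polynomial.smul_eq_C_mul]
    exact Submodule.smul_mem _ _ (hpow n)

/-! ### Gaussian integrals of polynomials -/

lemma integrable_polynomial_mul_gaussian (p : Polynomial ℝ) {b : ℝ} (hb : 0 < b) :
    Integrable fun t : ℝ => p.eval t * Real.exp (-b * t ^ 2) := by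
  induction p using Polynomial.induction_on' with
  | add p q hp hq =>
    refine (hp.add hq).congr (ae_of_all _ fun t => ?_)
    simp only [Polynomial.eval_add, add_mul, Pi.add_apply]
  | monomial n a =>
    have h := (integrable_rpow_mul_exp_neg_mul_sq hb (s := n)
      (lt_of_lt_of_le (by norm_num) (Nat.cast_nonneg n))).const_mul a
    simpa only [Polynomial.eval_monomial, Real.rpow_natCast, mul_assoc] using h

/-- Integration by parts: `H_{m+1} e^{-t²}` is the derivative of `-H_m e^{-t²}`. -/
lemma integral_hermitePoly_succ_mul (m : ℕ) (p : Polynomial ℝ) :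
    ∫ t : ℝ, (hermitePoly (m + 1) * p).eval t * Real.exp (-1 * t ^ 2) =
      ∫ t : ℝ, (hermitePoly m * Polynomial.derivative p).eval t * Real.exp (-1 * t ^ 2) := by
  have hv : ∀ t : ℝ, HasDerivAt (fun t => -((hermitePoly m).eval t * Real.exp (-1 * t ^ 2)))
      ((hermitePoly (m + 1)).eval t * Real.exp (-1 * t ^ 2)) t := by
    intro t
    have h1 := (hermitePoly m).hasDerivAt t
    have h2 : HasDerivAt (fun t : ℝ => Real.exp (-1 * t ^ 2))
        (Real.exp (-1 * t ^ 2) * (-1 * (2 * t))) t := by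
      have := (((hasDerivAt_pow 2 t).const_mul (-1 : ℝ))).exp
      simpa using this
    refine (h1.mul h2).neg.congr_deriv ?_
    simp only [hermitePoly, Polynomial.eval_sub, Polynomial.eval_mul, Polynomial.eval_X,
      Polynomial.eval_ofNat]
    ring
  have key := integral_mul_deriv_eq_deriv_mul_of_integrable (fun t _ => p.hasDerivAt t)
    (fun t _ => hv t) ?_ ?_ ?_
  · calc _ = _ := integral_congr_ae (ae_of_all _ fun t => by
            simp only [Polynomial.eval_mul]; ring)
      _ = _ := key
      _ = _ := by
            rw [← integral_neg]
            exact integral_congr_ae (ae_of_all _ fun t => by simp only [Polynomial.eval_mul]; ring)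
  · refine (integrable_polynomial_mul_gaussian (p * hermitePoly (m + 1)) one_pos).congr
      (ae_of_all _ fun t => ?_)
    simp only [Pi.mul_apply, Polynomial.eval_mul]; ring
  · refine (integrable_polynomial_mul_gaussian (-(Polynomial.derivative p * hermitePoly m))
      one_pos).congr (ae_of_all _ fun t => ?_)
    simp only [Pi.mul_apply, Polynomial.eval_mul, Polynomial.eval_neg]; ring
  · refine (integrable_polynomial_mul_gaussian (-(p * hermitePoly m))
      one_pos).congr (ae_of_all _ fun t => ?_)
    simp only [Pi.mul_apply, Polynomial.eval_mul, Polynomial.eval_neg]; ring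

/-- This gives both norms and orthogonality: the `m`-th derivative of `H_m` is the constant `2^m
m!`, while that of a polynomial of lower degree is zero. -/
lemma integral_hermitePoly_mul (m : ℕ) (p : Polynomial ℝ) :
    ∫ t : ℝ, (hermitePoly m * p).eval t * Real.exp (-1 * t ^ 2) =
      ∫ t : ℝ, (Polynomial.derivative^[m] p).eval t * Real.exp (-1 * t ^ 2) := by
  induction m generalizing p with
  | zero => simp [hermitePoly]
  | succ m ih => rw [integral_hermitePoly_succ_mul, ih, Function.iterate_succ_apply]

lemma integral_hermitePoly_self (m : ℕ) :
    ∫ t : ℝ, (hermitePoly m * hermitePoly m).eval t * Real.exp (-1 * t ^ 2) =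
      2 ^ m * m.factorial * √Real.pi := by
  rw [integral_hermitePoly_mul, iterate_derivative_hermitePoly]
  simp only [Polynomial.eval_C]
  rw [integral_const_mul, integral_gaussian, div_one]

lemma integral_hermitePoly_of_ne {m k : ℕ} (h : m ≠ k) :
    ∫ t : ℝ, (hermitePoly m * hermitePoly k).eval t * Real.exp (-1 * t ^ 2) = 0 := by
  wlog hlt : k < m generalizing m k
  · rw [mul_comm]; exact this h.symm (by omega)
  rw [integral_hermitePoly_mul, Polynomial.iterate_derivative_eq_zero
    ((natDegree_hermitePoly_le k).trans_lt hlt)]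
  simp

/-! ### Uniqueness for the moment problem and for Fourier coefficients -/

/-- An integrable function on the line whose Fourier transform vanishes is zero. -/
lemma ae_eq_zero_of_fourier_eq_zero {u : ℝ → ℂ} (hu : Integrable u)
    (h : ∀ ξ : ℝ, ∫ y : ℝ, exp (ξ * y * I) * u y = 0) : ∀ᵐ y, u y = 0 := by
  refine ae_eq_zero_of_integral_contDiff_smul_eq_zero hu.locallyIntegrable fun φ hφ hc => ?_
  have hF : ∀ ξ : ℝ, VectorFourier.fourierIntegral Real.fourierChar volume (innerₗ ℝ) u ξ = 0 := by
    intro ξ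
    -- The frequency is rescaled to match the character `e^{-2πi yξ}`.
    rw [VectorFourier.fourierIntegral, ← h (-(2 * Real.pi * ξ))]
    refine integral_congr_ae (ae_of_all _ fun y => ?_)
    simp only [Circle.smul_def, Real.fourierChar_apply, smul_eq_mul, innerₗ_apply_apply,
      RCLike.inner_apply, conj_trivial]
    congr 2; push_cast; ring
  -- The test function is written as the Fourier transform of a Schwartz function `Ψ`;
  -- self-adjointness of the transform then moves it onto `u`, where it vanishes.
  set Φ : SchwartzMap ℝ ℂ := (hc.comp_left (g := ((↑) : ℝ → ℂ)) ofReal_zero).toSchwartzMap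
    (ofRealCLM.contDiff.comp hφ) with hΦ
  set Ψ := FourierTransformInv.fourierInv Φ with hΨ
  have hΨΦ : FourierTransform.fourier Ψ = Φ := FourierTransform.fourier_fourierInv_eq Φ
  have key := VectorFourier.integral_fourierIntegral_smul_eq_flip (L := innerₗ ℝ)
    (μ := volume) (ν := volume) Real.continuous_fourierChar continuous_inner hu
    (Ψ.integrable (μ := volume))
  simp only [hF, zero_smul, integral_zero] at key
  rw [key]
  refine integral_congr_ae (ae_of_all _ fun y => ?_)
  have e : VectorFourier.fourierIntegral Real.fourierChar volume (innerₗ ℝ).flip (⇑Ψ) y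
      = (φ y : ℂ) := by
    have e1 : (FourierTransform.fourier Ψ) y = Φ y := by rw [hΨΦ]
    have e2 : Φ y = (φ y : ℂ) := rfl
    rw [← e2, ← e1, SchwartzMap.fourier_coe, flip_innerₗ]
    rfl
  simp only [e, real_smul, smul_eq_mul]
  ring

/-- A function with exponential moments all of whose polynomial moments vanish is zero. -/
lemma ae_eq_zero_of_moments {u : ℝ → ℂ} (hu : ∀ a : ℝ, Integrable fun y => u y * Real.exp (a * |y|))
    (h : ∀ k : ℕ, ∫ y : ℝ, u y * (y : ℂ) ^ k = 0) : ∀ᵐ y, u y = 0 := by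
  have hu0 : Integrable u := by simpa using hu 0
  refine ae_eq_zero_of_fourier_eq_zero hu0 fun ξ => ?_
  -- The exponential is expanded in its power series and integrated term by term. The absolute
  -- series sums to `|u| e^{|ξ||y|}`, integrable by the hypothesis at `a = |ξ|`.
  have hs := hasSum_integral_of_dominated_convergence (μ := volume)
    (F := fun (k : ℕ) (y : ℝ) => ((ξ * y * I) ^ k / k.factorial : ℂ) * u y)
    (f := fun y => exp (ξ * y * I) * u y)
    (bound := fun k y => (|ξ| * |y|) ^ k / k.factorial * ‖u y‖) ?_ ?_ ?_ ?_ ?_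
  · refine hs.unique ?_
    convert hasSum_zero with k
    calc _ = ∫ y : ℝ, ((ξ * I) ^ k / k.factorial : ℂ) * (u y * (y : ℂ) ^ k) :=
          integral_congr_ae (ae_of_all _ fun y => by ring)
      _ = 0 := by rw [integral_const_mul, h, mul_zero]
  · intro k
    exact (Continuous.aestronglyMeasurable (by fun_prop)).mul hu0.aestronglyMeasurable
  · refine fun k => ae_of_all _ fun y => le_of_eq ?_
    simp [mul_pow]
  · exact ae_of_all _ fun y => (Real.summable_pow_div_factorial _).mul_right _
  · have : (fun y : ℝ => ∑' k : ℕ, (|ξ| * |y|) ^ k / k.factorial * ‖u y‖) =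
        fun y => ‖u y * Real.exp (|ξ| * |y|)‖ := by
      funext y
      rw [tsum_mul_right, norm_mul, Complex.norm_real, Real.norm_of_nonneg (Real.exp_nonneg _),
        Real.exp_eq_exp_ℝ, NormedSpace.exp_eq_tsum_div, mul_comm]
    rw [this]
    exact (hu |ξ|).norm
  · refine ae_of_all _ fun y => HasSum.mul_right _ ?_
    have := NormedSpace.expSeries_div_hasSum_exp (ξ * y * I : ℂ)
    rwa [← Complex.exp_eq_exp_ℂ] at this

/-- A square integrable function on `[0,1]` with vanishing Fourier coefficients is zero. -/
lemma ae_eq_zero_of_fourierCoeff {F : ℝ → ℂ} (hF : MemLp F 2 (volume.restrict (Set.Icc 0 1)))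
    (h : ∀ n : ℤ, ∫ x in Set.Icc (0 : ℝ) 1, F x * exp (-(2 * I * Real.pi * n * x)) = 0) :
    ∀ᵐ x ∂(volume.restrict (Set.Icc (0 : ℝ) 1)), F x = 0 := by
  have hr : (volume : Measure ℝ).restrict (Set.Icc 0 1) = volume.restrict (Set.Ioc 0 1) :=
    Measure.restrict_congr_set Ioc_ae_eq_Icc.symm
  rw [hr] at hF ⊢
  -- Parseval: vanishing coefficients force the `L²` norm to vanish.
  have hs := hasSum_sq_fourierCoeffOn zero_lt_one hF
  have h0 : ∀ n, fourierCoeffOn zero_lt_one F n = 0 := by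
    intro n
    rw [fourierCoeffOn_eq_integral, intervalIntegral.integral_of_le zero_le_one, ← hr]
    have : ∫ x in Set.Icc (0 : ℝ) 1, (fourier (-n) (x : AddCircle ((1 : ℝ) - 0)) : ℂ) • F x = 0 := by
      rw [← h n]
      refine integral_congr_ae (ae_of_all _ fun x => ?_)
      simp only [smul_eq_mul, fourier_coe_apply]
      rw [mul_comm]
      congr 2
      push_cast; ring
    rw [this, smul_zero]
  simp only [h0, norm_zero, ne_eq, OfNat.ofNat_ne_zero, not_false_eq_true, zero_pow] at hs
  have h1 := hs.unique hasSum_zero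
  rw [intervalIntegral.integral_of_le zero_le_one] at h1
  simp only [sub_zero, inv_one, one_smul] at h1
  have h2 : Integrable (fun x => ‖F x‖ ^ 2) (volume.restrict (Set.Ioc (0 : ℝ) 1)) := by
    simpa using hF.integrable_norm_pow (p := 2) (by norm_num)
  rw [integral_eq_zero_iff_of_nonneg (fun x => by positivity) h2] at h1
  filter_upwards [h1] with x hx
  simpa using hx

/-! ### Integration over the strip -/

/-- The coordinates of the strip as a measure preserving map. -/
lemma measurePreserving_strip :
    MeasurePreserving (fun p : ℝ × ℝ => (⟨p.1, p.2⟩ : ℂ))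
      ((volume.restrict (Set.Icc (0 : ℝ) 1)).prod volume) (volume.restrict strip) := by
  have h := (volume_preserving_equiv_real_prod.symm).restrict_preimage measurableSet_strip
  have hs : measurableEquivRealProd.symm ⁻¹' strip = Set.Icc (0 : ℝ) 1 ×ˢ Set.univ := by
    ext p
    simp [strip, measurableEquivRealProd]
  have hm : (volume.restrict (Set.Icc (0 : ℝ) 1)).prod (volume : Measure ℝ)
      = volume.restrict (Set.Icc (0 : ℝ) 1 ×ˢ Set.univ) := by
    rw [Measure.volume_eq_prod, ← Measure.prod_restrict, Measure.restrict_univ]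
  rw [hs, ← hm] at h
  exact h

lemma measurableEmbedding_mk : MeasurableEmbedding (fun p : ℝ × ℝ => (⟨p.1, p.2⟩ : ℂ)) :=
  measurableEquivRealProd.symm.measurableEmbedding

lemma integrableOn_strip_iff {E : Type*} [NormedAddCommGroup E] {F : ℂ → E} :
    IntegrableOn F strip ↔ Integrable (fun p : ℝ × ℝ => F ⟨p.1, p.2⟩)
      ((volume.restrict (Set.Icc (0 : ℝ) 1)).prod volume) :=
  (measurePreserving_strip.integrable_comp_emb measurableEmbedding_mk).symm

lemma setIntegral_strip {E : Type*} [NormedAddCommGroup E] [NormedSpace ℝ E] (F : ℂ → E) :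
    ∫ z in strip, F z = ∫ p : ℝ × ℝ, F ⟨p.1, p.2⟩
      ∂((volume.restrict (Set.Icc (0 : ℝ) 1)).prod volume) :=
  (measurePreserving_strip.integral_comp measurableEmbedding_mk F).symm

lemma ae_strip_iff {p : ℂ → Prop} :
    (∀ᵐ z ∂(volume.restrict strip), p z) ↔
      ∀ᵐ q ∂((volume.restrict (Set.Icc (0 : ℝ) 1)).prod (volume : Measure ℝ)),
        p ⟨q.1, q.2⟩ := by
  rw [← measurePreserving_strip.map_eq, measurableEmbedding_mk.ae_map_iff]

/-- Adjacent closed strips share only a vertical line, so their overlap is negligible. -/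
lemma volume_re_eq (c : ℝ) : volume {z : ℂ | z.re = c} = 0 := by
  have h := volume_preserving_equiv_real_prod.measure_preimage_equiv (({c} : Set ℝ) ×ˢ Set.univ)
  have hs : measurableEquivRealProd ⁻¹' (({c} : Set ℝ) ×ˢ Set.univ) = {z : ℂ | z.re = c} := by
    ext z
    simp [measurableEquivRealProd]
  rw [hs] at h
  rw [h, Measure.volume_eq_prod, Measure.prod_prod]
  simp

/-- A function on the plane that is `ℤ`-periodic almost everywhere. -/
def IsPeriodicAE {E : Type*} (P : ℂ → E) : Prop := ∀ m : ℤ, ∀ᵐ z : ℂ, P (z + m) = P z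

/-- The translate of the strip by `-m`. -/
def stripShift (m : ℤ) : Set ℂ := (fun z : ℂ => z + m) ⁻¹' strip

lemma mem_stripShift {m : ℤ} {z : ℂ} : z ∈ stripShift m ↔ 0 ≤ z.re + m ∧ z.re + m ≤ 1 := by
  simp [stripShift, strip]

lemma measurableSet_stripShift (m : ℤ) : MeasurableSet (stripShift m) :=
  measurableSet_strip.preimage (measurable_add_const _)

lemma measurePreserving_stripShift (m : ℤ) :
    MeasurePreserving (fun z : ℂ => z + m) (volume.restrict (stripShift m))
      (volume.restrict strip) :=
  (measurePreserving_add_right (volume : Measure ℂ) (m : ℂ)).restrict_preimage measurableSet_strip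

section Periodic

variable {E : Type*} [NormedAddCommGroup E] {P : ℂ → E}

lemma IsPeriodicAE.integrableOn_stripShift (hP : IsPeriodicAE P) (hi : IntegrableOn P strip)
    (m : ℤ) : IntegrableOn P (stripShift m) :=
  (((measurePreserving_stripShift m).integrable_comp_emb
    (Homeomorph.addRight (m : ℂ)).measurableEmbedding).2 hi).congr (ae_restrict_of_ae (hP m))

lemma IsPeriodicAE.setIntegral_stripShift [NormedSpace ℝ E] (hP : IsPeriodicAE P) (m : ℤ) :
    ∫ z in stripShift m, P z = ∫ z in strip, P z := by
  rw [← (measurePreserving_stripShift m).integral_comp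
    (Homeomorph.addRight (m : ℂ)).measurableEmbedding P]
  refine integral_congr_ae (ae_restrict_of_ae ?_)
  filter_upwards [hP m] with z hz using hz.symm

end Periodic

lemma IsPeriodicAE.setIntegral_stripShift_mul {P : ℂ → ℂ} (hP : IsPeriodicAE P) (k : ℂ → ℂ)
    (m : ℤ) : ∫ z in stripShift m, k z * P z = ∫ z in strip, k (z - m) * P z := by
  rw [← (measurePreserving_stripShift m).integral_comp
    (Homeomorph.addRight (m : ℂ)).measurableEmbedding (fun z => k (z - m) * P z)]
  refine integral_congr_ae (ae_restrict_of_ae ?_)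
  filter_upwards [hP m] with z hz
  simp only [hz, add_sub_cancel_right]

/-- Unfolding an integral against a kernel that is supported in two adjacent strips. -/
lemma IsPeriodicAE.integral_kernel_mul {P : ℂ → ℂ} (hP : IsPeriodicAE P)
    (hi : IntegrableOn P strip) {k : ℂ → ℂ} (hk : Continuous k) {C : ℝ} (hC : ∀ z, ‖k z‖ ≤ C)
    (h0 : ∀ z : ℂ, z.re < 0 ∨ 2 < z.re → k z = 0) :
    Integrable (fun z => k z * P z) ∧
      ∫ z, k z * P z = ∫ z in strip, (k z + k (z + 1)) * P z := by
  have hstrip : strip = stripShift 0 := by ext z; simp [stripShift]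
  have hm : ∀ m, IntegrableOn (fun z => k z * P z) (stripShift m) := fun m =>
    (hP.integrableOn_stripShift hi m).bdd_mul hk.aestronglyMeasurable
      (ae_of_all _ hC)
  have hk1 : IntegrableOn (fun z => k (z + 1) * P z) strip :=
    hi.bdd_mul (c := C) (by fun_prop : Continuous fun z => k (z + 1)).aestronglyMeasurable
      (ae_of_all _ fun z => hC _)
  -- `stripShift` is a preimage, so `stripShift (-1)` is the strip `1 ≤ x ≤ 2`; together with
  -- `stripShift 0` it covers the support of the kernel.
  have hsupp : ∀ z, z ∉ stripShift 0 ∪ stripShift (-1) → k z * P z = 0 := by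
    intro z hz
    rw [h0 z, zero_mul]
    by_contra! h
    apply hz
    simp only [Set.mem_union, mem_stripShift]
    push_cast
    rcases le_total z.re 1 with h1 | h1
    · left; constructor <;> linarith
    · right; constructor <;> linarith
  have hint : Integrable (fun z => k z * P z) :=
    (integrableOn_iff_integrable_of_support_subset
      (fun z hz => by by_contra h; exact hz (hsupp z h))).1 ((hm 0).union (hm (-1)))
  refine ⟨hint, ?_⟩
  have hdisj : AEDisjoint volume (stripShift 0) (stripShift (-1)) := by
    refine measure_mono_null (fun z hz => ?_) (volume_re_eq 1)
    obtain ⟨h1, h2⟩ := hz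
    rw [mem_stripShift] at h1 h2
    push_cast at h1 h2
    simp only [Set.mem_ofPred_eq]
    linarith
  rw [← setIntegral_eq_integral_of_forall_compl_eq_zero hsupp,
    setIntegral_union₀ hdisj (measurableSet_stripShift _).nullMeasurableSet (hm 0) (hm (-1)),
    hP.setIntegral_stripShift_mul, hP.setIntegral_stripShift_mul, ← integral_add]
  · refine integral_congr_ae (ae_of_all _ fun z => ?_)
    simp only [Int.cast_zero, sub_zero, Int.cast_neg, Int.cast_one, sub_neg_eq_add]
    ring
  · simpa [hstrip, IntegrableOn] using hm 0
  · simpa [IntegrableOn] using hk1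

/-- Finitely many translates contribute the same integral each. With `P = |f|² e^{-ν|z|²}` this
controls `f` on wide strips by its norm, which makes test integrals continuous in `f`. -/
lemma IsPeriodicAE.exists_integral_bound {P : ℂ → ℝ} (hP : IsPeriodicAE P)
    (hi : IntegrableOn P strip) (h0 : ∀ z, 0 ≤ P z) (M : ℕ) :
    IntegrableOn P (⋃ m : Set.Icc (-M : ℤ) M, stripShift m) ∧
    ∫ z in ⋃ m : Set.Icc (-M : ℤ) M, stripShift m, P z
      ≤ Fintype.card (Set.Icc (-M : ℤ) M) * ∫ z in strip, P z := by
  have hle := Measure.restrict_iUnion_le (μ := (volume : Measure ℂ))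
    (s := fun m : Set.Icc (-M : ℤ) M => stripShift m)
  rw [Measure.sum_fintype] at hle
  have hint : Integrable P (∑ m : Set.Icc (-M : ℤ) M, volume.restrict (stripShift m)) :=
    integrable_finsetSum_measure.2 fun m _ => hP.integrableOn_stripShift hi m
  refine ⟨hint.mono_measure hle, (integral_mono_measure hle (ae_of_all _ h0) hint).trans ?_⟩
  rw [integral_finsetSum_measure
    fun (m : Set.Icc (-M : ℤ) M) _ => hP.integrableOn_stripShift hi (m : ℤ)]
  simp only [hP.setIntegral_stripShift]
  simp

lemma subset_iUnion_stripShift (M : ℕ) :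
    {z : ℂ | |z.re| ≤ M} ⊆ ⋃ m : Set.Icc (-M : ℤ) M, stripShift m := by
  intro z hz
  simp only [Set.mem_ofPred_eq, abs_le] at hz
  simp only [Set.mem_iUnion]
  refine ⟨⟨-⌊z.re⌋, ?_⟩, ?_⟩
  · rw [Set.mem_Icc]
    have h1 : (-M : ℤ) ≤ ⌊z.re⌋ := Int.le_floor.2 (by push_cast; linarith)
    have h2 : ⌊z.re⌋ ≤ (M : ℤ) := by
      have : (⌊z.re⌋ : ℝ) ≤ M := (Int.floor_le _).trans hz.2
      exact_mod_cast this
    omega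
  · rw [mem_stripShift]
    push_cast
    constructor <;> linarith [Int.floor_le z.re, Int.lt_floor_add_one z.re]

/-! ### Products of quasi-periodic functions are periodic -/

variable {ν α : ℝ}

/-- Since `|z+m|² - |z|² = 2mx + m²`, the weight changes under translation by exactly the inverse of
`|factor|²`. This is why integrands such as `f \bar h e^{-ν|z|²}` are periodic and can be unfolded.
-/
lemma norm_factor_sq_mul_weight (ν α : ℝ) (m : ℤ) (z : ℂ) :
    factor ν α m z * conj (factor ν α m z) * (weight ν (z + m) : ℂ) = weight ν z := by
  have e1 : (2 * I * Real.pi * α * m : ℂ).re = 0 := by simp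
  have e2 : ((ν : ℂ) * (z + m / 2) * m).re = ν * (z.re + m / 2) * m := by
    simp [mul_re]
  have e3 : ‖factor ν α m z‖ = Real.exp (ν * (z.re + m / 2) * m) := by
    rw [factor, norm_mul, norm_exp, norm_exp, e1, e2, Real.exp_zero, one_mul]
  rw [mul_conj, normSq_eq_norm_sq, e3, ← ofReal_mul]
  congr 1
  rw [weight, weight, ← Real.exp_nat_mul, ← Real.exp_add, ← normSq_eq_norm_sq,
    ← normSq_eq_norm_sq, normSq_apply, normSq_apply]
  simp only [add_re, add_im, intCast_re, intCast_im, add_zero]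
  congr 1
  push_cast; ring

lemma IsQuasiPeriodic.ae {f : ℂ → ℂ} (h : IsQuasiPeriodic ν α f) : IsQuasiPeriodicAE ν α f :=
  fun m => ae_of_all _ (h m)

lemma IsQuasiPeriodicAE.isPeriodicAE {f h : ℂ → ℂ} (hf : IsQuasiPeriodicAE ν α f)
    (hh : IsQuasiPeriodicAE ν α h) : IsPeriodicAE fun z => f z * conj (h z) * weight ν z := by
  intro m
  filter_upwards [hf m, hh m] with z h1 h2
  rw [h1, h2, map_mul, ← norm_factor_sq_mul_weight ν α m z]
  ring

lemma mul_conj_mul_weight (a : ℂ) (z : ℂ) :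
    a * conj a * weight ν z = ((‖a‖ ^ 2 * weight ν z : ℝ) : ℂ) := by
  rw [mul_conj, normSq_eq_norm_sq]; push_cast; ring

lemma IsQuasiPeriodicAE.isPeriodicAE_sq {f : ℂ → ℂ} (hf : IsQuasiPeriodicAE ν α f) :
    IsPeriodicAE fun z => ‖f z‖ ^ 2 * weight ν z := by
  intro m
  filter_upwards [hf.isPeriodicAE hf m] with z h1
  rw [mul_conj_mul_weight, mul_conj_mul_weight] at h1
  exact_mod_cast h1

/-! ### Elements of the space and their norms -/

/-- The element of `L^{2,ν}_{Γ,α}` represented by a function. -/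
def ofFun (f : ℂ → ℂ) (hm : AEStronglyMeasurable f volume) (hq : IsQuasiPeriodicAE ν α f)
    (hs : IsSquareIntegrable ν f) : L2Space ν α :=
  ⟨AEEqFun.mk f hm, by
    have h := AEEqFun.coeFn_mk f hm
    refine ⟨fun m => ?_, hs.congr (ae_restrict_of_ae ?_)⟩
    · filter_upwards [h, ae_translate m h, hq m] with z h1 h2 h3
      rw [h1, h2, h3]
    · filter_upwards [h] with z h1
      rw [h1]⟩

lemma coeFn_ofFun (f : ℂ → ℂ) (hm : AEStronglyMeasurable f volume)
    (hq : IsQuasiPeriodicAE ν α f) (hs : IsSquareIntegrable ν f) :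
    ∀ᵐ z, (ofFun f hm hq hs) z = f z := AEEqFun.coeFn_mk f hm

lemma L2Space.ext {f g : L2Space ν α} (h : ∀ᵐ z, f z = g z) : f = g :=
  Subtype.ext (AEEqFun.ext h)

lemma norm_sq_eq (f : L2Space ν α) : ‖f‖ ^ 2 = ∫ z in strip, ‖f z‖ ^ 2 * weight ν z := by
  have h := inner_self_eq_norm_sq_to_K (𝕜 := ℂ) f
  rw [inner_def] at h
  simp only [mul_conj_mul_weight] at h
  rw [integral_complex_ofReal, ← RCLike.ofReal_pow] at h
  exact (Complex.ofReal_inj.1 h).symm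

/-! ### Test functions as continuous functionals -/

lemma HasCompactSupport.exists_re_bound {k : ℂ → ℂ} (hc : HasCompactSupport k) :
    ∃ M : ℕ, ∀ z, k z ≠ 0 → |z.re| ≤ M := by
  obtain ⟨R, hR⟩ := hc.isCompact.isBounded.subset_closedBall 0
  obtain ⟨M, hM⟩ := exists_nat_ge R
  refine ⟨M, fun z hz => (abs_re_le_norm z).trans (le_trans ?_ hM)⟩
  simpa using hR (subset_tsupport _ hz)

/-- Integration against a continuous compactly supported function is a continuous functional. -/
lemma exists_testFunctional {k : ℂ → ℂ} (hk : Continuous k) (hc : HasCompactSupport k) :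
    ∃ T : L2Space ν α →L[ℂ] ℂ, ∀ f, T f = ∫ z, f z * conj (k z) * weight ν z := by
  let L : L2Space ν α →ₗ[ℂ] ℂ :=
    { toFun := fun f => ∫ z, f z * conj (k z) * weight ν z
      map_add' := fun f g => by
        rw [← integral_add (integrable_test f hk hc) (integrable_test g hk hc)]
        refine integral_congr_ae ?_
        filter_upwards [coeFn_add f g] with z hz
        rw [hz]; ring
      map_smul' := fun c f => by
        rw [RingHom.id_apply, smul_eq_mul, ← integral_const_mul]
        refine integral_congr_ae ?_
        filter_upwards [coeFn_smul c f] with z hz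
        rw [hz]; ring }
  obtain ⟨M, hM⟩ := HasCompactSupport.exists_re_bound hc
  set K := ⋃ m : Set.Icc (-M : ℤ) M, stripShift m with hK
  have hk2 : Integrable (fun z => ‖k z‖ ^ 2 * weight ν z) := by
    refine Continuous.integrable_of_hasCompactSupport ?_ ?_
    · have := continuous_weight ν; fun_prop
    · exact (hc.comp_left (g := fun c => ‖c‖ ^ 2) (by simp)).mul_right
  set D := ∫ z, ‖k z‖ ^ 2 * weight ν z with hD
  -- A bound on the unit ball suffices for a linear functional. There `|f k| ≤ |f|² + |k|²` reduces
  -- the estimate to finitely many translates of the strip, on which the weighted integral of `|f|²`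
  -- is known.
  have hbound : ∀ f ∈ Metric.closedBall (0 : L2Space ν α) 1,
      ‖L f‖ ≤ Fintype.card (Set.Icc (-M : ℤ) M) + D := by
    intro f hf
    have hf1 : ‖f‖ ≤ 1 := by simpa using hf
    obtain ⟨h1, h2⟩ := (quasiPeriodic f).isPeriodicAE_sq.exists_integral_bound
      (squareIntegrable f) (fun z => mul_nonneg (sq_nonneg _) (weight_pos ν z).le) M
    rw [← norm_sq_eq] at h2
    have hsupp : ∀ z, z ∉ K → f z * conj (k z) * weight ν z = 0 := by
      intro z hz
      have : k z = 0 := by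
        by_contra h
        exact hz (subset_iUnion_stripShift M (hM z h))
      simp [this]
    calc ‖L f‖ = ‖∫ z in K, f z * conj (k z) * weight ν z‖ := by
          rw [setIntegral_eq_integral_of_forall_compl_eq_zero hsupp]; rfl
      _ ≤ ∫ z in K, (‖f z‖ ^ 2 * weight ν z + ‖k z‖ ^ 2 * weight ν z) := by
          refine norm_integral_le_of_norm_le (h1.add hk2.integrableOn) (ae_of_all _ fun z => ?_)
          have hw := weight_pos ν z
          rw [norm_mul, norm_mul, RCLike.norm_conj, Complex.norm_real, Real.norm_of_nonneg hw.le,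
            ← add_mul]
          refine mul_le_mul_of_nonneg_right ?_ hw.le
          nlinarith [sq_nonneg (‖f z‖ - ‖k z‖), sq_nonneg (‖f z‖), sq_nonneg (‖k z‖)]
      _ = (∫ z in K, ‖f z‖ ^ 2 * weight ν z) + ∫ z in K, ‖k z‖ ^ 2 * weight ν z :=
          integral_add h1 hk2.integrableOn
      _ ≤ Fintype.card (Set.Icc (-M : ℤ) M) * ‖f‖ ^ 2 + D :=
          add_le_add h2 (setIntegral_le_integral hk2
            (ae_of_all _ fun z => mul_nonneg (sq_nonneg _) (weight_pos ν z).le))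
      _ ≤ Fintype.card (Set.Icc (-M : ℤ) M) + D := by
          have : ‖f‖ ^ 2 ≤ 1 := pow_le_one₀ (norm_nonneg _) hf1
          have h3 : (0 : ℝ) ≤ Fintype.card (Set.Icc (-M : ℤ) M) := Nat.cast_nonneg _
          nlinarith
  exact ⟨L.mkContinuous _ fun f => LinearMap.bound_of_ball_bound' one_pos _ L hbound f,
    fun f => rfl⟩

/-- Each test function imposes equality of two continuous functionals, so the graph is an
intersection of closed sets. Closedness lets infinite expansions be passed through `Δ_ν`. -/
lemma isClosed_landauGraph : IsClosed (landauGraph ν α : Set (L2Space ν α × L2Space ν α)) := by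
  have h : (landauGraph ν α : Set (L2Space ν α × L2Space ν α)) =
      ⋂ (φ : ℂ → ℂ) (_ : ContDiff ℝ ∞ φ) (_ : HasCompactSupport φ),
        {p | ∫ z, p.1 z * conj (landau ν φ z) * weight ν z
          = ∫ z, p.2 z * conj (φ z) * weight ν z} := by
    ext p
    simp only [Set.mem_iInter]
    rfl
  rw [h]
  refine isClosed_iInter fun φ => isClosed_iInter fun hφ => isClosed_iInter fun hc => ?_
  obtain ⟨T, hT⟩ := exists_testFunctional (ν := ν) (α := α) (continuous_landau (ν := ν) hφ)
    (compact_landau hc)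
  obtain ⟨T', hT'⟩ := exists_testFunctional (ν := ν) (α := α) hφ.continuous hc
  simp only [← hT, ← hT']
  exact isClosed_eq (T.continuous.comp continuous_fst) (T'.continuous.comp continuous_snd)

/-- Locally integrable functions are determined by their weighted test integrals. -/
lemma ae_eq_of_test {f g : ℂ → ℂ} (hf : LocallyIntegrable f volume)
    (hg : LocallyIntegrable g volume)
    (h : ∀ φ : ℂ → ℂ, ContDiff ℝ ∞ φ → HasCompactSupport φ →
      ∫ z, f z * conj (φ z) * weight ν z = ∫ z, g z * conj (φ z) * weight ν z) :
    ∀ᵐ z, f z = g z := by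
  have hw : ∀ {u : ℂ → ℂ}, LocallyIntegrable u volume →
      LocallyIntegrable (fun z => (weight ν z : ℂ) * u z) volume := by
    intro u hu
    refine locallyIntegrable_iff.2 fun K hK => ?_
    exact (locallyIntegrable_iff.1 hu K hK).continuousOn_mul
      (continuous_ofReal.comp (continuous_weight ν)).continuousOn hK
  have key : ∀ᵐ z, (weight ν z : ℂ) * f z = weight ν z * g z := by
    refine ae_eq_of_integral_contDiff_smul_eq (hw hf) (hw hg) fun φ hφ hc => ?_
    refine Eq.trans (integral_congr_ae (ae_of_all _ fun z => ?_)) ((h (fun z => (φ z : ℂ))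
      (ofRealCLM.contDiff.comp hφ) (hc.comp_left (g := ((↑) : ℝ → ℂ)) ofReal_zero)).trans
        (integral_congr_ae (ae_of_all _ fun z => ?_)))
    · simp only [real_smul, conj_ofReal]; ring
    · simp only [real_smul, conj_ofReal]; ring
  filter_upwards [key] with z hz
  exact mul_left_cancel₀ (by exact_mod_cast (weight_pos ν z).ne') hz

/-! ### Calculus for the first order operators -/

lemma dz_mul {f g : ℂ → ℂ} {z : ℂ} (hf : DifferentiableAt ℝ f z) (hg : DifferentiableAt ℝ g z) :
    dz (fun w => f w * g w) z = dz f z * g z + f z * dz g z := by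
  have h : fderiv ℝ (fun w => f w * g w) z = _ := (hf.hasFDerivAt.mul hg.hasFDerivAt).fderiv
  simp only [dz, h, add_apply, smul_apply, smul_eq_mul]
  ring

lemma opA_mul {f g : ℂ → ℂ} {z : ℂ} (hf : DifferentiableAt ℝ f z) (hg : DifferentiableAt ℝ g z) :
    opA (fun w => f w * g w) z = opA f z * g z + f z * opA g z := by
  have h : fderiv ℝ (fun w => f w * g w) z = _ := (hf.hasFDerivAt.mul hg.hasFDerivAt).fderiv
  simp only [opA, h, add_apply, smul_apply, smul_eq_mul]
  ring

lemma dz_add {f g : ℂ → ℂ} {z : ℂ} (hf : DifferentiableAt ℝ f z) (hg : DifferentiableAt ℝ g z) :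
    dz (fun w => f w + g w) z = dz f z + dz g z := by
  have h : fderiv ℝ (fun w => f w + g w) z = _ := (hf.hasFDerivAt.add hg.hasFDerivAt).fderiv
  simp only [dz, h, add_apply]
  ring

lemma dz_const_mul {f : ℂ → ℂ} {z : ℂ} (c : ℂ) (hf : DifferentiableAt ℝ f z) :
    dz (fun w => c * f w) z = c * dz f z := by
  have h := (hf.hasFDerivAt.const_mul c).fderiv
  simp only [dz, h, smul_apply, smul_eq_mul]
  ring

lemma opA_const_mul {f : ℂ → ℂ} {z : ℂ} (c : ℂ) (hf : DifferentiableAt ℝ f z) :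
    opA (fun w => c * f w) z = c * opA f z := by
  have h := (hf.hasFDerivAt.const_mul c).fderiv
  simp only [opA, h, smul_apply, smul_eq_mul]
  ring

lemma opA_of_differentiableAt {f : ℂ → ℂ} {z : ℂ} (hf : DifferentiableAt ℂ f z) :
    opA f z = 0 := by
  have h := hf.hasDerivAt.complexToReal_fderiv.fderiv
  simp only [opA, h, smul_apply, one_apply_eq_self, smul_eq_mul]
  linear_combination (deriv f z / 2) * I_mul_I

lemma dz_of_hasDerivAt {f : ℂ → ℂ} {f' z : ℂ} (hf : HasDerivAt f f' z) : dz f z = f' := by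
  have h := hf.complexToReal_fderiv.fderiv
  simp only [dz, h, smul_apply, one_apply_eq_self, smul_eq_mul]
  linear_combination (-f' / 2) * I_mul_I

lemma hasFDerivAt_comp_im {p : ℝ → ℝ} {p' : ℝ} {z : ℂ} (hp : HasDerivAt p p' z.im) :
    HasFDerivAt (fun w : ℂ => ((p w.im : ℝ) : ℂ)) (ofRealCLM.comp (p' • imCLM)) z :=
  ofRealCLM.hasFDerivAt.comp z (hp.comp_hasFDerivAt z imCLM.hasFDerivAt)

lemma hasFDerivAt_comp_re {p : ℝ → ℝ} {p' : ℝ} {z : ℂ} (hp : HasDerivAt p p' z.re) :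
    HasFDerivAt (fun w : ℂ => ((p w.re : ℝ) : ℂ)) (ofRealCLM.comp (p' • reCLM)) z :=
  ofRealCLM.hasFDerivAt.comp z (hp.comp_hasFDerivAt z reCLM.hasFDerivAt)

lemma opA_comp_im {p : ℝ → ℝ} {p' : ℝ} {z : ℂ} (hp : HasDerivAt p p' z.im) :
    opA (fun w : ℂ => ((p w.im : ℝ) : ℂ)) z = I / 2 * p' := by
  simp only [opA, (hasFDerivAt_comp_im hp).fderiv]
  simp; ring

lemma dz_comp_im {p : ℝ → ℝ} {p' : ℝ} {z : ℂ} (hp : HasDerivAt p p' z.im) :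
    dz (fun w : ℂ => ((p w.im : ℝ) : ℂ)) z = -I / 2 * p' := by
  simp only [dz, (hasFDerivAt_comp_im hp).fderiv]
  simp; ring

lemma opA_comp_re {p : ℝ → ℝ} {p' : ℝ} {z : ℂ} (hp : HasDerivAt p p' z.re) :
    opA (fun w : ℂ => ((p w.re : ℝ) : ℂ)) z = p' / 2 := by
  simp only [opA, (hasFDerivAt_comp_re hp).fderiv]
  simp

lemma dz_comp_re {p : ℝ → ℝ} {p' : ℝ} {z : ℂ} (hp : HasDerivAt p p' z.re) :
    dz (fun w : ℂ => ((p w.re : ℝ) : ℂ)) z = p' / 2 := by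
  simp only [dz, (hasFDerivAt_comp_re hp).fderiv]
  simp

lemma opA_conj {v : ℂ → ℂ} {z : ℂ} (hv : DifferentiableAt ℝ v z) :
    opA (fun w => conj (v w)) z = conj (dz v z) := by
  have h := (conjCLE.toContinuousLinearMap.hasFDerivAt.comp z hv.hasFDerivAt).fderiv
  have h' : fderiv ℝ (fun w => conj (v w)) z
      = conjCLE.toContinuousLinearMap.comp (fderiv ℝ v z) := h
  simp only [opA, dz, h']
  simp [Complex.conj_ofNat]

/-- The Gaussian is split into factors depending on `x` and on `y` only. This derivative is the
source of the term `ν z̄` in `A*`. -/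
lemma opA_weight (z : ℂ) : opA (fun w => (weight ν w : ℂ)) z = -ν * z * weight ν z := by
  have hp : ∀ t : ℝ, HasDerivAt (fun t : ℝ => Real.exp (-ν * t ^ 2))
      (Real.exp (-ν * t ^ 2) * (-ν * (2 * t))) t := fun t => by
    simpa using ((hasDerivAt_pow 2 t).const_mul (-ν)).exp
  have hw : (fun w => (weight ν w : ℂ)) = fun w : ℂ =>
      ((Real.exp (-ν * w.re ^ 2) : ℝ) : ℂ) * ((Real.exp (-ν * w.im ^ 2) : ℝ) : ℂ) := by
    funext w
    rw [← ofReal_mul, ← Real.exp_add, weight, ← normSq_eq_norm_sq, normSq_apply]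
    congr 2; ring
  have hz := congrFun hw z
  rw [hz, hw, opA_mul (hasFDerivAt_comp_re (hp _)).differentiableAt
    (hasFDerivAt_comp_im (hp _)).differentiableAt, opA_comp_re (hp _), opA_comp_im (hp _)]
  simp only [ofReal_mul, ofReal_neg, ofReal_ofNat]
  linear_combination (-ν * ((Real.exp (-ν * z.re ^ 2) : ℝ) : ℂ) *
    ((Real.exp (-ν * z.im ^ 2) : ℝ) : ℂ)) * re_add_im z

lemma contDiff_weight (ν : ℝ) : ContDiff ℝ ∞ fun z : ℂ => (weight ν z : ℂ) := by
  have h : ContDiff ℝ ∞ (weight ν) :=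
    Real.contDiff_exp.comp (contDiff_const.mul (contDiff_norm_sq ℝ))
  exact ofRealCLM.contDiff.comp h

lemma contDiff_conj_comp {v : ℂ → ℂ} (hv : ContDiff ℝ ∞ v) : ContDiff ℝ ∞ fun z => conj (v z) :=
  conjCLE.contDiff.comp hv

lemma contDiff_opAStar {f : ℂ → ℂ} (hf : ContDiff ℝ ∞ f) : ContDiff ℝ ∞ (opAStar ν f) :=
  (contDiff_dz hf).neg.add ((contDiff_const.mul (contDiff_conj_comp contDiff_id)).mul hf)

/-- Integration by parts against the constant function `1`. -/
lemma integral_fderiv_eq_zero {k : ℂ → ℂ} (hk : ContDiff ℝ ∞ k) (hc : HasCompactSupport k) (v : ℂ) :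
    ∫ z, fderiv ℝ k z v = 0 := by
  have hd := hk.differentiable (by simp)
  have hk' : Continuous fun z => fderiv ℝ k z v :=
    (hk.continuous_fderiv (by simp)).clm_apply continuous_const
  have h := integral_mul_fderiv_eq_neg_fderiv_mul_of_integrable (μ := (volume : Measure ℂ))
    (f := fun _ : ℂ => (1 : ℂ)) (g := k) (v := v) (by simp) ?_ ?_
    (fun x _ => differentiableAt_const _) (fun x _ => hd x)
  · simpa using h
  · simpa using hk'.integrable_of_hasCompactSupport (hc.fderiv_apply (𝕜 := ℝ) v)
  · simpa using hk.continuous.integrable_of_hasCompactSupport hc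

lemma integrable_fderiv_apply {k : ℂ → ℂ} (hk : ContDiff ℝ ∞ k) (hc : HasCompactSupport k)
    (v : ℂ) : Integrable fun z => fderiv ℝ k z v :=
  ((hk.continuous_fderiv (by simp)).clm_apply continuous_const).integrable_of_hasCompactSupport
    (hc.fderiv_apply (𝕜 := ℝ) v)

lemma integral_opA_eq_zero {k : ℂ → ℂ} (hk : ContDiff ℝ ∞ k) (hc : HasCompactSupport k) :
    ∫ z, opA k z = 0 := by
  unfold opA
  rw [integral_div, integral_add (integrable_fderiv_apply hk hc 1)
    ((integrable_fderiv_apply hk hc I).const_mul I), integral_const_mul,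
    integral_fderiv_eq_zero hk hc, integral_fderiv_eq_zero hk hc]
  simp

/-- `A*` is the formal adjoint of `A` for the weighted measure. -/
lemma integral_conj_opAStar {u v : ℂ → ℂ} (hu : ContDiff ℝ ∞ u) (hv : ContDiff ℝ ∞ v)
    (hc : HasCompactSupport u) :
    ∫ z, u z * conj (opAStar ν v z) * weight ν z = ∫ z, opA u z * conj (v z) * weight ν z := by
  have hw := contDiff_weight ν
  have hcv := contDiff_conj_comp hv
  have hd : ∀ {f : ℂ → ℂ}, ContDiff ℝ ∞ f → ∀ z, DifferentiableAt ℝ f z :=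
    fun h z => (h.differentiable (by simp)) z
  have h := integral_opA_eq_zero (k := fun z => u z * conj (v z) * weight ν z)
    ((hu.mul hcv).mul hw) hc.mul_right.mul_right
  have e : ∀ z, opA (fun z => u z * conj (v z) * weight ν z) z =
      opA u z * conj (v z) * weight ν z - u z * conj (opAStar ν v z) * weight ν z := by
    intro z
    rw [opA_mul (hd (hu.mul hcv) z) (hd hw z), opA_mul (hd hu z) (hd hcv z), opA_conj (hd hv z),
      opA_weight, opAStar]
    simp only [map_add, map_neg, map_mul, conj_ofReal, conj_conj]
    ring
  simp only [e] at h
  rw [integral_sub] at h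
  · exact (sub_eq_zero.1 h).symm
  · exact (((contDiff_opA hu).continuous.mul hcv.continuous).mul
      hw.continuous).integrable_of_hasCompactSupport (compact_opA hc).mul_right.mul_right
  · exact ((hu.continuous.mul (contDiff_conj_comp (contDiff_opAStar hv)).continuous).mul
      hw.continuous).integrable_of_hasCompactSupport hc.mul_right.mul_right

/-- The variant with the compact support on the other factor. Moving both first-order operators
across in `isWeakLandau_landau` needs both versions, as only `φ` has compact support there. -/
lemma integral_conj_opAStar' {u v : ℂ → ℂ} (hu : ContDiff ℝ ∞ u) (hv : ContDiff ℝ ∞ v)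
    (hc : HasCompactSupport v) :
    ∫ z, u z * conj (opAStar ν v z) * weight ν z = ∫ z, opA u z * conj (v z) * weight ν z := by
  have hw := contDiff_weight ν
  have hcv := contDiff_conj_comp hv
  have hd : ∀ {f : ℂ → ℂ}, ContDiff ℝ ∞ f → ∀ z, DifferentiableAt ℝ f z :=
    fun h z => (h.differentiable (by simp)) z
  have hcc : HasCompactSupport fun z => conj (v z) := hc.comp_left (g := conj) (map_zero _)
  have hcs : HasCompactSupport fun z => conj (opAStar ν v z) :=
    HasCompactSupport.comp_left (g := conj) ((compact_dz hc).neg.add hc.mul_left) (map_zero _)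
  have h := integral_opA_eq_zero (k := fun z => u z * conj (v z) * weight ν z)
    ((hu.mul hcv).mul hw) hcc.mul_left.mul_right
  have e : ∀ z, opA (fun z => u z * conj (v z) * weight ν z) z =
      opA u z * conj (v z) * weight ν z - u z * conj (opAStar ν v z) * weight ν z := by
    intro z
    rw [opA_mul (hd (hu.mul hcv) z) (hd hw z), opA_mul (hd hu z) (hd hcv z), opA_conj (hd hv z),
      opA_weight, opAStar]
    simp only [map_add, map_neg, map_mul, conj_ofReal, conj_conj]
    ring
  simp only [e] at h
  rw [integral_sub] at h
  · exact (sub_eq_zero.1 h).symm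
  · exact (((contDiff_opA hu).continuous.mul hcv.continuous).mul
      hw.continuous).integrable_of_hasCompactSupport hcc.mul_left.mul_right
  · exact ((hu.continuous.mul (contDiff_conj_comp (contDiff_opAStar hv)).continuous).mul
      hw.continuous).integrable_of_hasCompactSupport hcs.mul_left.mul_right

/-- On smooth functions the distributional operator is the pointwise one. -/
lemma isWeakLandau_landau {g : ℂ → ℂ} (hg : ContDiff ℝ ∞ g) : IsWeakLandau ν g (landau ν g) := by
  intro φ hφ hc
  -- Both sides of the claim equal `∫ (A g) \overline{A φ} e^{-ν|z|²}`.
  have h1 := integral_conj_opAStar' (ν := ν) hg (contDiff_opA hφ) (compact_opA hc)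
  have h2 := congrArg conj (integral_conj_opAStar (ν := ν) hφ (contDiff_opA hg) hc)
  rw [← integral_conj, ← integral_conj] at h2
  refine h1.trans (Eq.trans (integral_congr_ae (ae_of_all _ fun z => ?_)) (h2.symm.trans
    (integral_congr_ae (ae_of_all _ fun z => ?_))))
  · simp only [map_mul, conj_conj, conj_ofReal]; ring
  · simp only [map_mul, conj_conj, conj_ofReal]
    change _ = opAStar ν (opA g) z * _ * _
    ring

lemma IsWeakLandau.congr {f g f' g' : ℂ → ℂ} (h : IsWeakLandau ν f g) (hf : ∀ᵐ z, f z = f' z)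
    (hg : ∀ᵐ z, g z = g' z) : IsWeakLandau ν f' g' := by
  intro φ hφ hc
  refine Eq.trans (integral_congr_ae ?_) ((h φ hφ hc).trans (integral_congr_ae ?_))
  · filter_upwards [hf] with z hz
    rw [hz]
  · filter_upwards [hg] with z hz
    rw [hz]

/-- Two continuous functions that define the same distribution agree everywhere, so a weak equation
with smooth `g` and continuous `h` is a pointwise one. -/
lemma IsWeakLandau.landau_eq {g h : ℂ → ℂ} (hw : IsWeakLandau ν g h) (hg : ContDiff ℝ ∞ g)
    (hh : Continuous h) : landau ν g = h := by
  have hl : Continuous (landau ν g) := continuous_landau hg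
  have : landau ν g =ᵐ[volume] h := ae_eq_of_test (ν := ν) hl.locallyIntegrable
    hh.locallyIntegrable fun φ hφ hc =>
      (isWeakLandau_landau hg φ hφ hc).symm.trans (hw φ hφ hc)
  exact (hl.ae_eq_iff_eq volume hh).1 this

/-! ### The functions `ψ_n P(t_n)` -/

/-- The argument `t_n = √(2ν) y + √(2/ν) π (n+α)` of the Hermite polynomials. -/
def hermiteArg (ν α : ℝ) (n : ℤ) (y : ℝ) : ℝ := √(2 * ν) * y + √(2 / ν) * Real.pi * (n + α)

/-- The function `ψ_n P(t_n)` for a polynomial `P`. -/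
def psiPoly (ν α : ℝ) (n : ℤ) (P : Polynomial ℝ) (z : ℂ) : ℂ :=
  psi ν α n z * ((P.eval (hermiteArg ν α n z.im) : ℝ) : ℂ)

/-- The normalization `(2^m m!)^{-1/2}`. -/
def hermiteConst (m : ℕ) : ℝ := ((2 : ℝ) ^ m * m.factorial) ^ (-(1 / 2) : ℝ)

lemma psiHermite_eq (ν α : ℝ) (m : ℕ) (n : ℤ) (z : ℂ) :
    psiHermite ν α m n z = hermiteConst m * psiPoly ν α n (hermitePoly m) z := by
  rw [psiHermite, psiPoly, psi, hermiteConst, hermiteArg, exp_add, exp_add]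
  push_cast
  rw [add_comm (α : ℂ) n]
  ring

lemma psi_eq_psiPoly (ν α : ℝ) (n : ℤ) : psi ν α n = psiPoly ν α n (hermitePoly 0) := by
  funext z; simp [psiPoly, hermitePoly]

lemma hasDerivAt_psi (ν α : ℝ) (n : ℤ) (z : ℂ) :
    HasDerivAt (psi ν α n) ((ν * z + 2 * I * Real.pi * (α + n)) * psi ν α n z) z := by
  have h1 : HasDerivAt (fun z : ℂ => exp (ν / 2 * z ^ 2)) (exp (ν / 2 * z ^ 2) * (ν * z)) z := by
    have := ((hasDerivAt_pow 2 z).const_mul (ν / 2 : ℂ)).cexp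
    refine this.congr_deriv ?_
    push_cast; ring
  have h2 : HasDerivAt (fun z : ℂ => exp (-(Real.pi ^ 2 / ν) * (n + α) ^ 2 +
      2 * I * Real.pi * (α + n) * z)) (exp (-(Real.pi ^ 2 / ν) * (n + α) ^ 2 +
      2 * I * Real.pi * (α + n) * z) * (2 * I * Real.pi * (α + n))) z := by
    have := (((hasDerivAt_id z).const_mul (2 * I * Real.pi * (α + n) : ℂ)).const_add
      (-(Real.pi ^ 2 / ν) * (n + α) ^ 2 : ℂ)).cexp
    refine this.congr_deriv ?_
    simp
  refine ((h1.const_mul (((2 * ν / Real.pi) ^ (1 / 4 : ℝ) : ℝ) : ℂ)).mul h2).congr_deriv ?_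
  rw [psi]; ring

lemma differentiable_psi (ν α : ℝ) (n : ℤ) : Differentiable ℂ (psi ν α n) :=
  fun z => (hasDerivAt_psi ν α n z).differentiableAt

lemma contDiff_psi (ν α : ℝ) (n : ℤ) : ContDiff ℝ ∞ (psi ν α n) :=
  ((differentiable_psi ν α n).contDiff (n := ∞)).restrict_scalars ℝ

lemma contDiff_evalArg (ν α : ℝ) (n : ℤ) (P : Polynomial ℝ) :
    ContDiff ℝ ∞ fun z : ℂ => ((P.eval (hermiteArg ν α n z.im) : ℝ) : ℂ) := by
  refine ofRealCLM.contDiff.comp ((Polynomial.contDiff_aeval P ∞).comp ?_)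
  exact (contDiff_const.mul imCLM.contDiff).add contDiff_const

lemma contDiff_psiPoly (ν α : ℝ) (n : ℤ) (P : Polynomial ℝ) : ContDiff ℝ ∞ (psiPoly ν α n P) :=
  (contDiff_psi ν α n).mul (contDiff_evalArg ν α n P)

/-- Beyond the automorphy factor, translation by `k` produces only `e^{2πi nk} = 1`. -/
lemma psi_add_int (ν α : ℝ) (n k : ℤ) (z : ℂ) :
    psi ν α n (z + k) = factor ν α k z * psi ν α n z := by
  have h : exp (2 * Real.pi * I * (n * k : ℤ)) = 1 := by
    rw [mul_comm]; exact exp_int_mul_two_pi_mul_I _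
  rw [psi, psi, factor]
  have e : exp (ν / 2 * (z + k) ^ 2) * exp (-(Real.pi ^ 2 / ν) * (n + α) ^ 2 +
      2 * I * Real.pi * (α + n) * (z + k)) =
      exp (2 * I * Real.pi * α * k) * exp (ν * (z + k / 2) * k) * (exp (ν / 2 * z ^ 2) *
        exp (-(Real.pi ^ 2 / ν) * (n + α) ^ 2 + 2 * I * Real.pi * (α + n) * z)) *
        exp (2 * Real.pi * I * (n * k : ℤ)) := by
    simp only [← exp_add]
    congr 1
    push_cast; ring
  rw [mul_assoc, e, h]
  ring

lemma isQuasiPeriodic_psiPoly (ν α : ℝ) (n : ℤ) (P : Polynomial ℝ) :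
    IsQuasiPeriodic ν α (psiPoly ν α n P) := by
  intro k z
  simp only [psiPoly, psi_add_int, add_im, intCast_im, add_zero]
  ring

lemma hasDerivAt_evalArg (ν α : ℝ) (n : ℤ) (P : Polynomial ℝ) (y : ℝ) :
    HasDerivAt (fun y => P.eval (hermiteArg ν α n y))
      (√(2 * ν) * (Polynomial.derivative P).eval (hermiteArg ν α n y)) y := by
  have h : HasDerivAt (hermiteArg ν α n) (√(2 * ν)) y := by
    have := ((hasDerivAt_id y).const_mul √(2 * ν)).add_const (√(2 / ν) * Real.pi * (n + α))
    rwa [mul_one] at this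
  refine ((P.hasDerivAt _).comp y h).congr_deriv ?_
  ring

/-- Holomorphy of `ψ_n` leaves only the derivative of the polynomial factor: `A` is the lowering
operator. -/
lemma opA_psiPoly (ν α : ℝ) (n : ℤ) (P : Polynomial ℝ) :
    opA (psiPoly ν α n P) = fun z => I / 2 * √(2 * ν) *
      psiPoly ν α n (Polynomial.derivative P) z := by
  funext z
  have h := hasDerivAt_evalArg ν α n P z.im
  have h1 : opA (psiPoly ν α n P) z = _ :=
    opA_mul ((differentiable_psi ν α n z).restrictScalars ℝ) (hasFDerivAt_comp_im h).differentiableAt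
  rw [h1, opA_of_differentiableAt (differentiable_psi ν α n z), opA_comp_im h, psiPoly]
  push_cast; ring

lemma sqrt_mul_hermiteArg (hν : 0 < ν) (α : ℝ) (n : ℤ) (y : ℝ) :
    √(2 * ν) * hermiteArg ν α n y = 2 * ν * y + 2 * Real.pi * (n + α) := by
  have h1 : √(2 * ν) * √(2 * ν) = 2 * ν := Real.mul_self_sqrt (by positivity)
  have h2 : √(2 * ν) * √(2 / ν) = 2 := by
    rw [← Real.sqrt_mul (by positivity), show 2 * ν * (2 / ν) = 2 ^ 2 by field_simp]
    exact Real.sqrt_sq (by norm_num)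
  rw [hermiteArg]
  linear_combination y * h1 + Real.pi * (n + α) * h2

/-- The logarithmic derivative of `ψ_n` gives `A* ψ_n = -i(2νy + 2π(n+α)) ψ_n = -i √(2ν) t_n ψ_n`.
This supplies the term `2XP`, so that `A*` acts through the Hermite recursion. -/
lemma opAStar_psiPoly (hν : 0 < ν) (α : ℝ) (n : ℤ) (P : Polynomial ℝ) :
    opAStar ν (psiPoly ν α n P) = fun z => -(I / 2) * √(2 * ν) *
      psiPoly ν α n (2 * Polynomial.X * P - Polynomial.derivative P) z := by
  funext z
  have h := hasDerivAt_evalArg ν α n P z.im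
  have h1 : dz (psiPoly ν α n P) z = _ :=
    dz_mul ((differentiable_psi ν α n z).restrictScalars ℝ) (hasFDerivAt_comp_im h).differentiableAt
  have h2 : ((√(2 * ν) : ℝ) : ℂ) * hermiteArg ν α n z.im =
      2 * ν * z.im + 2 * Real.pi * (n + α) := by exact_mod_cast sqrt_mul_hermiteArg hν α n z.im
  have h3 : conj z = z - 2 * I * z.im := by
    apply Complex.ext <;> simp; ring
  rw [opAStar, h1, dz_of_hasDerivAt (hasDerivAt_psi ν α n z), dz_comp_im h, psiPoly, psiPoly, h3]
  simp only [Polynomial.eval_sub, Polynomial.eval_mul, Polynomial.eval_X, Polynomial.eval_ofNat]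
  push_cast
  linear_combination (I * psi ν α n z * (P.eval (hermiteArg ν α n z.im) : ℝ)) * h2

lemma opAStar_const_mul {f : ℂ → ℂ} (c : ℂ) (hf : Differentiable ℝ f) :
    opAStar ν (fun z => c * f z) = fun z => c * opAStar ν f z := by
  funext z
  rw [opAStar, dz_const_mul c (hf z), opAStar]
  ring

lemma landau_const_mul {f : ℂ → ℂ} (c : ℂ) (hf : ContDiff ℝ ∞ f) :
    landau ν (fun z => c * f z) = fun z => c * landau ν f z := by
  have h : opA (fun z => c * f z) = fun z => c * opA f z := by
    funext z
    exact opA_const_mul c (hf.differentiable (by simp) z)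
  funext z
  change opAStar ν (opA fun z => c * f z) z = c * opAStar ν (opA f) z
  rw [h, opAStar_const_mul c ((contDiff_opA hf).differentiable (by simp))]

lemma psiPoly_smul (ν α : ℝ) (n : ℤ) (c : ℝ) (P : Polynomial ℝ) (z : ℂ) :
    psiPoly ν α n (c • P) z = c * psiPoly ν α n P z := by
  simp only [psiPoly, Polynomial.eval_smul, smul_eq_mul]
  push_cast; ring

lemma ofReal_sqrt_mul_self {a : ℝ} (ha : 0 ≤ a) : ((√a : ℝ) : ℂ) * (√a : ℝ) = a := by
  rw [← ofReal_mul, Real.mul_self_sqrt ha]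

/-- The constants of `A` and `A*` multiply to `(i/2)(-i/2)(2ν) = ν/2`, and Hermite's equation
contributes `2m`. -/
lemma landau_psiPoly_hermitePoly (hν : 0 < ν) (α : ℝ) (m : ℕ) (n : ℤ) :
    landau ν (psiPoly ν α n (hermitePoly m)) =
      fun z => ν * m * psiPoly ν α n (hermitePoly m) z := by
  funext z
  change opAStar ν (opA _) z = _
  rw [opA_psiPoly, opAStar_const_mul _ ((contDiff_psiPoly _ _ _ _).differentiable (by simp)),
    opAStar_psiPoly hν]
  simp only
  rw [hermitePoly_ode, psiPoly_smul]
  have h := ofReal_sqrt_mul_self (a := 2 * ν) (by positivity)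
  push_cast at h ⊢
  linear_combination (-(I ^ 2) / 2 * m * psiPoly ν α n (hermitePoly m) z) * h
    - ν * m * psiPoly ν α n (hermitePoly m) z * I_sq

lemma contDiff_psiHermite (ν α : ℝ) (m : ℕ) (n : ℤ) : ContDiff ℝ ∞ (psiHermite ν α m n) := by
  rw [funext (psiHermite_eq ν α m n)]
  exact contDiff_const.mul (contDiff_psiPoly _ _ _ _)

lemma isQuasiPeriodic_psiHermite (ν α : ℝ) (m : ℕ) (n : ℤ) :
    IsQuasiPeriodic ν α (psiHermite ν α m n) := by
  intro k z
  rw [psiHermite_eq, psiHermite_eq, isQuasiPeriodic_psiPoly]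
  ring

lemma landau_psiHermite (hν : 0 < ν) (α : ℝ) (m : ℕ) (n : ℤ) :
    landau ν (psiHermite ν α m n) = fun z => ν * m * psiHermite ν α m n z := by
  rw [funext (psiHermite_eq ν α m n), landau_const_mul _ (contDiff_psiPoly _ _ _ _),
    landau_psiPoly_hermitePoly hν]
  funext z; ring

/-- The factor `i` cancels the `-i` of `A*`, so each step raises the Hermite index and multiplies by
the real number `√(2ν)/2`. -/
lemma iterate_opAStar_psi (hν : 0 < ν) (α : ℝ) (m : ℕ) (n : ℤ) :
    (fun (f : ℂ → ℂ) (w : ℂ) => I * opAStar ν f w)^[m] (psi ν α n) =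
      fun z => ((√(2 * ν) / 2) ^ m : ℂ) * psiPoly ν α n (hermitePoly m) z := by
  induction m with
  | zero => rw [psi_eq_psiPoly]; funext z; simp
  | succ m ih =>
    rw [Function.iterate_succ_apply', ih,
      opAStar_const_mul _ ((contDiff_psiPoly _ _ _ _).differentiable (by simp)),
      opAStar_psiPoly hν]
    funext z
    rw [hermitePoly, pow_succ]
    linear_combination (-((√(2 * ν) / 2) ^ m * (√(2 * ν) / 2) *
      psiPoly ν α n (2 * Polynomial.X * hermitePoly m - Polynomial.derivative (hermitePoly m)) z
      : ℂ)) * I_sq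

/-- The functions `ψ_{m,n}` are obtained from `ψ_n` by the creation operator. -/
lemma creation_psi (hν : 0 < ν) (α : ℝ) (m : ℕ) (n : ℤ) (z : ℂ) :
    (((ν ^ m * m.factorial) ^ (-(1 / 2) : ℝ) : ℝ) : ℂ) *
      ((fun (f : ℂ → ℂ) (w : ℂ) => I * opAStar ν f w)^[m] (psi ν α n)) z
        = psiHermite ν α m n z := by
  rw [iterate_opAStar_psi hν, psiHermite_eq, hermiteConst]
  -- The constants match because `√(2ν)/2 = √(ν/2)` and `ν^m m! = (ν/2)^m · 2^m m!`.
  have h : (ν ^ m * m.factorial) ^ (-(1 / 2) : ℝ) * (√(2 * ν) / 2) ^ m =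
      ((2 : ℝ) ^ m * m.factorial) ^ (-(1 / 2) : ℝ) := by
    have hf : (0 : ℝ) < m.factorial := by exact_mod_cast m.factorial_pos
    have h1 : √(2 * ν) / 2 = √(ν / 2) := by
      rw [show ν / 2 = 2 * ν / 2 ^ 2 by ring, Real.sqrt_div' _ (by positivity),
        Real.sqrt_sq (by norm_num)]
    have h2 : √(ν / 2) ^ m = ((ν / 2) ^ m) ^ (1 / 2 : ℝ) := by
      rw [Real.sqrt_eq_rpow, ← Real.rpow_natCast, ← Real.rpow_natCast, ← Real.rpow_mul (by positivity),
        ← Real.rpow_mul (by positivity), mul_comm]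
    have h3 : ν ^ m * m.factorial = (ν / 2) ^ m * ((2 : ℝ) ^ m * m.factorial) := by
      rw [div_pow]; field_simp
    rw [h1, h2, h3, Real.mul_rpow (by positivity) (by positivity), mul_right_comm,
      ← Real.rpow_add (by positivity)]
    norm_num
  rw [← h]
  push_cast
  ring

/-! ### Inner products of the functions `ψ_n P(t_n)` -/

/-- The quadratic part of the exponent is `(ν/2)(z² + z̄²) - ν|z|² = -2νy²`; with the linear and
constant terms it completes to `-(t_n² + t_k²)/2`, and only a character in `x` is left over. Inner
products therefore separate in `x` and `y`. -/
lemma psi_mul_conj_psi (hν : 0 < ν) (α : ℝ) (n k : ℤ) (z : ℂ) :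
    psi ν α n z * conj (psi ν α k z) * weight ν z =
      √(2 * ν / Real.pi) * exp (2 * I * Real.pi * ((n - k : ℤ) : ℂ) * z.re) *
        ((Real.exp (-1 * hermiteArg ν α n z.im ^ 2 / 2) *
          Real.exp (-1 * hermiteArg ν α k z.im ^ 2 / 2) : ℝ) : ℂ) := by
  have hsq : ∀ n : ℤ, (hermiteArg ν α n z.im : ℂ) ^ 2 = 2 * ν * z.im ^ 2 +
      4 * Real.pi * (n + α) * z.im + 2 * Real.pi ^ 2 / ν * (n + α) ^ 2 := by
    intro n
    have h1 : (√(2 * ν)) ^ 2 = 2 * ν := Real.sq_sqrt (by positivity)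
    have h3 : (√(2 / ν)) ^ 2 = 2 / ν := Real.sq_sqrt (by positivity)
    have h2 : √(2 * ν) * √(2 / ν) = 2 := by
      rw [← Real.sqrt_mul (by positivity), show 2 * ν * (2 / ν) = 2 ^ 2 by field_simp]
      exact Real.sqrt_sq (by norm_num)
    have : hermiteArg ν α n z.im ^ 2 = 2 * ν * z.im ^ 2 +
      4 * Real.pi * (n + α) * z.im + 2 * Real.pi ^ 2 / ν * (n + α) ^ 2 := by
      rw [hermiteArg]
      linear_combination z.im ^ 2 * h1 + 2 * z.im * Real.pi * (n + α) * h2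
        + (Real.pi * (n + α)) ^ 2 * h3
    exact_mod_cast this
  have hc : (((2 * ν / Real.pi) ^ (1 / 4 : ℝ) : ℝ) : ℂ) * ((2 * ν / Real.pi) ^ (1 / 4 : ℝ) : ℝ)
      = √(2 * ν / Real.pi) := by
    rw [← ofReal_mul, ← Real.rpow_add (by positivity), Real.sqrt_eq_rpow]
    norm_num
  have hw : (weight ν z : ℂ) = exp (-ν * (z * conj z)) := by
    rw [weight, mul_conj, normSq_eq_norm_sq]; push_cast; rfl
  have hz := re_add_im z
  have hzc : conj z = z.re - z.im * I := by
    apply Complex.ext <;> simp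
  rw [psi, psi, hw, ← hc]
  simp only [map_mul, conj_ofReal, ← exp_conj, ofReal_mul, ofReal_exp]
  have e : exp (ν / 2 * z ^ 2) * exp (-(Real.pi ^ 2 / ν) * (n + α) ^ 2 +
        2 * I * Real.pi * (α + n) * z) * (exp (conj (ν / 2 * z ^ 2)) *
        exp (conj (-(Real.pi ^ 2 / ν) * (k + α) ^ 2 + 2 * I * Real.pi * (α + k) * z))) *
        exp (-ν * (z * conj z)) =
      exp (2 * I * Real.pi * ((n - k : ℤ) : ℂ) * z.re) *
        (exp ((-1 * hermiteArg ν α n z.im ^ 2 / 2 : ℝ) : ℂ) *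
          exp ((-1 * hermiteArg ν α k z.im ^ 2 / 2 : ℝ) : ℂ)) := by
    simp only [← exp_add]
    congr 1
    simp only [map_add, map_mul, map_neg, map_div₀, map_pow, conj_ofReal, conj_I,
      map_intCast, map_ofNat, hzc]
    push_cast
    rw [hsq, hsq]
    conv_lhs => rw [← hz]
    simp only [add_re, ofReal_re, mul_re, I_re, mul_zero, ofReal_im, I_im, mul_one, sub_self,
      add_zero, add_im, mul_im, zero_add]
    have hI := I_sq
    field_simp
    ring_nf
    simp only [I_sq]
    ring
  simp only [map_mul] at e
  linear_combination (((2 * ν / Real.pi) ^ (1 / 4 : ℝ) : ℝ) : ℂ) *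
    ((2 * ν / Real.pi) ^ (1 / 4 : ℝ) : ℝ) * e

/-! ### The vectors `ψ_{m,n}` -/

lemma hermiteArg_affine (hν : 0 < ν) (α : ℝ) (n : ℤ) (g : ℝ → ℝ) (hg : Integrable g) :
    Integrable (fun y => g (hermiteArg ν α n y)) ∧
      ∫ y, g (hermiteArg ν α n y) = (√(2 * ν))⁻¹ * ∫ t, g t := by
  have h0 : √(2 * ν) ≠ 0 := (Real.sqrt_pos.2 (by positivity)).ne'
  refine ⟨(hg.comp_add_right (√(2 / ν) * Real.pi * (n + α))).comp_mul_left' h0, ?_⟩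
  have h := Measure.integral_comp_mul_left (fun t => g (t + √(2 / ν) * Real.pi * (n + α))) √(2 * ν)
  rw [integral_add_right_eq_self g] at h
  rw [abs_of_nonneg (by positivity)] at h
  exact h

lemma psiPoly_mul_conj (hν : 0 < ν) (α : ℝ) (n k : ℤ) (P Q : Polynomial ℝ) (z : ℂ) :
    psiPoly ν α n P z * conj (psiPoly ν α k Q z) * weight ν z =
      √(2 * ν / Real.pi) * (exp (2 * I * Real.pi * ((n - k : ℤ) : ℂ) * z.re) *
        ((P.eval (hermiteArg ν α n z.im) * Q.eval (hermiteArg ν α k z.im) *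
          (Real.exp (-1 * hermiteArg ν α n z.im ^ 2 / 2) *
          Real.exp (-1 * hermiteArg ν α k z.im ^ 2 / 2)) : ℝ) : ℂ)) := by
  have h := psi_mul_conj_psi hν α n k z
  rw [psiPoly, psiPoly, map_mul, conj_ofReal]
  rw [ofReal_mul, ofReal_mul]
  linear_combination ((P.eval (hermiteArg ν α n z.im) : ℝ) : ℂ) *
    (Q.eval (hermiteArg ν α k z.im) : ℝ) * h

lemma gaussian_mul_self (t : ℝ) :
    Real.exp (-1 * t ^ 2 / 2) * Real.exp (-1 * t ^ 2 / 2) = Real.exp (-1 * t ^ 2) := by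
  rw [← Real.exp_add]; congr 1; ring

/-- By Fubini the `x`-integral is an integral of a character over a period. In the diagonal case the
substitution `t = t_n(y)` has Jacobian `√(2ν)`, turning `√(2ν/π)` into `1/√π`. -/
lemma integral_psiPoly (hν : 0 < ν) (α : ℝ) (n k : ℤ) (P Q : Polynomial ℝ) :
    ∫ z in strip, psiPoly ν α n P z * conj (psiPoly ν α k Q z) * weight ν z =
      if n = k then (((√Real.pi)⁻¹ * ∫ t, (P * Q).eval t * Real.exp (-1 * t ^ 2) : ℝ) : ℂ)
      else 0 := by
  simp only [psiPoly_mul_conj hν]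
  rw [integral_const_mul, setIntegral_strip]
  simp only
  rw [integral_prod_mul (fun x : ℝ => exp (2 * I * Real.pi * ((n - k : ℤ) : ℂ) * x))
    (fun y : ℝ => ((P.eval (hermiteArg ν α n y) * Q.eval (hermiteArg ν α k y) *
      (Real.exp (-1 * hermiteArg ν α n y ^ 2 / 2) *
        Real.exp (-1 * hermiteArg ν α k y ^ 2 / 2)) : ℝ) : ℂ))]
  split_ifs with h
  · subst h
    have h1 := (hermiteArg_affine hν α n _ (integrable_polynomial_mul_gaussian (P * Q) one_pos)).2
    rw [integral_complex_ofReal]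
    simp only [gaussian_mul_self, ← Polynomial.eval_mul]
    rw [h1]
    have h2 : √(2 * ν / Real.pi) = √(2 * ν) * (√Real.pi)⁻¹ := by
      rw [Real.sqrt_div (by positivity)]; rfl
    have h0 : √(2 * ν) ≠ 0 := (Real.sqrt_pos.2 (by positivity)).ne'
    have h3 : ∫ x in Set.Icc (0 : ℝ) 1, exp (2 * I * Real.pi * ((n - n : ℤ) : ℂ) * x) = 1 := by
      simp
    rw [h2, h3, one_mul, ← ofReal_mul]
    congr 1
    field_simp
  · have hc : (2 * I * Real.pi * ((n - k : ℤ) : ℂ)) ≠ 0 := by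
      have : ((n - k : ℤ) : ℂ) ≠ 0 := by exact_mod_cast sub_ne_zero.2 h
      simp [Real.pi_ne_zero] at this ⊢
      exact this
    rw [integral_Icc_eq_integral_Ioc, ← intervalIntegral.integral_of_le zero_le_one,
      integral_exp_mul_complex hc]
    have : exp (2 * I * Real.pi * ((n - k : ℤ) : ℂ) * (1 : ℝ)) = 1 := by
      rw [← exp_int_mul_two_pi_mul_I (n - k)]
      congr 1; push_cast; ring
    rw [this]
    simp

lemma isSquareIntegrable_psiPoly (hν : 0 < ν) (α : ℝ) (n : ℤ) (P : Polynomial ℝ) :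
    IsSquareIntegrable ν (psiPoly ν α n P) := by
  have h1 := (hermiteArg_affine hν α n _ (integrable_polynomial_mul_gaussian (P * P) one_pos)).1
  have h2 : Integrable (fun p : ℝ × ℝ => √(2 * ν / Real.pi) * ((P * P).eval (hermiteArg ν α n p.2) *
      Real.exp (-1 * hermiteArg ν α n p.2 ^ 2)))
      ((volume.restrict (Set.Icc (0 : ℝ) 1)).prod volume) :=
    (h1.comp_snd _).const_mul _
  rw [IsSquareIntegrable, integrableOn_strip_iff]
  refine h2.congr (ae_of_all _ fun p => ?_)
  have h := psiPoly_mul_conj hν α n n P P ⟨p.1, p.2⟩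
  rw [mul_conj_mul_weight] at h
  simp only [sub_self, Int.cast_zero, mul_zero, zero_mul, exp_zero, one_mul, gaussian_mul_self] at h
  simp only [Polynomial.eval_mul]
  exact_mod_cast h.symm

/-- The element `ψ_n P(t_n)` of `L^{2,ν}_{Γ,α}`. -/
def psiElem (hν : 0 < ν) (α : ℝ) (n : ℤ) (P : Polynomial ℝ) : L2Space ν α :=
  ofFun (psiPoly ν α n P) (contDiff_psiPoly ν α n P).continuous.aestronglyMeasurable
    (isQuasiPeriodic_psiPoly ν α n P).ae (isSquareIntegrable_psiPoly hν α n P)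

lemma coeFn_psiElem (hν : 0 < ν) (α : ℝ) (n : ℤ) (P : Polynomial ℝ) :
    ∀ᵐ z, psiElem hν α n P z = psiPoly ν α n P z := coeFn_ofFun _ _ _ _

lemma inner_psiElem (hν : 0 < ν) (n : ℤ) (P : Polynomial ℝ) (f : L2Space ν α) :
    inner ℂ (psiElem hν α n P) f = ∫ z in strip, f z * conj (psiPoly ν α n P z) * weight ν z := by
  rw [inner_def]
  refine integral_congr_ae (ae_restrict_of_ae ?_)
  filter_upwards [coeFn_psiElem hν α n P] with z hz
  rw [hz]

/-- The element `ψ_{m,n}` of `L^{2,ν}_{Γ,α}`. -/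
def psiVec (hν : 0 < ν) (α : ℝ) (i : ℕ × ℤ) : L2Space ν α :=
  psiElem hν α i.2 (hermiteConst i.1 • hermitePoly i.1)

lemma psiHermite_eq_psiPoly (ν α : ℝ) (m : ℕ) (n : ℤ) :
    psiHermite ν α m n = psiPoly ν α n (hermiteConst m • hermitePoly m) := by
  funext z
  rw [psiHermite_eq, psiPoly_smul]

lemma coeFn_psiVec (hν : 0 < ν) (α : ℝ) (i : ℕ × ℤ) :
    ∀ᵐ z, psiVec hν α i z = psiHermite ν α i.1 i.2 z := by
  rw [psiHermite_eq_psiPoly]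
  exact coeFn_psiElem hν α _ _

lemma orthonormal_psiVec (hν : 0 < ν) (α : ℝ) : Orthonormal ℂ (psiVec hν α) := by
  classical
  rw [orthonormal_iff_ite]
  rintro ⟨m, n⟩ ⟨m', n'⟩
  refine (inner_psiElem hν _ _ _).trans ((integral_congr_ae (ae_restrict_of_ae ?_)).trans
    ((integral_psiPoly hν α n' n (hermiteConst m' • hermitePoly m')
      (hermiteConst m • hermitePoly m)).trans ?_))
  · filter_upwards [coeFn_psiElem hν α n' (hermiteConst m' • hermitePoly m')] with z hz
    rw [psiVec, hz]
  have e : ∀ t : ℝ, (hermiteConst m' • hermitePoly m' * hermiteConst m • hermitePoly m).eval t *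
      Real.exp (-1 * t ^ 2) = hermiteConst m' * hermiteConst m *
        ((hermitePoly m' * hermitePoly m).eval t * Real.exp (-1 * t ^ 2)) := by
    intro t
    simp only [Polynomial.eval_mul, Polynomial.eval_smul, smul_eq_mul]; ring
  simp only [e, Prod.mk.injEq]
  rw [integral_const_mul]
  by_cases hn : n' = n
  · subst hn
    by_cases hm : m' = m
    · subst hm
      have h0 : (0 : ℝ) < 2 ^ m' * m'.factorial := by
        have : (0 : ℝ) < m'.factorial := by exact_mod_cast m'.factorial_pos
        positivity
      have hc : hermiteConst m' * hermiteConst m' = (2 ^ m' * m'.factorial : ℝ)⁻¹ := by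
        rw [hermiteConst, ← Real.rpow_add h0, ← Real.rpow_neg_one]; norm_num
      rw [integral_hermitePoly_self, hc]
      have hp : √Real.pi ≠ 0 := (Real.sqrt_pos.2 Real.pi_pos).ne'
      have : (√Real.pi)⁻¹ * ((2 ^ m' * m'.factorial : ℝ)⁻¹ *
          (2 ^ m' * m'.factorial * √Real.pi)) = 1 := by
        field_simp
      rw [this]
      simp
    · rw [integral_hermitePoly_of_ne hm]
      simp [Ne.symm hm]
  · simp [hn, Ne.symm hn]

/-! ### Cutoff functions -/

/-- With `B` a smooth step from `0` to `1`, the function `B(x) - B(x-1)` telescopes under integer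
translations, giving a smooth partition of unity. -/
lemma exists_cutoff : ∃ χ : ℝ → ℝ, ContDiff ℝ ∞ χ ∧ tsupport χ ⊆ Set.Icc 0 2 ∧
    ∀ x ∈ Set.Icc (0 : ℝ) 1, χ x + χ (x + 1) = 1 ∧ deriv χ x + deriv χ (x + 1) = 0 ∧
      deriv (deriv χ) x + deriv (deriv χ) (x + 1) = 0 := by
  set B : ℝ → ℝ := fun x => Real.smoothTransition (3 * x - 1) with hB
  have hBs : ContDiff ℝ ∞ B :=
    Real.smoothTransition.contDiff.comp ((contDiff_const.mul contDiff_id).sub contDiff_const)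
  have hB0 : ∀ x, x ≤ 1 / 3 → B x = 0 := fun x hx =>
    Real.smoothTransition.zero_of_nonpos (by linarith)
  have hB1 : ∀ x, 2 / 3 ≤ x → B x = 1 := fun x hx =>
    Real.smoothTransition.one_of_one_le (by linarith)
  set χ : ℝ → ℝ := fun x => B x - B (x - 1) with hχ
  have hχs : ContDiff ℝ ∞ χ := hBs.sub (hBs.comp (contDiff_id.sub contDiff_const))
  have hd1 : Differentiable ℝ χ := hχs.differentiable (by simp)
  have hd2 : Differentiable ℝ (deriv χ) :=
    (hχs.iterate_deriv 1).differentiable (by simp)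
  refine ⟨χ, hχs, closure_minimal (fun x hx => ?_) isClosed_Icc, fun x hx => ?_⟩
  · by_contra h
    apply hx
    simp only [Set.mem_Icc, not_and_or, not_le] at h
    simp only [hχ]
    rcases h with h | h
    · rw [hB0 _ (by linarith), hB0 _ (by linarith), sub_self]
    · rw [hB1 _ (by linarith), hB1 _ (by linarith), sub_self]
  -- The identity holds on `(-1/3, 4/3)`, a neighbourhood of every point of `[0,1]` including the
  -- endpoints, so it may be differentiated there.
  · have h0 : (fun x => χ x + χ (x + 1)) =ᶠ[nhds x] fun _ => 1 := by
      have : Set.Ioo (-1 / 3 : ℝ) (4 / 3) ∈ nhds x :=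
        Ioo_mem_nhds (by linarith [hx.1]) (by linarith [hx.2])
      filter_upwards [this] with y hy
      simp only [hχ, add_sub_cancel_right]
      rw [hB0 (y - 1) (by linarith [hy.2]), hB1 (y + 1) (by linarith [hy.1])]
      ring
    have hsh : ∀ {f : ℝ → ℝ}, Differentiable ℝ f → Differentiable ℝ fun x => f (x + 1) :=
      fun hf => hf.comp (differentiable_id.add_const 1)
    have e1 : deriv (fun x => χ x + χ (x + 1)) = fun x => deriv χ x + deriv χ (x + 1) := by
      funext y
      rw [deriv_fun_add (hd1 y) (hsh hd1 y), deriv_comp_add_const]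
    have e2 : deriv (fun x => deriv χ x + deriv χ (x + 1)) =
        fun x => deriv (deriv χ) x + deriv (deriv χ) (x + 1) := by
      funext y
      rw [deriv_fun_add (hd2 y) (hsh hd2 y), deriv_comp_add_const]
    have h1 := h0.deriv
    rw [e1] at h1
    have h2 := h1.deriv
    rw [e2] at h2
    refine ⟨h0.eq_of_nhds, ?_, ?_⟩
    · simpa using h1.eq_of_nhds
    · simpa using h2.eq_of_nhds

/-- Unfolding replaces the cutoff in `x` by the constant `s`. For the partition of unity `s = 1`;
for its derivatives `s = 0`, and the integral disappears. -/
lemma IsPeriodicAE.integral_cutoff_mul {P : ℂ → ℂ} (hP : IsPeriodicAE P)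
    (hi : IntegrableOn P strip) {a b : ℝ → ℝ} (ha : Continuous a) (has : tsupport a ⊆ Set.Icc 0 2)
    (hb : Continuous b) (hbc : HasCompactSupport b) {s : ℝ}
    (hs : ∀ x ∈ Set.Icc (0 : ℝ) 1, a x + a (x + 1) = s) :
    Integrable (fun z : ℂ => ((a z.re : ℝ) : ℂ) * (b z.im : ℝ) * P z) ∧
      ∫ z : ℂ, ((a z.re : ℝ) : ℂ) * (b z.im : ℝ) * P z =
        s * ∫ z in strip, ((b z.im : ℝ) : ℂ) * P z := by
  have hac : HasCompactSupport a := isCompact_Icc.of_isClosed_subset isClosed_closure has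
  obtain ⟨C, hC⟩ := ha.bounded_above_of_compact_support hac
  obtain ⟨D, hD⟩ := hb.bounded_above_of_compact_support hbc
  have hC0 : 0 ≤ C := (norm_nonneg _).trans (hC 0)
  obtain ⟨h1, h2⟩ := hP.integral_kernel_mul hi
    (k := fun z : ℂ => ((a z.re : ℝ) : ℂ) * (b z.im : ℝ)) (C := C * D)
    (by fun_prop)
    (fun z => by
      rw [norm_mul, Complex.norm_real, Complex.norm_real]
      exact mul_le_mul (hC _) (hD _) (norm_nonneg _) hC0)
    (fun z hz => by
      have : a z.re = 0 := by
        by_contra h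
        have := has (subset_tsupport _ h)
        rcases hz with hz | hz
        · linarith [this.1]
        · linarith [this.2]
      simp [this])
  refine ⟨h1, h2.trans ?_⟩
  rw [← integral_const_mul]
  refine setIntegral_congr_fun measurableSet_strip fun z hz => ?_
  simp only [add_re, one_re, add_im, one_im, add_zero]
  rw [← hs z.re hz]
  push_cast; ring

/-- The Leibniz rule, grouped so that the coefficient `ν z̄` occurs only inside `Δ_ν u` and `A* u`,
which stay quasi-periodic for `u = ψ_n P(t_n)`. -/
lemma landau_mul {c u : ℂ → ℂ} (hc : ContDiff ℝ ∞ c) (hu : ContDiff ℝ ∞ u) (z : ℂ) :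
    landau ν (fun w => c w * u w) z = c z * landau ν u z - dz (opA c) z * u z
      + opA c z * opAStar ν u z - dz c z * opA u z := by
  have hd : ∀ {f : ℂ → ℂ}, ContDiff ℝ ∞ f → ∀ z, DifferentiableAt ℝ f z :=
    fun h z => (h.differentiable (by simp)) z
  have h1 : opA (fun w => c w * u w) = fun w => opA c w * u w + c w * opA u w :=
    funext fun w => opA_mul (hd hc w) (hd hu w)
  rw [landau, h1, dz_add (hd ((contDiff_opA hc).mul hu) z) (hd (hc.mul (contDiff_opA hu)) z),
    dz_mul (hd (contDiff_opA hc) z) (hd hu z), dz_mul (hd hc z) (hd (contDiff_opA hu) z), landau,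
    opAStar]
  ring

lemma cutoff_derivatives {a b : ℝ → ℝ} (ha : ContDiff ℝ ∞ a) (hb : ContDiff ℝ ∞ b) (z : ℂ) :
    let c : ℂ → ℂ := fun z => ((a z.re : ℝ) : ℂ) * (b z.im : ℝ)
    opA c z = (deriv a z.re * b z.im + I * (a z.re * deriv b z.im)) / 2 ∧
    dz c z = (deriv a z.re * b z.im - I * (a z.re * deriv b z.im)) / 2 ∧
    dz (opA c) z = (deriv (deriv a) z.re * b z.im + a z.re * deriv (deriv b) z.im) / 4 := by
  intro c
  have h1 : ∀ {p : ℝ → ℝ}, ContDiff ℝ ∞ p → ∀ x, HasDerivAt p (deriv p x) x :=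
    fun hp x => ((hp.differentiable (by simp)) x).hasDerivAt
  have h2 : ∀ {p : ℝ → ℝ}, ContDiff ℝ ∞ p → ContDiff ℝ ∞ (deriv p) :=
    fun hp => hp.iterate_deriv 1
  have hr : ∀ {p : ℝ → ℝ}, ContDiff ℝ ∞ p → ∀ z : ℂ,
      DifferentiableAt ℝ (fun w : ℂ => ((p w.re : ℝ) : ℂ)) z :=
    fun hp z => (hasFDerivAt_comp_re (h1 hp z.re)).differentiableAt
  have hi : ∀ {p : ℝ → ℝ}, ContDiff ℝ ∞ p → ∀ z : ℂ,
      DifferentiableAt ℝ (fun w : ℂ => ((p w.im : ℝ) : ℂ)) z :=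
    fun hp z => (hasFDerivAt_comp_im (h1 hp z.im)).differentiableAt
  have hA : ∀ z, opA c z = 1 / 2 * (((deriv a z.re : ℝ) : ℂ) * (b z.im : ℝ))
      + I / 2 * (((a z.re : ℝ) : ℂ) * (deriv b z.im : ℝ)) := by
    intro z
    rw [opA_mul (hr ha z) (hi hb z), opA_comp_re (h1 ha _), opA_comp_im (h1 hb _)]
    ring
  refine ⟨?_, ?_, ?_⟩
  · rw [hA]; ring
  · rw [dz_mul (hr ha z) (hi hb z), dz_comp_re (h1 ha _), dz_comp_im (h1 hb _)]
    ring
  · have d1 : DifferentiableAt ℝ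
        (fun w : ℂ => ((deriv a w.re : ℝ) : ℂ) * (b w.im : ℝ)) z := (hr (h2 ha) z).mul (hi hb z)
    have d2 : DifferentiableAt ℝ
        (fun w : ℂ => ((a w.re : ℝ) : ℂ) * (deriv b w.im : ℝ)) z := (hr ha z).mul (hi (h2 hb) z)
    rw [funext hA, dz_add (d1.const_mul _) (d2.const_mul _), dz_const_mul _ d1,
      dz_const_mul _ d2, dz_mul (hr (h2 ha) z) (hi hb z),
      dz_mul (hr ha z) (hi (h2 hb) z), dz_comp_re (h1 ha _), dz_comp_re (h1 (h2 ha) _),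
      dz_comp_im (h1 hb _), dz_comp_im (h1 (h2 hb) _)]
    linear_combination (-(1 / 4) * ((a z.re : ℝ) : ℂ) * (deriv (deriv b) z.im : ℝ)) * I_sq

/-! ### The Landau operator on coefficients -/

lemma L2Space.integrableOn_mul_conj (f : L2Space ν α) {h : ℂ → ℂ} (hh : ∃ e : L2Space ν α,
    ∀ᵐ z, e z = h z) : IntegrableOn (fun z => f z * conj (h z) * weight ν z) strip := by
  obtain ⟨e, he⟩ := hh
  refine (integrableOn_inner e f).congr (ae_restrict_of_ae ?_)
  filter_upwards [he] with z hz
  rw [hz]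

lemma psiPoly_periodic (f : L2Space ν α) (n : ℤ) (P : Polynomial ℝ) :
    IsPeriodicAE fun z => f z * conj (psiPoly ν α n P z) * weight ν z :=
  (quasiPeriodic f).isPeriodicAE (isQuasiPeriodic_psiPoly ν α n P).ae

lemma psiPoly_integrableOn (hν : 0 < ν) (f : L2Space ν α) (n : ℤ) (P : Polynomial ℝ) :
    IntegrableOn (fun z => f z * conj (psiPoly ν α n P z) * weight ν z) strip :=
  f.integrableOn_mul_conj ⟨psiElem hν α n P, coeFn_psiElem hν α n P⟩

lemma tendsto_integral_cutoff {P : ℂ → ℂ} (hi : IntegrableOn P strip) {β : ℕ → ℝ → ℝ}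
    (hβ : ∀ N, Continuous (β N)) {C : ℝ} (hC : ∀ N y, |β N y| ≤ C) {l : ℝ}
    (hl : ∀ y, Filter.Tendsto (fun N => β N y) Filter.atTop (nhds l)) :
    Filter.Tendsto (fun N => ∫ z in strip, ((β N z.im : ℝ) : ℂ) * P z) Filter.atTop
      (nhds (l * ∫ z in strip, P z)) := by
  rw [← integral_const_mul]
  refine tendsto_integral_of_dominated_convergence (fun z => C * ‖P z‖) (fun N => ?_)
    (hi.norm.const_mul C) (fun N => ae_of_all _ fun z => ?_) (ae_of_all _ fun z => ?_)
  · have := hβ N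
    exact (by fun_prop : Continuous fun z : ℂ => ((β N z.im : ℝ) : ℂ)).aestronglyMeasurable.mul
      hi.aestronglyMeasurable
  · rw [norm_mul, Complex.norm_real]
    exact mul_le_mul_of_nonneg_right (hC N _) (norm_nonneg _)
  · exact ((continuous_ofReal.tendsto l).comp (hl z.im)).mul_const _

/-- A sequence of cutoffs on the line with derivatives tending to zero. -/
lemma exists_cutoff_seq : ∃ (β : ℕ → ℝ → ℝ) (C : ℝ), (∀ N, ContDiff ℝ ∞ (β N)) ∧
    (∀ N, HasCompactSupport (β N)) ∧
    (∀ N y, |β N y| ≤ C ∧ |deriv (β N) y| ≤ C ∧ |deriv (deriv (β N)) y| ≤ C) ∧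
    ∀ y, Filter.Tendsto (fun N => β N y) Filter.atTop (nhds 1) ∧
      Filter.Tendsto (fun N => deriv (β N) y) Filter.atTop (nhds 0) ∧
      Filter.Tendsto (fun N => deriv (deriv (β N)) y) Filter.atTop (nhds 0) := by
  let η : ContDiffBump (0 : ℝ) := ⟨1, 2, one_pos, one_lt_two⟩
  have hη : ContDiff ℝ ∞ η := η.contDiff
  have hηc : HasCompactSupport η := η.hasCompactSupport
  have hη1 : ContDiff ℝ ∞ (deriv η) := hη.iterate_deriv 1
  have hη2 : ContDiff ℝ ∞ (deriv (deriv η)) := hη.iterate_deriv 2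
  obtain ⟨C0, h0⟩ := hη.continuous.bounded_above_of_compact_support hηc
  obtain ⟨C1, h1⟩ := hη1.continuous.bounded_above_of_compact_support hηc.deriv
  obtain ⟨C2, h2⟩ := hη2.continuous.bounded_above_of_compact_support hηc.deriv.deriv
  -- The cutoffs are the dilates `η(ε y)`: each derivative gains a factor `ε ≤ 1`, which gives
  -- uniform bounds as well as convergence to zero.
  set ε : ℕ → ℝ := fun N => 1 / ((N : ℝ) + 1) with hε
  have hε0 : ∀ N, 0 < ε N := fun N => Nat.one_div_pos_of_nat
  have hε1 : ∀ N, ε N ≤ 1 := fun N => by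
    rw [hε]; simp only
    rw [div_le_one (by positivity)]
    have : (0 : ℝ) ≤ N := Nat.cast_nonneg N
    linarith
  have hεt : Filter.Tendsto ε Filter.atTop (nhds 0) := tendsto_one_div_add_atTop_nhds_zero_nat
  have hd1 : ∀ N, deriv (fun y => η (ε N * y)) = fun y => ε N * deriv η (ε N * y) := fun N => by
    funext y
    have := deriv_comp_mul_left (ε N) η y
    simpa using this
  have hd2 : ∀ N, deriv (fun y => ε N * deriv η (ε N * y))
      = fun y => ε N * (ε N * deriv (deriv η) (ε N * y)) := fun N => by
    funext y
    have := deriv_comp_mul_left (ε N) (deriv η) y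
    rw [deriv_const_mul_field, this, smul_eq_mul]
  have harg : ∀ y, Filter.Tendsto (fun N => ε N * y) Filter.atTop (nhds 0) := fun y => by
    simpa using hεt.mul_const y
  have hC : ∀ N (x D : ℝ), ‖x‖ ≤ D → |ε N * x| ≤ D := fun N x D hx => by
    rw [abs_mul, abs_of_pos (hε0 N)]
    calc ε N * |x| ≤ 1 * |x| := mul_le_mul_of_nonneg_right (hε1 N) (abs_nonneg _)
      _ ≤ D := by rw [one_mul]; exact hx
  refine ⟨fun N y => η (ε N * y), max C0 (max C1 C2), fun N => ?_, fun N => ?_, fun N y => ?_,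
    fun y => ?_⟩
  · exact hη.comp (contDiff_const.mul contDiff_id)
  · exact hηc.comp_homeomorph (Homeomorph.mulLeft₀ (ε N) (hε0 N).ne')
  · rw [hd1, hd2]
    refine ⟨(h0 _).trans (le_max_left _ _), ?_, ?_⟩
    · exact (hC N _ _ (h1 _)).trans ((le_max_left _ _).trans (le_max_right _ _))
    · exact (hC N _ _ (hC N _ _ (h2 _))).trans ((le_max_right _ _).trans (le_max_right _ _))
  · simp only [hd1, hd2]
    refine ⟨?_, ?_, ?_⟩
    · have h : η 0 = 1 := η.one_of_mem_closedBall (by simp [η.rIn_pos.le])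
      rw [← h]
      exact (hη.continuous.tendsto 0).comp (harg y)
    · simpa using hεt.mul ((hη1.continuous.tendsto 0).comp (harg y))
    · simpa using hεt.mul (hεt.mul ((hη2.continuous.tendsto 0).comp (harg y)))

/-- A smooth function of compact support in the direction of `y` that tests `Δ_ν f = g`
against `ψ_n P(t_n)`, where `ψ_n P(t_n)` is an eigenfunction. -/
lemma integral_cutoff_im (hν : 0 < ν) {f g : L2Space ν α} (hfg : IsWeakLandau ν f g) (n : ℤ)
    {P : Polynomial ℝ} {lam : ℝ}
    (hP : landau ν (psiPoly ν α n P) = fun z => lam * psiPoly ν α n P z)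
    {b : ℝ → ℝ} (hb : ContDiff ℝ ∞ b) (hbc : HasCompactSupport b)
    {J : (ℝ → ℝ) → L2Space ν α → Polynomial ℝ → ℂ}
    (hJ : ∀ b h Q, J b h Q = ∫ z in strip,
      ((b z.im : ℝ) : ℂ) * (h z * conj (psiPoly ν α n Q z) * weight ν z)) :
    J b g P = lam * J b f P - 1 / 4 * J (deriv (deriv b)) f P
      + √(2 * ν) / 4 * J (deriv b) f (2 * Polynomial.X * P - Polynomial.derivative P)
      - √(2 * ν) / 4 * J (deriv b) f (Polynomial.derivative P) := by
  obtain ⟨a, ha, has, hs⟩ := exists_cutoff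
  have ha1 : ContDiff ℝ ∞ (deriv a) := ha.iterate_deriv 1
  have ha2 : ContDiff ℝ ∞ (deriv (deriv a)) := ha.iterate_deriv 2
  have hb1 : ContDiff ℝ ∞ (deriv b) := hb.iterate_deriv 1
  have hb2 : ContDiff ℝ ∞ (deriv (deriv b)) := hb.iterate_deriv 2
  have has1 : tsupport (deriv a) ⊆ Set.Icc 0 2 := (tsupport_deriv_subset (f := a)).trans has
  have has2 : tsupport (deriv (deriv a)) ⊆ Set.Icc 0 2 :=
    (tsupport_deriv_subset (f := deriv a)).trans has1
  have hac : HasCompactSupport a := isCompact_Icc.of_isClosed_subset isClosed_closure has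
  -- Integrability and the value of an integral are carried together, so that the Leibniz terms can
  -- be added without separate integrability proofs.
  let HI : (ℂ → ℂ) → ℂ → Prop := fun F v => Integrable F ∧ ∫ z, F z = v
  have hadd : ∀ {F G v w}, HI F v → HI G w → HI (fun z => F z + G z) (v + w) :=
    fun h1 h2 => ⟨h1.1.add h2.1, by rw [integral_add h1.1 h2.1, h1.2, h2.2]⟩
  have hmul : ∀ {F v} (c : ℂ), HI F v → HI (fun z => c * F z) (c * v) :=
    fun c h => ⟨h.1.const_mul c, by rw [integral_const_mul, h.2]⟩
  have key : ∀ {a b : ℝ → ℝ} (h : L2Space ν α) (Q : Polynomial ℝ) {s : ℝ}, Continuous a →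
      tsupport a ⊆ Set.Icc 0 2 → Continuous b → HasCompactSupport b →
      (∀ x ∈ Set.Icc (0 : ℝ) 1, a x + a (x + 1) = s) →
      HI (fun z : ℂ => ((a z.re : ℝ) : ℂ) * (b z.im : ℝ) *
        (h z * conj (psiPoly ν α n Q z) * weight ν z)) (s * J b h Q) :=
    by
      intro a b h Q s h1 h2 h3 h4 h5
      rw [hJ]
      exact (psiPoly_periodic h n Q).integral_cutoff_mul (psiPoly_integrableOn hν h n Q)
        h1 h2 h3 h4 h5
  set K := 2 * Polynomial.X * P - Polynomial.derivative P with hK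
  set D := Polynomial.derivative P with hD
  -- The seven terms of the Leibniz rule. Those with a derivative of `a` (`k2`, `k4`, `k6`) unfold
  -- with `s = 0` and contribute nothing; those with derivatives of `b` (`k3`, `k5`, `k7`) remain
  -- for the limit argument.
  have k1 := hmul lam (key f P ha.continuous has hb.continuous hbc fun x hx => (hs x hx).1)
  have k2 := hmul (-1 / 4) (key f P ha2.continuous has2 hb.continuous hbc
    fun x hx => (hs x hx).2.2)
  have k3 := hmul (-1 / 4) (key f P ha.continuous has hb2.continuous hbc.deriv.deriv
    fun x hx => (hs x hx).1)
  have k4 := hmul (I / 4 * √(2 * ν)) (key f K ha1.continuous has1 hb.continuous hbc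
    fun x hx => (hs x hx).2.1)
  have k5 := hmul (√(2 * ν) / 4) (key f K ha.continuous has hb1.continuous hbc.deriv
    fun x hx => (hs x hx).1)
  have k6 := hmul (I / 4 * √(2 * ν)) (key f D ha1.continuous has1 hb.continuous hbc
    fun x hx => (hs x hx).2.1)
  have k7 := hmul (-√(2 * ν) / 4) (key f D ha.continuous has hb1.continuous hbc.deriv
    fun x hx => (hs x hx).1)
  have kg := key g P ha.continuous has hb.continuous hbc fun x hx => (hs x hx).1
  have ktot := hadd k1 (hadd k2 (hadd k3 (hadd k4 (hadd k5 (hadd k6 k7)))))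
  set c : ℂ → ℂ := fun z => ((a z.re : ℝ) : ℂ) * (b z.im : ℝ) with hc
  have hcs : ContDiff ℝ ∞ c :=
    (ofRealCLM.contDiff.comp (ha.comp reCLM.contDiff)).mul
      (ofRealCLM.contDiff.comp (hb.comp imCLM.contDiff))
  have hcc : HasCompactSupport c := by
    refine HasCompactSupport.intro (K := Set.Icc (0 : ℝ) 2 ×ℂ tsupport b)
      (isCompact_Icc.reProdIm hbc) fun z hz => ?_
    rw [mem_reProdIm, not_and_or] at hz
    simp only [hc]
    rcases hz with hz | hz
    · rw [image_eq_zero_of_notMem_tsupport fun h => hz (has h)]; simp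
    · rw [image_eq_zero_of_notMem_tsupport hz]; simp
  have hu := contDiff_psiPoly ν α n P
  have htest := hfg (fun z => c z * psiPoly ν α n P z) (hcs.mul hu) hcc.mul_right
  have el : ∀ z, landau ν (fun z => c z * psiPoly ν α n P z) z =
      c z * (lam * psiPoly ν α n P z)
      - (deriv (deriv a) z.re * b z.im + a z.re * deriv (deriv b) z.im) / 4 * psiPoly ν α n P z
      + (deriv a z.re * b z.im + I * (a z.re * deriv b z.im)) / 2 *
        (-(I / 2) * √(2 * ν) * psiPoly ν α n K z)
      - (deriv a z.re * b z.im - I * (a z.re * deriv b z.im)) / 2 *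
        (I / 2 * √(2 * ν) * psiPoly ν α n D z) := by
    intro z
    obtain ⟨d1, d2, d3⟩ := cutoff_derivatives ha hb z
    rw [landau_mul hcs hu, hP, d1, d2, d3, opAStar_psiPoly hν, opA_psiPoly, ← hK, ← hD]
  have hcongr : ∀ {F G : ℂ → ℂ} {v : ℂ}, HI F v → (∀ z, G z = F z) → ∫ z, G z = v :=
    fun h he => (integral_congr_ae (ae_of_all _ he)).trans h.2
  have e1 := hcongr ktot
    (G := fun z => f z * conj (landau ν (fun z => c z * psiPoly ν α n P z) z) * weight ν z)
    fun z => by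
      simp only [el]
      simp only [hc, map_mul, map_add, map_sub, map_neg, map_div₀, conj_ofReal, conj_I,
        map_ofNat]
      linear_combination (-√(2 * ν) / 4 * (((a z.re : ℝ) : ℂ) * (deriv b z.im : ℝ))
        * (f z * (conj (psiPoly ν α n K z) - conj (psiPoly ν α n D z)) * weight ν z)) * I_sq
  have e2 := hcongr kg (G := fun z => g z * conj (c z * psiPoly ν α n P z) * weight ν z)
    fun z => by simp only [hc, map_mul, conj_ofReal]; ring
  rw [e1, e2] at htest
  push_cast at htest
  linear_combination -htest

/-- The Landau operator multiplies the coefficient at `ψ_{m,n}` by `ν m`. -/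
lemma inner_psiVec_of_isWeakLandau (hν : 0 < ν) {f g : L2Space ν α} (hfg : IsWeakLandau ν f g)
    (i : ℕ × ℤ) : inner ℂ (psiVec hν α i) g = ν * i.1 * inner ℂ (psiVec hν α i) f := by
  obtain ⟨m, n⟩ := i
  obtain ⟨β, C, hβ, hβc, hC, hl⟩ := exists_cutoff_seq
  set P := hermiteConst m • hermitePoly m with hP
  have hP' : landau ν (psiPoly ν α n P) = fun z => ((ν * m : ℝ) : ℂ) * psiPoly ν α n P z := by
    rw [hP, ← psiHermite_eq_psiPoly, landau_psiHermite hν]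
    push_cast; rfl
  have hβ1 : ∀ N, ContDiff ℝ ∞ (deriv (β N)) := fun N => (hβ N).iterate_deriv 1
  have hβ2 : ∀ N, ContDiff ℝ ∞ (deriv (deriv (β N))) := fun N => (hβ N).iterate_deriv 2
  have h := fun N => integral_cutoff_im hν hfg n hP' (hβ N) (hβc N) (fun _ _ _ => rfl)
  have t0 : ∀ h : L2Space ν α, _ := fun h => tendsto_integral_cutoff
    (psiPoly_integrableOn hν h n P) (fun N => (hβ N).continuous) (fun N y => (hC N y).1)
    (fun y => (hl y).1)
  have t1 : ∀ Q : Polynomial ℝ, _ := fun Q => tendsto_integral_cutoff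
    (psiPoly_integrableOn hν f n Q) (fun N => (hβ1 N).continuous) (fun N y => (hC N y).2.1)
    (fun y => (hl y).2.1)
  have t2 := tendsto_integral_cutoff
    (psiPoly_integrableOn hν f n P) (fun N => (hβ2 N).continuous) (fun N y => (hC N y).2.2)
    (fun y => (hl y).2.2)
  -- In the limit every term containing a derivative of the cutoff tends to zero, leaving only the
  -- eigenvalue relation.
  have tr := ((((t0 f).const_mul ((ν * m : ℝ) : ℂ)).sub (t2.const_mul (1 / 4))).add
    ((t1 (2 * Polynomial.X * P - Polynomial.derivative P)).const_mul (√(2 * ν) / 4 : ℂ))).sub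
    ((t1 (Polynomial.derivative P)).const_mul (√(2 * ν) / 4 : ℂ))
  have e := tendsto_nhds_unique (t0 g) (tr.congr fun N => (h N).symm)
  rw [psiVec, inner_psiElem, inner_psiElem]
  simpa using e

/-! ### Completeness of the space -/

lemma psi_ne_zero (hν : 0 < ν) (α : ℝ) (n : ℤ) (z : ℂ) : psi ν α n z ≠ 0 := by
  rw [psi]
  have : (2 * ν / Real.pi) ^ (1 / 4 : ℝ) ≠ 0 :=
    (Real.rpow_pos_of_pos (div_pos (by positivity) Real.pi_pos) _).ne'
  exact mul_ne_zero (mul_ne_zero (by exact_mod_cast this) (exp_ne_zero _)) (exp_ne_zero _)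

lemma weight_half_sq (ν : ℝ) (z : ℂ) : weight (ν / 2) z ^ 2 = weight ν z := by
  rw [weight, weight, ← Real.exp_nat_mul]; congr 1; push_cast; ring

lemma aestronglyMeasurable_mul_weight (f : L2Space ν α) :
    AEStronglyMeasurable (fun z => f z * (weight (ν / 2) z : ℂ)) (volume.restrict strip) :=
  ((aesm f).mul (continuous_ofReal.comp (continuous_weight _)).aestronglyMeasurable).mono_measure
    Measure.restrict_le_self

lemma norm_mul_weight_sq (a : ℂ) (z : ℂ) :
    ‖a * (weight (ν / 2) z : ℂ)‖ ^ 2 = ‖a‖ ^ 2 * weight ν z := by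
  rw [norm_mul, mul_pow, Complex.norm_real, Real.norm_of_nonneg (weight_pos _ _).le,
    weight_half_sq]

lemma memLp_mul_weight (f : L2Space ν α) :
    MemLp (fun z => f z * (weight (ν / 2) z : ℂ)) 2 (volume.restrict strip) := by
  rw [memLp_two_iff_integrable_sq_norm (aestronglyMeasurable_mul_weight f)]
  simp only [norm_mul_weight_sq]
  exact squareIntegrable f

/-- The isometric embedding of `L^{2,ν}_{Γ,α}` into the `L²` space of the strip. -/
def toStripLp (ν α : ℝ) : L2Space ν α →ₗᵢ[ℂ] Lp ℂ 2 (volume.restrict strip) where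
  toFun f := (memLp_mul_weight f).toLp _
  map_add' f g := by
    rw [← MemLp.toLp_add]
    refine MemLp.toLp_congr _ _ (ae_restrict_of_ae ?_)
    filter_upwards [coeFn_add f g] with z hz
    simp only [Pi.add_apply, hz]; ring
  map_smul' c f := by
    rw [RingHom.id_apply, ← MemLp.toLp_const_smul]
    refine MemLp.toLp_congr _ _ (ae_restrict_of_ae ?_)
    filter_upwards [coeFn_smul c f] with z hz
    simp only [Pi.smul_apply, hz, smul_eq_mul]; ring
  norm_map' f := by
    have h1 := congrArg RCLike.re (L2.inner_def (𝕜 := ℂ) ((memLp_mul_weight f).toLp _)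
      ((memLp_mul_weight f).toLp _))
    rw [← norm_sq_eq_re_inner] at h1
    have h2 : ∫ z in strip, inner ℂ (((memLp_mul_weight f).toLp _ : ℂ → ℂ) z)
        (((memLp_mul_weight f).toLp _ : ℂ → ℂ) z) =
        ∫ z in strip, ((‖f z‖ ^ 2 * weight ν z : ℝ) : ℂ) := by
      refine integral_congr_ae ?_
      filter_upwards [(memLp_mul_weight f).coeFn_toLp] with z hz
      rw [hz, inner_self_eq_norm_sq_to_K, ← norm_mul_weight_sq]
      simp
    rw [h2, integral_complex_ofReal, ← norm_sq_eq] at h1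
    have h3 : ‖(memLp_mul_weight f).toLp _‖ ^ 2 = ‖f‖ ^ 2 := h1
    exact (sq_eq_sq₀ (norm_nonneg _) (norm_nonneg _)).1 h3

/-- Translation of a point into the half open strip `[0,1) × ℝ`. -/
def foldStrip (z : ℂ) : ℂ := ⟨Int.fract z.re, z.im⟩

lemma measurable_foldStrip : Measurable foldStrip :=
  measurableEquivRealProd.symm.measurable.comp
    ((measurable_fract.comp measurable_re).prodMk measurable_im)

lemma foldStrip_add_int (z : ℂ) (m : ℤ) : foldStrip (z + m) = foldStrip z := by
  simp [foldStrip]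

lemma ae_foldStrip : ∀ᵐ z ∂(volume.restrict strip), foldStrip z = z := by
  rw [ae_restrict_iff' measurableSet_strip]
  have h : ∀ᵐ z : ℂ, z.re ≠ 1 := by
    rw [ae_iff]; simpa using volume_re_eq 1
  filter_upwards [h] with z h1 h2
  refine Complex.ext ?_ rfl
  exact Int.fract_eq_self.2 ⟨h2.1, lt_of_le_of_ne h2.2 h1⟩

/-- Because `ψ_0` is quasi-periodic without zeros, every quasi-periodic function is `ψ_0` times a
periodic one. Dividing by `ψ_0` and the root of the weight on the strip, extending periodically and
multiplying back by `ψ_0` gives a preimage. -/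
lemma surjective_toStripLp (hν : 0 < ν) (α : ℝ) : Function.Surjective (toStripLp ν α) := by
  intro h
  set g : ℂ → ℂ := fun z => psi ν α 0 z * (h (foldStrip z) /
    (psi ν α 0 (foldStrip z) * (weight (ν / 2) (foldStrip z) : ℂ))) with hg
  have hpm : Measurable (psi ν α 0) := (differentiable_psi ν α 0).continuous.measurable
  have hwm : Measurable fun z => (weight (ν / 2) z : ℂ) :=
    (continuous_ofReal.comp (continuous_weight _)).measurable
  have hgm : Measurable g :=
    hpm.mul (((Lp.stronglyMeasurable h).measurable.comp measurable_foldStrip).div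
      ((hpm.comp measurable_foldStrip).mul (hwm.comp measurable_foldStrip)))
  have hq : IsQuasiPeriodic ν α g := by
    intro m z
    simp only [hg, foldStrip_add_int, psi_add_int]
    ring
  have hgh : ∀ᵐ z ∂(volume.restrict strip), g z * (weight (ν / 2) z : ℂ) = h z := by
    filter_upwards [ae_foldStrip] with z hz
    have h1 := psi_ne_zero hν α 0 z
    have h2 : (weight (ν / 2) z : ℂ) ≠ 0 := by exact_mod_cast (weight_pos _ z).ne'
    simp only [hg, hz]
    field_simp
  have hs : IsSquareIntegrable ν g := by
    refine ((memLp_two_iff_integrable_sq_norm (Lp.aestronglyMeasurable h)).1 (Lp.memLp h)).congr ?_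
    filter_upwards [hgh] with z hz
    rw [← hz, norm_mul_weight_sq]
  refine ⟨ofFun g hgm.aestronglyMeasurable hq.ae hs, ?_⟩
  refine Lp.ext ((MemLp.coeFn_toLp (memLp_mul_weight _)).trans ?_)
  filter_upwards [hgh, ae_restrict_of_ae (coeFn_ofFun g hgm.aestronglyMeasurable hq.ae hs)]
    with z h1 h2
  rw [h2, h1]

lemma completeSpace_L2Space (hν : 0 < ν) (α : ℝ) : CompleteSpace (L2Space ν α) :=
  (LinearIsometryEquiv.ofSurjective (toStripLp ν α)
    (surjective_toStripLp hν α)).toIsometryEquiv.completeSpace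

/-! ### Completeness of the system `ψ_{m,n}` -/

/-- Hermite polynomials span all polynomials, so for fixed `n` orthogonality to the basis gives
orthogonality to every `ψ_n P(t_n)`, in particular to monomials in `y`. -/
lemma integral_psiPoly_eq_zero (hν : 0 < ν) {f : L2Space ν α}
    (hf : ∀ i, inner ℂ (psiVec hν α i) f = 0) (n : ℤ) (P : Polynomial ℝ) :
    ∫ z in strip, f z * conj (psiPoly ν α n P z) * weight ν z = 0 := by
  have hP : P ∈ Submodule.span ℝ (Set.range hermitePoly) := by rw [span_hermitePoly]; trivial
  have hsm : ∀ (c : ℝ) (P : Polynomial ℝ),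
      ∫ z in strip, f z * conj (psiPoly ν α n (c • P) z) * weight ν z =
        c * ∫ z in strip, f z * conj (psiPoly ν α n P z) * weight ν z := by
    intro c P
    rw [← integral_const_mul]
    refine integral_congr_ae (ae_of_all _ fun z => ?_)
    simp only [psiPoly_smul, map_mul, conj_ofReal]; ring
  induction hP using Submodule.span_induction with
  | mem P hP =>
    obtain ⟨m, rfl⟩ := hP
    have h := hf (m, n)
    rw [psiVec, inner_psiElem, hsm] at h
    refine (mul_eq_zero.1 h).resolve_left ?_
    have : (0 : ℝ) < 2 ^ m * m.factorial := by
      have : (0 : ℝ) < m.factorial := by exact_mod_cast m.factorial_pos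
      positivity
    have h0 : hermiteConst m ≠ 0 := (Real.rpow_pos_of_pos this _).ne'
    exact_mod_cast h0
  | zero => simpa using hsm 0 0
  | add P Q _ _ h1 h2 =>
    have h3 := integral_add (psiPoly_integrableOn hν f n P) (psiPoly_integrableOn hν f n Q)
    rw [h1, h2, add_zero] at h3
    rw [← h3]
    refine integral_congr_ae (ae_of_all _ fun z => ?_)
    simp only [psiPoly, Polynomial.eval_add, map_mul, conj_ofReal]
    push_cast; ring
  | smul c P _ h => rw [hsm, h, mul_zero]

/-- The function on the strip whose Fourier transforms in `x` are tested against Gaussians. -/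
def gaussTwist (ν α : ℝ) (f : ℂ → ℂ) (z : ℂ) : ℂ :=
  f z * (conj (exp (ν / 2 * z ^ 2)) * exp (-(2 * I * Real.pi * α * z.re))) * weight ν z

/-- The surplus Gaussian in `y` is what later provides exponential moments. -/
lemma norm_gaussTwist_sq (ν α : ℝ) (f : ℂ → ℂ) (z : ℂ) :
    ‖gaussTwist ν α f z‖ ^ 2 = ‖f z‖ ^ 2 * weight ν z * Real.exp (-(2 * ν) * z.im ^ 2) := by
  have e1 : (ν / 2 * z ^ 2 : ℂ).re = ν / 2 * (z.re ^ 2 - z.im ^ 2) := by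
    have : (ν / 2 : ℂ) = ((ν / 2 : ℝ) : ℂ) := by push_cast; rfl
    rw [this, re_ofReal_mul]; simp [sq]
  have e2 : (-(2 * I * Real.pi * α * z.re) : ℂ).re = 0 := by simp
  rw [gaussTwist, norm_mul, norm_mul, norm_mul, RCLike.norm_conj, norm_exp, norm_exp, e1, e2,
    Real.exp_zero, mul_one, Complex.norm_real, Real.norm_of_nonneg (weight_pos _ _).le, mul_pow,
    mul_pow, mul_assoc, mul_assoc]
  congr 1
  rw [weight, ← Real.exp_nat_mul, ← Real.exp_nat_mul, ← Real.exp_add, ← Real.exp_add,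
    ← normSq_eq_norm_sq, normSq_apply]
  congr 1
  push_cast; ring

/-- All dependence on `n` is isolated in a constant, the character in `x`, a real exponential in `y`
and the polynomial; the twist of `f` is the same for all `n`. -/
lemma mul_conj_psiPoly_eq (ν α : ℝ) (f : ℂ → ℂ) (n : ℤ) (P : Polynomial ℝ) (z : ℂ) :
    f z * conj (psiPoly ν α n P z) * weight ν z =
      (((2 * ν / Real.pi) ^ (1 / 4 : ℝ) * Real.exp (-(Real.pi ^ 2 / ν) * (n + α) ^ 2) : ℝ) : ℂ) *
        (gaussTwist ν α f z * exp (-(2 * I * Real.pi * n * z.re)) *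
          ((Real.exp (-(2 * Real.pi * (n + α)) * z.im) : ℝ) : ℂ) *
          ((P.eval (hermiteArg ν α n z.im) : ℝ) : ℂ)) := by
  have hzc : conj z = z.re - z.im * I := by
    apply Complex.ext <;> simp
  have e : exp (conj (-(Real.pi ^ 2 / ν) * (n + α) ^ 2 + 2 * I * Real.pi * (α + n) * z)) =
      ((Real.exp (-(Real.pi ^ 2 / ν) * (n + α) ^ 2) : ℝ) : ℂ) *
        exp (-(2 * I * Real.pi * α * z.re)) * exp (-(2 * I * Real.pi * n * z.re)) *
        ((Real.exp (-(2 * Real.pi * (n + α)) * z.im) : ℝ) : ℂ) := by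
    simp only [ofReal_exp, ← exp_add]
    congr 1
    simp only [map_add, map_mul, map_neg, map_div₀, map_pow, conj_ofReal, conj_I,
      map_intCast, map_ofNat, hzc]
    push_cast
    linear_combination (2 * Real.pi * (α + n) * z.im) * I_sq
  rw [psiPoly, psi, gaussTwist]
  simp only [map_mul, conj_ofReal]
  rw [← exp_conj (-(Real.pi ^ 2 / ν) * (n + α) ^ 2 + 2 * I * Real.pi * (α + n) * z), e]
  push_cast
  ring

lemma aestronglyMeasurable_gaussTwist (f : L2Space ν α) :
    AEStronglyMeasurable (fun p : ℝ × ℝ => gaussTwist ν α f ⟨p.1, p.2⟩)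
      ((volume.restrict (Set.Icc (0 : ℝ) 1)).prod volume) := by
  have h : AEStronglyMeasurable (gaussTwist ν α f) (volume.restrict strip) := by
    refine AEStronglyMeasurable.mono_measure ?_ Measure.restrict_le_self
    refine ((aesm f).mul (Continuous.aestronglyMeasurable ?_)).mul
      (continuous_ofReal.comp (continuous_weight ν)).aestronglyMeasurable
    fun_prop
  exact h.comp_measurePreserving measurePreserving_strip

lemma integrable_gaussTwist_sq (hν : 0 < ν) (f : L2Space ν α) :
    Integrable (fun p : ℝ × ℝ => ‖gaussTwist ν α f ⟨p.1, p.2⟩‖ ^ 2)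
      ((volume.restrict (Set.Icc (0 : ℝ) 1)).prod volume) := by
  refine (integrableOn_strip_iff.1 (squareIntegrable f)).mono'
    ((aestronglyMeasurable_gaussTwist f).norm.pow 2) (ae_of_all _ fun p => ?_)
  rw [Real.norm_of_nonneg (sq_nonneg _), norm_gaussTwist_sq]
  refine mul_le_of_le_one_right (mul_nonneg (sq_nonneg _) (weight_pos _ _).le) ?_
  rw [Real.exp_le_one_iff]
  nlinarith [sq_nonneg p.2]

lemma integrable_gaussTwist_mul (hν : 0 < ν) (f : L2Space ν α) {k : ℝ × ℝ → ℂ}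
    (hk : Continuous k) {a : ℝ} (hka : ∀ p, ‖k p‖ ≤ Real.exp (a * |p.2|)) :
    Integrable (fun p : ℝ × ℝ => gaussTwist ν α f ⟨p.1, p.2⟩ * k p)
      ((volume.restrict (Set.Icc (0 : ℝ) 1)).prod volume) := by
  have h1 := integrableOn_strip_iff.1 (squareIntegrable f)
  have h2 : Integrable (fun p : ℝ × ℝ => Real.exp (a ^ 2 / ν) * Real.exp (-ν * p.2 ^ 2))
      ((volume.restrict (Set.Icc (0 : ℝ) 1)).prod volume) :=
    ((integrable_exp_neg_mul_sq hν).const_mul _).comp_snd _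
  refine (h1.add h2).mono' ((aestronglyMeasurable_gaussTwist f).mul hk.aestronglyMeasurable)
    (ae_of_all _ fun p => ?_)
  set r := ‖f ⟨p.1, p.2⟩‖ ^ 2 * weight ν ⟨p.1, p.2⟩ with hr
  set s := ‖gaussTwist ν α f ⟨p.1, p.2⟩‖ with hs
  have e1 : s ^ 2 = r * Real.exp (-(2 * ν) * p.2 ^ 2) := norm_gaussTwist_sq ν α f ⟨p.1, p.2⟩
  have e2 : (s * Real.exp (ν * p.2 ^ 2)) ^ 2 = r := by
    rw [mul_pow, e1, ← Real.exp_nat_mul, mul_assoc, ← Real.exp_add]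
    have : -(2 * ν) * p.2 ^ 2 + (2 : ℕ) * (ν * p.2 ^ 2) = 0 := by push_cast; ring
    rw [this, Real.exp_zero, mul_one]
  -- From `2a|y| ≤ a²/ν + νy²`. Writing the majorant as `(s e^{νy²}) · e^{a|y| - νy²}`, both factors
  -- are then square integrable on the strip.
  have e3 : Real.exp (a * |p.2| - ν * p.2 ^ 2) ^ 2 ≤
      Real.exp (a ^ 2 / ν) * Real.exp (-ν * p.2 ^ 2) := by
    rw [← Real.exp_nat_mul, ← Real.exp_add, Real.exp_le_exp]
    have h3 : 2 * (a * |p.2|) ≤ a ^ 2 / ν + ν * |p.2| ^ 2 := by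
      have : a ^ 2 / ν + ν * |p.2| ^ 2 - 2 * (a * |p.2|) = (a - ν * |p.2|) ^ 2 / ν := by
        field_simp; ring
      have h4 : 0 ≤ (a - ν * |p.2|) ^ 2 / ν := by positivity
      linarith
    rw [sq_abs] at h3
    push_cast
    linarith
  have e4 : s * Real.exp (a * |p.2|) =
      (s * Real.exp (ν * p.2 ^ 2)) * Real.exp (a * |p.2| - ν * p.2 ^ 2) := by
    rw [mul_assoc, ← Real.exp_add]; congr 2; ring
  rw [norm_mul, Pi.add_apply]
  calc s * ‖k p‖ ≤ s * Real.exp (a * |p.2|) := mul_le_mul_of_nonneg_left (hka p) (norm_nonneg _)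
    _ ≤ r + Real.exp (a ^ 2 / ν) * Real.exp (-ν * p.2 ^ 2) := by
      rw [e4]
      nlinarith [sq_nonneg (s * Real.exp (ν * p.2 ^ 2) - Real.exp (a * |p.2| - ν * p.2 ^ 2)),
        sq_nonneg (s * Real.exp (ν * p.2 ^ 2)), sq_nonneg (Real.exp (a * |p.2| - ν * p.2 ^ 2))]

lemma norm_exp_two_pi_I (n : ℤ) (x : ℝ) : ‖exp (-(2 * I * Real.pi * n * x))‖ = 1 := by
  rw [norm_exp]
  simp

/-- The Fourier coefficients in `x` of the twisted function vanish for almost every `y`. -/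
lemma fourier_gaussTwist_eq_zero (hν : 0 < ν) {f : L2Space ν α}
    (hf : ∀ i, inner ℂ (psiVec hν α i) f = 0) (n : ℤ) :
    ∀ᵐ y : ℝ, ∫ x in Set.Icc (0 : ℝ) 1, gaussTwist ν α f ⟨x, y⟩ *
      exp (-(2 * I * Real.pi * n * x)) = 0 := by
  set c := 2 * Real.pi * (n + α) with hc
  set u : ℝ → ℂ := fun y => ∫ x in Set.Icc (0 : ℝ) 1, gaussTwist ν α f ⟨x, y⟩ *
      exp (-(2 * I * Real.pi * n * x)) * ((Real.exp (-c * y) : ℝ) : ℂ) with hu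
  have hu0 : ∀ᵐ y, u y = 0 := by
    refine ae_eq_zero_of_moments (fun a => ?_) (fun k => ?_)
    · have h := (integrable_gaussTwist_mul hν f (k := fun p : ℝ × ℝ =>
        exp (-(2 * I * Real.pi * n * p.1)) * ((Real.exp (-c * p.2) : ℝ) : ℂ) *
          ((Real.exp (a * |p.2|) : ℝ) : ℂ)) (a := |c| + a) (by fun_prop) (fun p => ?_)
        ).integral_prod_right
      · refine h.congr (ae_of_all _ fun y => ?_)
        simp only [hu]
        rw [← integral_mul_const]
        refine integral_congr_ae (ae_of_all _ fun x => ?_)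
        simp only; ring
      · rw [norm_mul, norm_mul, norm_exp_two_pi_I, one_mul, Complex.norm_real, Complex.norm_real,
          Real.norm_of_nonneg (Real.exp_nonneg _), Real.norm_of_nonneg (Real.exp_nonneg _),
          ← Real.exp_add, Real.exp_le_exp, add_mul, ← abs_mul]
        have := neg_le_abs (c * p.2)
        linarith
    -- The polynomial inverts the affine map `y ↦ t_n(y)`, so that `P(t_n) = y^k` and orthogonality
    -- becomes the vanishing of the `k`-th moment.
    · set P : Polynomial ℝ := (Polynomial.C (√(2 * ν))⁻¹ *
        (Polynomial.X - Polynomial.C (√(2 / ν) * Real.pi * (n + α)))) ^ k with hP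
      have h0 : √(2 * ν) ≠ 0 := (Real.sqrt_pos.2 (by positivity)).ne'
      have hPe : ∀ y, P.eval (hermiteArg ν α n y) = y ^ k := by
        intro y
        simp only [hP, Polynomial.eval_pow, Polynomial.eval_mul, Polynomial.eval_C,
          Polynomial.eval_sub, Polynomial.eval_X, hermiteArg]
        congr 1
        field_simp
        ring
      have hC : (((2 * ν / Real.pi) ^ (1 / 4 : ℝ) *
          Real.exp (-(Real.pi ^ 2 / ν) * (n + α) ^ 2) : ℝ) : ℂ) ≠ 0 := by
        have : (2 * ν / Real.pi) ^ (1 / 4 : ℝ) * Real.exp (-(Real.pi ^ 2 / ν) * (n + α) ^ 2) ≠ 0 :=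
          (mul_pos (Real.rpow_pos_of_pos (div_pos (by positivity) Real.pi_pos) _)
            (Real.exp_pos _)).ne'
        exact_mod_cast this
      have h1 := integral_psiPoly_eq_zero hν hf n P
      have h2 := psiPoly_integrableOn hν f n P
      simp only [mul_conj_psiPoly_eq, hPe] at h1 h2
      rw [integral_const_mul] at h1
      have h1 := (mul_eq_zero.1 h1).resolve_left hC
      have h2 : IntegrableOn _ strip := (integrable_const_mul_iff hC.isUnit _).1 h2
      rw [setIntegral_strip, integral_prod_symm _ (integrableOn_strip_iff.1 h2)] at h1
      rw [← h1]
      refine integral_congr_ae (ae_of_all _ fun y => ?_)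
      simp only [hu]
      rw [← integral_mul_const]
      refine integral_congr_ae (ae_of_all _ fun x => ?_)
      simp only [ofReal_pow, hc]
  filter_upwards [hu0] with y hy
  simp only [hu] at hy
  rw [integral_mul_const] at hy
  refine (mul_eq_zero.1 hy).resolve_right ?_
  exact_mod_cast (Real.exp_pos _).ne'

/-- Countability of `ℤ` gives one null set of `y` outside which all Fourier coefficients vanish. The
twist is then zero on almost every horizontal slice, and its twisting factor has no zeros. -/
lemma eq_zero_of_inner_psiVec (hν : 0 < ν) {f : L2Space ν α}
    (hf : ∀ i, inner ℂ (psiVec hν α i) f = 0) : f = 0 := by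
  have h1 : ∀ᵐ y : ℝ, ∀ n : ℤ, ∫ x in Set.Icc (0 : ℝ) 1, gaussTwist ν α f ⟨x, y⟩ *
      exp (-(2 * I * Real.pi * n * x)) = 0 :=
    ae_all_iff.2 (fourier_gaussTwist_eq_zero hν hf)
  have hG : Integrable (fun p : ℝ × ℝ => gaussTwist ν α f ⟨p.1, p.2⟩)
      ((volume.restrict (Set.Icc (0 : ℝ) 1)).prod volume) := by
    simpa using integrable_gaussTwist_mul hν f (k := fun _ => 1) continuous_const (a := 0)
      (by simp)
  have h2 : ∀ᵐ y : ℝ, ∀ᵐ x ∂(volume.restrict (Set.Icc (0 : ℝ) 1)),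
      gaussTwist ν α f ⟨x, y⟩ = 0 := by
    filter_upwards [h1, hG.prod_left_ae, (integrable_gaussTwist_sq hν f).prod_left_ae]
      with y hy1 hy2 hy3
    exact ae_eq_zero_of_fourierCoeff
      ((memLp_two_iff_integrable_sq_norm hy2.aestronglyMeasurable).2 hy3) hy1
  -- The slicewise vanishing passes to the product measure through the integral of the norm.
  have h3 : ∫ p : ℝ × ℝ, ‖gaussTwist ν α f ⟨p.1, p.2⟩‖
      ∂((volume.restrict (Set.Icc (0 : ℝ) 1)).prod volume) = 0 := by
    rw [integral_prod_symm _ hG.norm]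
    refine integral_eq_zero_of_ae ?_
    filter_upwards [h2] with y hy
    refine integral_eq_zero_of_ae ?_
    filter_upwards [hy] with x hx
    simp only [hx, norm_zero, Pi.zero_apply]
  rw [integral_eq_zero_iff_of_nonneg (fun p => norm_nonneg _) hG.norm] at h3
  have h4 : ∀ᵐ z ∂(volume.restrict strip), gaussTwist ν α f z = 0 := by
    rw [ae_strip_iff]
    filter_upwards [h3] with p hp
    exact norm_eq_zero.1 hp
  refine ae_zero_of_strip f ?_
  filter_upwards [(ae_restrict_iff' measurableSet_strip).1 h4] with z hz hs
  have h5 := norm_gaussTwist_sq ν α f z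
  rw [hz hs, norm_zero, zero_pow two_ne_zero] at h5
  have h6 := weight_pos ν z
  have h7 := Real.exp_pos (-(2 * ν) * z.im ^ 2)
  have h8 : ‖f z‖ ^ 2 = 0 := by
    rcases mul_eq_zero.1 h5.symm with h | h
    · exact (mul_eq_zero.1 h).resolve_right h6.ne'
    · exact absurd h h7.ne'
  simpa using h8

/-! ### Diagonal operators in a Hilbert basis -/

/-- A bounded multiplier acts diagonally on a Hilbert basis. -/
lemma exists_diagonal {ι H : Type*} [NormedAddCommGroup H] [InnerProductSpace ℂ H]
    (b : HilbertBasis ι ℂ H) {d : ι → ℂ} {C : ℝ} (hC : ∀ i, ‖d i‖ ≤ C) :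
    ∃ R : H →L[ℂ] H, ∀ h i, inner ℂ (b i) (R h) = d i * inner ℂ (b i) h := by
  have hmem : ∀ f : lp (fun _ : ι => ℂ) 2, Memℓp (fun i => d i * f i) 2 := by
    intro f
    refine memℓp_gen ?_
    have h := (lp.memℓp f).summable (by norm_num)
    refine (h.mul_left (C ^ 2)).of_nonneg_of_le (fun i => by positivity) fun i => ?_
    simp only [ENNReal.toReal_ofNat, Real.rpow_ofNat, norm_mul, mul_pow]
    exact mul_le_mul_of_nonneg_right (pow_le_pow_left₀ (norm_nonneg _) (hC i) 2) (by positivity)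
  let D : lp (fun _ : ι => ℂ) 2 →ₗ[ℂ] lp (fun _ : ι => ℂ) 2 :=
    { toFun := fun f => ⟨fun i => d i * f i, hmem f⟩
      map_add' := fun f g => by
        ext i
        change d i * (f i + g i) = d i * f i + d i * g i
        ring
      map_smul' := fun c f => by
        ext i
        change d i * (c * f i) = c * (d i * f i)
        ring }
  have hD : ∀ f, ‖D f‖ ≤ |C| * ‖f‖ := by
    intro f
    have h1 := lp.hasSum_norm (p := 2) (by norm_num) f
    have h2 := lp.hasSum_norm (p := 2) (by norm_num) (D f)
    have h3 := hasSum_le (fun i => ?_) h2 (h1.mul_left (C ^ 2))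
    · simp only [ENNReal.toReal_ofNat, Real.rpow_ofNat] at h3
      rw [← sq_abs C, ← mul_pow] at h3
      exact (pow_le_pow_iff_left₀ (norm_nonneg _) (by positivity) two_ne_zero).1 h3
    · change ‖d i * f i‖ ^ _ ≤ _
      simp only [ENNReal.toReal_ofNat, Real.rpow_ofNat, norm_mul, mul_pow]
      exact mul_le_mul_of_nonneg_right (pow_le_pow_left₀ (norm_nonneg _) (hC i) 2) (by positivity)
  refine ⟨(b.repr.symm.toContinuousLinearEquiv : lp (fun _ : ι => ℂ) 2 →L[ℂ] H).comp
    ((D.mkContinuous _ hD).comp (b.repr.toContinuousLinearEquiv : H →L[ℂ] _)), fun h i => ?_⟩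
  rw [← HilbertBasis.repr_apply_apply, ← HilbertBasis.repr_apply_apply]
  have : b.repr (b.repr.symm (D (b.repr h))) = D (b.repr h) := b.repr.apply_symm_apply _
  exact congrArg (fun f : lp (fun _ : ι => ℂ) 2 => f i) this

/-! ### The spectral decomposition -/

/-- The Hilbert basis `ψ_{m,n}` of `L^{2,ν}_{Γ,α}`. -/
def psiBasis (hν : 0 < ν) (α : ℝ) [CompleteSpace (L2Space ν α)] :
    HilbertBasis (ℕ × ℤ) ℂ (L2Space ν α) :=
  HilbertBasis.mkOfOrthogonalEqBot (orthonormal_psiVec hν α) (by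
    rw [eq_bot_iff]
    intro f hf
    rw [Submodule.mem_bot]
    refine eq_zero_of_inner_psiVec hν fun i => ?_
    exact (Submodule.mem_orthogonal _ f).1 hf _ (Submodule.subset_span ⟨i, rfl⟩))

lemma coe_psiBasis [CompleteSpace (L2Space ν α)] (hν : 0 < ν) : ⇑(psiBasis hν α) = psiVec hν α :=
  HilbertBasis.coe_mkOfOrthogonalEqBot _ _

lemma hasSum_psiVec [CompleteSpace (L2Space ν α)] (hν : 0 < ν) (f : L2Space ν α) :
    HasSum (fun i => inner ℂ (psiVec hν α i) f • psiVec hν α i) f := by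
  have h := (psiBasis hν α).hasSum_repr f
  simpa only [HilbertBasis.repr_apply_apply, coe_psiBasis] using h

lemma isWeakLandau_psiVec (hν : 0 < ν) (i : ℕ × ℤ) :
    IsWeakLandau ν (psiVec hν α i) ((ν * i.1 : ℂ) • psiVec hν α i : L2Space ν α) := by
  have h := isWeakLandau_landau (ν := ν) (contDiff_psiHermite ν α i.1 i.2)
  refine h.congr ?_ ?_
  · filter_upwards [coeFn_psiVec hν α i] with z hz using hz.symm
  · filter_upwards [coeFn_psiVec hν α i, coeFn_smul (ν * i.1 : ℂ) (psiVec hν α i)] with z h1 h2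
    rw [h2, h1, landau_psiHermite hν]

/-- The diagonalization. For the converse, finite partial sums of the two expansions form pairs in
the graph, and the graph is closed. -/
lemma isWeakLandau_iff [CompleteSpace (L2Space ν α)] (hν : 0 < ν) (f g : L2Space ν α) :
    IsWeakLandau ν f g ↔
    ∀ i, inner ℂ (psiVec hν α i) g = ν * i.1 * inner ℂ (psiVec hν α i) f := by
  refine ⟨fun h i => inner_psiVec_of_isWeakLandau hν h i, fun h => ?_⟩
  have hs := (hasSum_psiVec hν f).prodMk (hasSum_psiVec hν g)
  refine isClosed_landauGraph.mem_of_tendsto hs (Filter.Eventually.of_forall fun s => ?_)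
  refine Submodule.sum_mem _ fun i _ => ?_
  have h1 : (psiVec hν α i, (ν * i.1 : ℂ) • psiVec hν α i) ∈ landauGraph ν α :=
    isWeakLandau_psiVec hν i
  have h2 := Submodule.smul_mem _ (inner ℂ (psiVec hν α i) f) h1
  rw [Prod.smul_mk, smul_smul, mul_comm, ← h] at h2
  exact h2

lemma mem_eigenspace_iff {lam : ℂ} {f : L2Space ν α} : f ∈ eigenspace ν α lam ↔
    IsWeakLandau ν f ((ν * lam : ℂ) • f : L2Space ν α) := by
  rw [← mem_graph_landauOperator (f, (ν * lam : ℂ) • f)]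
  constructor
  · rintro ⟨hd, h⟩
    rw [← h]
    exact (landauOperator ν α).mem_graph ⟨f, hd⟩
  · intro h
    have hd : f ∈ (landauOperator ν α).domain := LinearPMap.mem_domain_iff.2 ⟨_, h⟩
    exact ⟨hd, ((LinearPMap.image_iff hd).2 h).symm⟩

/-- On coefficients the eigenvalue equation reads `ν(λ - m) c_{m,n} = 0`. -/
lemma mem_eigenspace_iff_inner [CompleteSpace (L2Space ν α)] (hν : 0 < ν) {lam : ℂ}
    {f : L2Space ν α} :
    f ∈ eigenspace ν α lam ↔ ∀ i : ℕ × ℤ, lam ≠ i.1 → inner ℂ (psiVec hν α i) f = 0 := by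
  have hν0 : (ν : ℂ) ≠ 0 := by exact_mod_cast hν.ne'
  rw [mem_eigenspace_iff, isWeakLandau_iff hν]
  refine forall_congr' fun i => ?_
  rw [inner_smul_right]
  constructor
  · intro h hi
    have h1 : (ν : ℂ) * (lam - i.1) * inner ℂ (psiVec hν α i) f = 0 := by
      linear_combination h
    exact (mul_eq_zero.1 h1).resolve_left (mul_ne_zero hν0 (sub_ne_zero.2 hi))
  · intro h
    by_cases hi : lam = i.1
    · rw [hi]
    · rw [h hi]; ring

lemma psiVec_mem_eigenspace (hν : 0 < ν) (m : ℕ) (n : ℤ) :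
    psiVec hν α (m, n) ∈ eigenspace ν α m :=
  mem_eigenspace_iff.2 (isWeakLandau_psiVec hν (m, n))

lemma psiVec_ne_zero (hν : 0 < ν) (i : ℕ × ℤ) : psiVec hν α i ≠ 0 :=
  (orthonormal_psiVec hν α).ne_zero i

lemma eigenspace_ne_bot_iff [CompleteSpace (L2Space ν α)] (hν : 0 < ν) (lam : ℂ) :
    eigenspace ν α lam ≠ ⊥ ↔ ∃ m : ℕ, lam = m := by
  constructor
  · intro h
    by_contra! hm
    refine h (eq_bot_iff.2 fun f hf => ?_)
    rw [mem_eigenspace_iff_inner hν] at hf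
    exact eq_zero_of_inner_psiVec hν fun i => hf i (hm i.1)
  · rintro ⟨m, rfl⟩ h
    have := psiVec_mem_eigenspace (α := α) hν m 0
    rw [h, Submodule.mem_bot] at this
    exact psiVec_ne_zero hν _ this

lemma isClosed_eigenspace [CompleteSpace (L2Space ν α)] (hν : 0 < ν) (lam : ℂ) :
    IsClosed (eigenspace ν α lam : Set (L2Space ν α)) := by
  have h : (eigenspace ν α lam : Set (L2Space ν α)) =
      ⋂ (i : ℕ × ℤ) (_ : lam ≠ i.1), {f | inner ℂ (psiVec hν α i) f = 0} := by
    ext f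
    simp only [SetLike.mem_coe, mem_eigenspace_iff_inner hν, Set.mem_iInter, Set.mem_ofPred_eq]
  rw [h]
  exact isClosed_iInter fun i => isClosed_iInter fun _ =>
    isClosed_eq (continuous_const.inner continuous_id) continuous_const

lemma completeSpace_eigenspace [CompleteSpace (L2Space ν α)] (hν : 0 < ν) (lam : ℂ) :
    CompleteSpace (eigenspace ν α lam) :=
  (isClosed_eigenspace hν lam).completeSpace_coe

/-- The vectors `ψ_{m,n}`, `n ∈ ℤ`, as elements of the `m`-th eigenspace. -/
def eigenVec (hν : 0 < ν) (α : ℝ) (m : ℕ) (n : ℤ) :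
    eigenspace ν α m :=
  ⟨psiVec hν α (m, n), psiVec_mem_eigenspace hν m n⟩

lemma orthonormal_eigenVec [CompleteSpace (L2Space ν α)] (hν : 0 < ν) (m : ℕ) :
    Orthonormal ℂ (eigenVec hν α m) :=
  (orthonormal_psiVec hν α).comp (fun n : ℤ => (m, n)) (fun _ _ h => (Prod.mk.inj h).2)
    |>.codRestrict (eigenspace ν α m) (psiVec_mem_eigenspace hν m)

lemma not_finiteDimensional_eigenspace [CompleteSpace (L2Space ν α)] (hν : 0 < ν) (m : ℕ) :
    ¬ FiniteDimensional ℂ (eigenspace ν α m) := by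
  intro h
  have := (orthonormal_eigenVec (α := α) hν m).linearIndependent.finite
  exact not_finite ℤ

lemma exists_eigenBasis [CompleteSpace (L2Space ν α)] (hν : 0 < ν) (m : ℕ) :
    ∃ b : HilbertBasis ℤ ℂ (eigenspace ν α m),
      ∀ n : ℤ, ∀ᵐ z, (b n : L2Space ν α) z = psiHermite ν α m n z := by
  have := completeSpace_eigenspace (α := α) hν (m : ℂ)
  refine ⟨HilbertBasis.mkOfOrthogonalEqBot (orthonormal_eigenVec hν m) ?_, fun n => ?_⟩
  · rw [eq_bot_iff]
    rintro ⟨f, hf⟩ h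
    rw [Submodule.mem_bot]
    refine Subtype.ext (eq_zero_of_inner_psiVec hν fun i => ?_)
    by_cases hi : m = i.1
    · have h1 := (Submodule.mem_orthogonal _ _).1 h (eigenVec hν α m i.2)
        (Submodule.subset_span ⟨i.2, rfl⟩)
      subst hi
      exact h1
    · exact (mem_eigenspace_iff_inner hν).1 hf i (by exact_mod_cast hi)
  · rw [HilbertBasis.coe_mkOfOrthogonalEqBot]
    exact coeFn_psiVec hν α (m, n)

lemma isHilbertSum_eigenspace [CompleteSpace (L2Space ν α)] (hν : 0 < ν) :
    IsHilbertSum ℂ (fun m : ℕ => eigenspace ν α m)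
      (fun m : ℕ => (eigenspace ν α m).subtypeₗᵢ) := by
  have : ∀ m : ℕ, CompleteSpace (eigenspace ν α m) := fun m => completeSpace_eigenspace hν _
  refine IsHilbertSum.mkInternal _ ?_ ?_
  · intro m m' hm v w
    -- In Parseval's formula every term has a vanishing factor, since the first index cannot equal
    -- both `m` and `m'`.
    have h := (psiBasis hν α).hasSum_inner_mul_inner (v : L2Space ν α) (w : L2Space ν α)
    refine h.unique ?_
    convert hasSum_zero with i
    rw [coe_psiBasis]
    by_cases hi : m = i.1
    · rw [(mem_eigenspace_iff_inner hν).1 w.2 i (by rw [← hi]; exact_mod_cast hm.symm), mul_zero]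
    · rw [← inner_conj_symm, (mem_eigenspace_iff_inner hν).1 v.2 i (by exact_mod_cast hi),
        map_zero, zero_mul]
  · rw [← (psiBasis hν α).dense_span]
    refine Submodule.topologicalClosure_mono (Submodule.span_le.2 ?_)
    rintro _ ⟨⟨m, n⟩, rfl⟩
    rw [coe_psiBasis]
    exact Submodule.mem_iSup_of_mem m (psiVec_mem_eigenspace hν m n)

/-- The sequence tends to zero, hence is bounded. If `μ = νm` for some `m`, that entry is `0⁻¹ = 0`
and does no harm. -/
lemma exists_bound_inv (hν : 0 < ν) {μ : ℂ} : ∃ C : ℝ, ∀ m : ℕ, ‖((ν : ℂ) * m - μ)⁻¹‖ ≤ C := by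
  have h1 : Filter.Tendsto (fun m : ℕ => ‖(ν : ℂ) * m - μ‖) Filter.atTop Filter.atTop := by
    refine Filter.tendsto_atTop_mono (f := fun m : ℕ => ν * m - ‖μ‖) (fun m => ?_) ?_
    · have h := norm_sub_norm_le ((ν : ℂ) * m) μ
      rwa [norm_mul, Complex.norm_real, Real.norm_of_nonneg hν.le, norm_natCast] at h
    · exact Filter.tendsto_atTop_add_const_right _ _
        (tendsto_natCast_atTop_atTop.const_mul_atTop hν)
  have h2 : Filter.Tendsto (fun m : ℕ => ‖((ν : ℂ) * m - μ)⁻¹‖) Filter.atTop (nhds 0) := by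
    simp only [norm_inv]
    exact tendsto_inv_atTop_zero.comp h1
  obtain ⟨C, hC⟩ := h2.bddAbove_range
  exact ⟨C, fun m => hC ⟨m, rfl⟩⟩

/-- Away from the numbers `νm` the resolvent is the diagonal operator with entries `(νm - μ)⁻¹`;
that it maps into the domain is checked on coefficients with `isWeakLandau_iff`. At `μ = νm` a left
inverse of `Δ_ν - μ` would kill the eigenvector `ψ_{m,0}`. -/
lemma unboundedSpectrum_landauOperator [CompleteSpace (L2Space ν α)] (hν : 0 < ν) :
    unboundedSpectrum (landauOperator ν α) = Set.range (fun m : ℕ => (ν : ℂ) * m) := by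
  ext μ
  rw [unboundedSpectrum, Set.mem_compl_iff]
  constructor
  · intro h
    by_contra hμ
    apply h
    have hne : ∀ m : ℕ, (ν : ℂ) * m - μ ≠ 0 := fun m h0 => hμ ⟨m, sub_eq_zero.1 h0⟩
    obtain ⟨C, hC⟩ := exists_bound_inv hν (μ := μ)
    obtain ⟨R, hR⟩ := exists_diagonal (psiBasis hν α)
      (d := fun i => ((ν : ℂ) * i.1 - μ)⁻¹) (fun i => hC i.1)
    simp only [coe_psiBasis] at hR
    refine ⟨R, fun h => ?_, fun f => ?_⟩
    · have hg : (R h, h + μ • R h) ∈ (landauOperator ν α).graph := by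
        rw [mem_graph_landauOperator, isWeakLandau_iff hν]
        intro i
        rw [inner_add_right, inner_smul_right, hR]
        have := hne i.1
        field_simp
        ring
      have hd := LinearPMap.mem_domain_iff.2 ⟨_, hg⟩
      refine ⟨hd, ?_⟩
      rw [← (LinearPMap.image_iff hd).2 hg]
      abel
    · have hg := (isWeakLandau_iff hν (f : L2Space ν α) (landauOperator ν α f)).1
        ((mem_graph_landauOperator _).1 ((landauOperator ν α).mem_graph f))
      refine sub_eq_zero.1 (eq_zero_of_inner_psiVec hν fun i => ?_)
      rw [inner_sub_right, hR, inner_sub_right, inner_smul_right, hg i]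
      have := hne i.1
      field_simp
      ring
  · rintro ⟨m, rfl⟩ ⟨R, -, hR⟩
    obtain ⟨hd, h⟩ := psiVec_mem_eigenspace (α := α) hν m 0
    have h1 := hR ⟨_, hd⟩
    rw [h, sub_self, map_zero] at h1
    exact psiVec_ne_zero hν _ h1.symm

/-! ### Series of the functions `ψ_n P(t_n)` -/

/-- Coefficients of at most polynomial growth. -/
def PolyGrowth (b : ℤ → ℂ) : Prop := ∃ (C : ℝ) (k : ℕ), ∀ n, ‖b n‖ ≤ C * (1 + |(n : ℝ)|) ^ k

lemma PolyGrowth.of_bound {b : ℤ → ℂ} {C : ℝ} (h : ∀ n, ‖b n‖ ≤ C) : PolyGrowth b :=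
  ⟨C, 0, fun n => by simpa using h n⟩

lemma PolyGrowth.mul {b c : ℤ → ℂ} (hb : PolyGrowth b) (hc : PolyGrowth c) :
    PolyGrowth fun n => b n * c n := by
  obtain ⟨C, k, hC⟩ := hb
  obtain ⟨D, l, hD⟩ := hc
  refine ⟨C * D, k + l, fun n => ?_⟩
  rw [norm_mul]
  calc ‖b n‖ * ‖c n‖ ≤ (C * (1 + |(n : ℝ)|) ^ k) * (D * (1 + |(n : ℝ)|) ^ l) :=
        mul_le_mul (hC n) (hD n) (norm_nonneg _) ((norm_nonneg _).trans (hC n))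
    _ = _ := by rw [pow_add]; ring

/-- Up to a factor independent of `n`, `ψ_n` is a term of the Jacobi theta series with `τ = iπ/ν` at
a point shifted by `iπα/ν`. This imports locally uniform summable bounds, also with powers of `n`.
-/
lemma psi_eq_jacobiTheta₂_term (hν : 0 < ν) (α : ℝ) (n : ℤ) (z : ℂ) :
    psi ν α n z = ((2 * ν / Real.pi) ^ (1 / 4 : ℝ) : ℝ) * exp (ν / 2 * z ^ 2) *
      exp (-(Real.pi ^ 2 / ν) * α ^ 2 + 2 * I * Real.pi * α * z) *
      jacobiTheta₂_term n (z + (Real.pi * α / ν : ℝ) * I) ((Real.pi / ν : ℝ) * I) := by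
  have hν0 : (ν : ℂ) ≠ 0 := by exact_mod_cast hν.ne'
  have e : exp (ν / 2 * z ^ 2 + (-(Real.pi ^ 2 / ν) * (n + α) ^ 2 + 2 * I * Real.pi * (α + n) * z)) =
      exp (ν / 2 * z ^ 2) * exp (-(Real.pi ^ 2 / ν) * α ^ 2 + 2 * I * Real.pi * α * z) *
        jacobiTheta₂_term n (z + (Real.pi * α / ν : ℝ) * I) ((Real.pi / ν : ℝ) * I) := by
    rw [jacobiTheta₂_term, ← exp_add, ← exp_add]
    congr 1
    push_cast
    field_simp
    ring_nf
    simp only [I_sq]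
    ring
  rw [mul_assoc, mul_assoc, ← mul_assoc (exp _) (exp _), ← e, exp_add, psi]
  ring

lemma PolyGrowth.exists_bound_psi (hν : 0 < ν) (α : ℝ) {b : ℤ → ℂ} (hb : PolyGrowth b) (R : ℝ) :
    ∃ u : ℤ → ℝ, Summable u ∧ ∀ n z, ‖z‖ ≤ R → ‖b n * psi ν α n z‖ ≤ u n := by
  obtain ⟨C, k, hC⟩ := hb
  have hC0 : 0 ≤ C := by simpa using (norm_nonneg _).trans (hC 0)
  set E : ℂ → ℂ := fun z => ((2 * ν / Real.pi) ^ (1 / 4 : ℝ) : ℝ) * exp (ν / 2 * z ^ 2) *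
      exp (-(Real.pi ^ 2 / ν) * α ^ 2 + 2 * I * Real.pi * α * z) with hE
  have hEc : Continuous E := by fun_prop
  obtain ⟨M, hM⟩ := (isCompact_closedBall (0 : ℂ) R).exists_bound_of_continuousOn hEc.continuousOn
  set S := R + |Real.pi * α / ν| with hS
  have hT : 0 < Real.pi / ν := by positivity
  set J : ℤ → ℝ := fun n =>
    Real.exp (-Real.pi * (Real.pi / ν * (n : ℝ) ^ 2 - 2 * S * |(n : ℝ)|)) with hJ
  have hs0 : Summable J := by
    have h := summable_pow_mul_jacobiTheta₂_term_bound S hT 0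
    simpa [hJ] using h
  have hsk : Summable fun n : ℤ => |(n : ℝ)| ^ k * J n := by
    have h := summable_pow_mul_jacobiTheta₂_term_bound S hT k
    simpa [hJ] using h
  -- The absolute value of `M` is taken because the ball is empty for `R < 0` and `M` could be
  -- negative. The constant `2 ^ (k - 1)` comes from `(1+x)^k ≤ 2^(k-1)(1+x^k)`, valid with
  -- truncated subtraction at `k = 0`.
  refine ⟨fun n => C * (2 ^ (k - 1) * (J n + |(n : ℝ)| ^ k * J n)) * |M|,
    ((hs0.add hsk).mul_left _).mul_left _ |>.mul_right _, fun n z hz => ?_⟩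
  have h1 : ‖E z‖ ≤ |M| := (hM z (by simpa using hz)).trans (le_abs_self M)
  have h2 : ‖jacobiTheta₂_term n (z + (Real.pi * α / ν : ℝ) * I) ((Real.pi / ν : ℝ) * I)‖ ≤ J n := by
    have h := norm_jacobiTheta₂_term_le hT (S := S) (z := z + (Real.pi * α / ν : ℝ) * I)
      (τ := (Real.pi / ν : ℝ) * I) ?_ ?_ n
    · simpa [hJ] using h
    · rw [add_im, im_ofReal_mul, I_im, mul_one]
      exact (abs_add_le _ _).trans (add_le_add ((abs_im_le_norm z).trans hz) le_rfl)
    · rw [im_ofReal_mul, I_im, mul_one]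
  have h3 : (1 + |(n : ℝ)|) ^ k ≤ 2 ^ (k - 1) * (1 + |(n : ℝ)| ^ k) := by
    simpa using add_pow_le zero_le_one (abs_nonneg (n : ℝ)) k
  have hJ0 : 0 ≤ J n := (Real.exp_pos _).le
  rw [psi_eq_jacobiTheta₂_term hν, norm_mul, norm_mul]
  calc ‖b n‖ * (‖E z‖ * _) ≤ (C * (2 ^ (k - 1) * (1 + |(n : ℝ)| ^ k))) * (|M| * J n) := by
        refine mul_le_mul ((hC n).trans (mul_le_mul_of_nonneg_left h3 hC0))
          (mul_le_mul h1 h2 (norm_nonneg _) (abs_nonneg _)) (by positivity) (by positivity)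
    _ = _ := by ring

lemma PolyGrowth.differentiable_tsum_psi (hν : 0 < ν) (α : ℝ) {b : ℤ → ℂ} (hb : PolyGrowth b) :
    Differentiable ℂ fun z => ∑' n, b n * psi ν α n z := by
  intro z
  obtain ⟨u, hu, hle⟩ := hb.exists_bound_psi hν α (‖z‖ + 1)
  have h := differentiableOn_tsum_of_summable_norm (U := Metric.ball (0 : ℂ) (‖z‖ + 1)) hu
    (fun n => ((differentiable_psi ν α n).const_mul (b n)).differentiableOn) Metric.isOpen_ball
    (fun n w hw => hle n w (by simpa using (Metric.mem_ball.1 hw).le))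
  exact h.differentiableAt (Metric.isOpen_ball.mem_nhds (by simp))

lemma polyGrowth_shift (ν α : ℝ) :
    PolyGrowth fun n => ((√(2 / ν) * Real.pi * (n + α) : ℝ) : ℂ) := by
  refine ⟨√(2 / ν) * Real.pi * (1 + |α|), 1, fun n => ?_⟩
  rw [Complex.norm_real, Real.norm_eq_abs, abs_mul, abs_of_nonneg (by positivity), pow_one,
    mul_assoc _ (1 + |α|)]
  refine mul_le_mul_of_nonneg_left ?_ (by positivity)
  have := abs_add_le (n : ℝ) α
  nlinarith [abs_nonneg (n : ℝ), abs_nonneg α, mul_nonneg (abs_nonneg (n : ℝ)) (abs_nonneg α)]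

/-- Series `∑ b_n ψ_n P(t_n)` with coefficients of polynomial growth converge locally uniformly
to smooth functions. -/
lemma tsum_psiPoly (hν : 0 < ν) (α : ℝ) (P : Polynomial ℝ) :
    -- The coefficients are quantified after `P`, since the induction on the degree changes them.
    ∀ b : ℤ → ℂ, PolyGrowth b →
      (∀ R : ℝ, ∃ u : ℤ → ℝ, Summable u ∧ ∀ n z, ‖z‖ ≤ R → ‖b n * psiPoly ν α n P z‖ ≤ u n) ∧
      ContDiff ℝ ∞ fun z => ∑' n, b n * psiPoly ν α n P z := by
  have hsum : ∀ {P : Polynomial ℝ} {b : ℤ → ℂ}, (∀ R : ℝ, ∃ u : ℤ → ℝ, Summable u ∧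
      ∀ n z, ‖z‖ ≤ R → ‖b n * psiPoly ν α n P z‖ ≤ u n) → ∀ z,
        Summable fun n => b n * psiPoly ν α n P z := by
    intro P b h z
    obtain ⟨u, hu, hle⟩ := h ‖z‖
    exact hu.of_norm_bounded fun n => hle n z le_rfl
  induction P using Polynomial.induction_on with
  | C a =>
    intro b hb
    have hb' : PolyGrowth fun n => b n * (a : ℂ) := hb.mul (PolyGrowth.of_bound fun _ => le_rfl)
    have e : ∀ n z, b n * psiPoly ν α n (Polynomial.C a) z = b n * a * psi ν α n z := by
      intro n z
      rw [psiPoly, Polynomial.eval_C]; ring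
    simp only [e]
    exact ⟨hb'.exists_bound_psi hν α,
      ((hb'.differentiable_tsum_psi hν α).contDiff (n := ∞)).restrict_scalars ℝ⟩
  | add P Q hP hQ =>
    intro b hb
    obtain ⟨h1, h2⟩ := hP b hb
    obtain ⟨h3, h4⟩ := hQ b hb
    have e : ∀ n z, b n * psiPoly ν α n (P + Q) z =
        b n * psiPoly ν α n P z + b n * psiPoly ν α n Q z := by
      intro n z
      rw [psiPoly, psiPoly, psiPoly, Polynomial.eval_add]; push_cast; ring
    simp only [e]
    refine ⟨fun R => ?_, ?_⟩
    · obtain ⟨u, hu, hle⟩ := h1 R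
      obtain ⟨v, hv, hle'⟩ := h3 R
      exact ⟨fun n => u n + v n, hu.add hv, fun n z hz =>
        (norm_add_le _ _).trans (add_le_add (hle n z hz) (hle' n z hz))⟩
    · have e2 : (fun z => ∑' n, (b n * psiPoly ν α n P z + b n * psiPoly ν α n Q z)) =
          fun z => (∑' n, b n * psiPoly ν α n P z) + ∑' n, b n * psiPoly ν α n Q z :=
        funext fun z => (hsum h1 z).tsum_add (hsum h3 z)
      rw [e2]
      exact h2.add h4
  | monomial k a ih =>
    intro b hb
    obtain ⟨h1, h2⟩ := ih b hb
    obtain ⟨h3, h4⟩ := ih _ (hb.mul (polyGrowth_shift ν α))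
    -- One factor `t_n` is split: its part in `y` leaves the sum, and its part in `n` is absorbed
    -- into coefficients that still grow polynomially. Degree zero is the entire theta series.
    have e : ∀ n z, b n * psiPoly ν α n (Polynomial.C a * Polynomial.X ^ (k + 1)) z =
        ((√(2 * ν) * z.im : ℝ) : ℂ) *
          (b n * psiPoly ν α n (Polynomial.C a * Polynomial.X ^ k) z) +
        b n * ((√(2 / ν) * Real.pi * (n + α) : ℝ) : ℂ) *
          psiPoly ν α n (Polynomial.C a * Polynomial.X ^ k) z := by
      intro n z
      simp only [psiPoly, Polynomial.eval_mul, Polynomial.eval_pow, Polynomial.eval_X,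
        Polynomial.eval_C, hermiteArg]
      push_cast
      ring
    simp only [e]
    refine ⟨fun R => ?_, ?_⟩
    · obtain ⟨u, hu, hle⟩ := h1 R
      obtain ⟨v, hv, hle'⟩ := h3 R
      refine ⟨fun n => √(2 * ν) * R * u n + v n, (hu.mul_left _).add hv, fun n z hz =>
        (norm_add_le _ _).trans (add_le_add ?_ (hle' n z hz))⟩
      rw [norm_mul, Complex.norm_real, norm_mul, Real.norm_of_nonneg (Real.sqrt_nonneg _)]
      exact mul_le_mul (mul_le_mul_of_nonneg_left ((abs_im_le_norm z).trans hz)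
        (Real.sqrt_nonneg _)) (hle n z hz) (norm_nonneg _)
        (mul_nonneg (Real.sqrt_nonneg _) ((norm_nonneg z).trans hz))
    · have e2 : (fun z => ∑' n, (((√(2 * ν) * z.im : ℝ) : ℂ) *
          (b n * psiPoly ν α n (Polynomial.C a * Polynomial.X ^ k) z) +
        b n * ((√(2 / ν) * Real.pi * (n + α) : ℝ) : ℂ) *
          psiPoly ν α n (Polynomial.C a * Polynomial.X ^ k) z)) =
          fun z => ((√(2 * ν) * z.im : ℝ) : ℂ) *
            (∑' n, b n * psiPoly ν α n (Polynomial.C a * Polynomial.X ^ k) z) +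
            ∑' n, b n * ((√(2 / ν) * Real.pi * (n + α) : ℝ) : ℂ) *
              psiPoly ν α n (Polynomial.C a * Polynomial.X ^ k) z := by
        funext z
        rw [((hsum h1 z).mul_left _).tsum_add (hsum h3 z), tsum_mul_left]
      rw [e2]
      exact ((ofRealCLM.contDiff.comp (contDiff_const.mul imCLM.contDiff)).mul h2).add h4

/-! ### Smooth representatives of eigenfunctions -/

/-- The smooth representative of an element of the `m`-th eigenspace. -/
def eigenSeries (hν : 0 < ν) (f : L2Space ν α) (m : ℕ) (z : ℂ) : ℂ :=
  ∑' n : ℤ, inner ℂ (psiVec hν α (m, n)) f * psiHermite ν α m n z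

lemma polyGrowth_inner_psiVec (hν : 0 < ν) (f : L2Space ν α) (m : ℕ) :
    PolyGrowth fun n => inner ℂ (psiVec hν α (m, n)) f := by
  refine PolyGrowth.of_bound (C := ‖f‖) fun n => ?_
  have h := norm_inner_le_norm (𝕜 := ℂ) (psiVec hν α (m, n)) f
  rwa [(orthonormal_psiVec hν α).1, one_mul] at h

lemma contDiff_eigenSeries (hν : 0 < ν) (f : L2Space ν α) (m : ℕ) :
    ContDiff ℝ ∞ (eigenSeries hν f m) := by
  have h := (tsum_psiPoly hν α (hermiteConst m • hermitePoly m) _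
    (polyGrowth_inner_psiVec hν f m)).2
  have e : eigenSeries hν f m = fun z => ∑' n : ℤ, inner ℂ (psiVec hν α (m, n)) f *
      psiPoly ν α n (hermiteConst m • hermitePoly m) z := by
    funext z
    simp only [eigenSeries, psiHermite_eq_psiPoly]
  rwa [e]

lemma isQuasiPeriodic_eigenSeries (hν : 0 < ν) (f : L2Space ν α) (m : ℕ) :
    IsQuasiPeriodic ν α (eigenSeries hν f m) := by
  intro k z
  rw [eigenSeries, eigenSeries, ← tsum_mul_left]
  refine tsum_congr fun n => ?_
  rw [isQuasiPeriodic_psiHermite]; ring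

lemma differentiable_eigenSeries_zero (hν : 0 < ν) (f : L2Space ν α) :
    Differentiable ℂ (eigenSeries hν f 0) := by
  have h := ((polyGrowth_inner_psiVec hν f 0).mul
    (PolyGrowth.of_bound (b := fun _ => (hermiteConst 0 : ℂ))
      fun _ => le_rfl)).differentiable_tsum_psi hν α
  refine (funext fun z => tsum_congr fun n => ?_ :
    (fun z => ∑' n, _ * psi ν α n z) = eigenSeries hν f 0) ▸ h
  rw [psiHermite_eq, ← psi_eq_psiPoly]
  ring

/-- The expansion of `f` converges in norm, the series locally uniformly. The two limits are
compared as distributions: a test functional is continuous in norm, and dominated convergence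
handles the pointwise series. -/
lemma ae_eq_eigenSeries [CompleteSpace (L2Space ν α)] (hν : 0 < ν) {m : ℕ} {f : L2Space ν α}
    (hf : f ∈ eigenspace ν α m) : ∀ᵐ z, f z = eigenSeries hν f m z := by
  set c : ℤ → ℂ := fun n => inner ℂ (psiVec hν α (m, n)) f with hc
  have hs : HasSum (fun n : ℤ => c n • psiVec hν α (m, n)) f := by
    refine ((Prod.mk_right_injective m).hasSum_iff fun i hi => ?_).2 (hasSum_psiVec hν f)
    have hm : (m : ℂ) ≠ i.1 := fun h => hi ⟨i.2, by rw [Nat.cast_injective h]⟩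
    rw [(mem_eigenspace_iff_inner hν).1 hf i hm, zero_smul]
  refine ae_eq_of_test (ν := ν) (locallyIntegrable f)
    (contDiff_eigenSeries hν f m).continuous.locallyIntegrable fun φ hφ hφc => ?_
  obtain ⟨T, hT⟩ := exists_testFunctional (ν := ν) (α := α) hφ.continuous hφc
  have h1 := hs.mapL T
  have h2 : ∀ n, T (c n • psiVec hν α (m, n)) =
      ∫ z, c n * psiHermite ν α m n z * conj (φ z) * weight ν z := by
    intro n
    rw [hT]
    refine integral_congr_ae ?_
    filter_upwards [coeFn_smul (c n) (psiVec hν α (m, n)), coeFn_psiVec hν α (m, n)] with z h3 h4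
    rw [h3, h4]
  simp only [h2, hT] at h1
  refine h1.unique ?_
  obtain ⟨R, hR⟩ := hφc.isCompact.isBounded.subset_closedBall 0
  obtain ⟨u, hu, hle⟩ := (tsum_psiPoly hν α (hermiteConst m • hermitePoly m) c
    (polyGrowth_inner_psiVec hν f m)).1 R
  simp only [← psiHermite_eq_psiPoly] at hle
  have hφw : Integrable fun z => ‖φ z‖ * weight ν z :=
    ((hφ.continuous.norm).mul (continuous_weight ν)).integrable_of_hasCompactSupport
      hφc.norm.mul_right
  have hz : ∀ n z, ‖c n * psiHermite ν α m n z * conj (φ z) * weight ν z‖ ≤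
      u n * (‖φ z‖ * weight ν z) := by
    intro n z
    rw [norm_mul, norm_mul, RCLike.norm_conj, Complex.norm_real,
      Real.norm_of_nonneg (weight_pos ν z).le, mul_assoc]
    by_cases h0 : φ z = 0
    · simp [h0]
    · exact mul_le_mul_of_nonneg_right (hle n z (by simpa using hR (subset_tsupport _ h0)))
        (mul_nonneg (norm_nonneg _) (weight_pos ν z).le)
  refine hasSum_integral_of_dominated_convergence (fun n z => u n * (‖φ z‖ * weight ν z))
    (fun n => ?_) (fun n => ae_of_all _ (hz n)) (ae_of_all _ fun z => hu.mul_right _) ?_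
    (ae_of_all _ fun z => ?_)
  · refine Continuous.aestronglyMeasurable ?_
    exact ((continuous_const.mul (contDiff_psiHermite ν α m n).continuous).mul
      (continuous_conj.comp hφ.continuous)).mul (continuous_ofReal.comp (continuous_weight ν))
  · simp only [tsum_mul_right]
    exact hφw.const_mul _
  · have hsum : Summable fun n => c n * psiHermite ν α m n z := by
      obtain ⟨v, hv, hv'⟩ := (tsum_psiPoly hν α (hermiteConst m • hermitePoly m) c
        (polyGrowth_inner_psiVec hν f m)).1 ‖z‖
      simp only [← psiHermite_eq_psiPoly] at hv'
      exact hv.of_norm_bounded fun n => hv' n z le_rfl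
    exact (hsum.hasSum.mul_right _).mul_right _

/-- Eigenfunctions are exactly the elements with a smooth quasi-periodic representative that
solves the eigenvalue equation pointwise. -/
lemma mem_eigenspace_iff_smooth [CompleteSpace (L2Space ν α)] (hν : 0 < ν) (lam : ℂ)
    (f : L2Space ν α) : f ∈ eigenspace ν α lam ↔
      ∃ g : ℂ → ℂ, ContDiff ℝ ∞ g ∧ IsQuasiPeriodic ν α g ∧ (∀ᵐ z, f z = g z) ∧
        ∀ z, landau ν g z = ν * lam * g z := by
  constructor
  · intro hf
    obtain ⟨g, hg, hq, hfg⟩ : ∃ g : ℂ → ℂ, ContDiff ℝ ∞ g ∧ IsQuasiPeriodic ν α g ∧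
        ∀ᵐ z, f z = g z := by
      -- If `λ` is not a natural number the eigenspace is trivial and the zero function serves.
      by_cases h : eigenspace ν α lam = ⊥
      · rw [h, Submodule.mem_bot] at hf
        subst hf
        exact ⟨fun _ => 0, contDiff_const, fun m z => by simp, AEEqFun.coeFn_zero⟩
      · obtain ⟨m, rfl⟩ := (eigenspace_ne_bot_iff hν lam).1 h
        exact ⟨eigenSeries hν f m, contDiff_eigenSeries hν f m, isQuasiPeriodic_eigenSeries hν f m,
          ae_eq_eigenSeries hν hf⟩
    refine ⟨g, hg, hq, hfg, fun z => ?_⟩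
    have hw : IsWeakLandau ν g fun z => ν * lam * g z := by
      refine (mem_eigenspace_iff.1 hf).congr hfg ?_
      filter_upwards [coeFn_smul (ν * lam : ℂ) f, hfg] with z h1 h2
      rw [h1, h2]
    exact congrFun (hw.landau_eq hg (continuous_const.mul hg.continuous)) z
  · rintro ⟨g, hg, -, hfg, hl⟩
    refine mem_eigenspace_iff.2 ((isWeakLandau_landau hg).congr ?_ ?_)
    · filter_upwards [hfg] with z hz using hz.symm
    · filter_upwards [coeFn_smul (ν * lam : ℂ) f, hfg] with z h1 h2
      rw [h1, h2, hl]

/-- For `m = 0` the polynomial factor is constant, so the smooth representative is a series of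
entire functions. Conversely `A g = 0` for entire `g`, hence `A* A g = 0`. -/
lemma eigenspace_zero [CompleteSpace (L2Space ν α)] (hν : 0 < ν) :
    eigenspace ν α 0 = holomorphicSpace ν α := by
  ext f
  constructor
  · intro hf
    refine ⟨eigenSeries hν f 0, differentiable_eigenSeries_zero hν f,
      isQuasiPeriodic_eigenSeries hν f 0, ae_eq_eigenSeries hν ?_⟩
    simpa using hf
  · rintro ⟨g, hg, hq, hfg⟩
    refine (mem_eigenspace_iff_smooth hν 0 f).2
      ⟨g, (hg.contDiff (n := ∞)).restrict_scalars ℝ, hq, hfg, fun z => ?_⟩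
    have h : opA g = fun _ => 0 := funext fun z => opA_of_differentiableAt (hg z)
    simp [landau, h, dz]

end RankOneTheta

end

theorem mainTheorem4 (ν α : ℝ) (hν : 0 < ν) :
    ∃ _ : CompleteSpace (RankOneTheta.L2Space ν α),
      -- the spectrum of the Landau operator
      RankOneTheta.unboundedSpectrum (RankOneTheta.landauOperator ν α) =
        Set.range (fun m : ℕ => (ν : ℂ) * m) ∧
      -- the eigenvalues, their infinite multiplicity, and smoothness of the eigenfunctions
      (∀ lam : ℂ, RankOneTheta.eigenspace ν α lam ≠ ⊥ ↔ ∃ m : ℕ, lam = m) ∧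
      (∀ m : ℕ, ¬ FiniteDimensional ℂ (RankOneTheta.eigenspace ν α m)) ∧
      (∀ (lam : ℂ) (f : RankOneTheta.L2Space ν α), f ∈ RankOneTheta.eigenspace ν α lam ↔
        ∃ g : ℂ → ℂ, ContDiff ℝ ∞ g ∧ RankOneTheta.IsQuasiPeriodic ν α g ∧ (∀ᵐ z, f z = g z) ∧
          ∀ z, RankOneTheta.landau ν g z = ν * lam * g z) ∧
      -- the lowest eigenspace, and the Hilbert sum decomposition
      RankOneTheta.eigenspace ν α 0 = RankOneTheta.holomorphicSpace ν α ∧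
      IsHilbertSum ℂ (fun m : ℕ => RankOneTheta.eigenspace ν α m)
        (fun m : ℕ => (RankOneTheta.eigenspace ν α m).subtypeₗᵢ) ∧
      -- the operator `(ν^m m!)^{-1/2} (iA*)^m` and the orthonormal bases of the eigenspaces
      (∀ (m : ℕ) (n : ℤ) (z : ℂ),
        (((ν ^ m * m.factorial) ^ (-(1 / 2) : ℝ) : ℝ) : ℂ) *
            ((fun (f : ℂ → ℂ) (w : ℂ) => I * RankOneTheta.opAStar ν f w)^[m]
              (RankOneTheta.psi ν α n)) z
          = RankOneTheta.psiHermite ν α m n z) ∧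
      (∀ m : ℕ, ∃ b : HilbertBasis ℤ ℂ (RankOneTheta.eigenspace ν α m),
        ∀ n : ℤ, ∀ᵐ z, (b n : RankOneTheta.L2Space ν α) z =
          RankOneTheta.psiHermite ν α m n z) := by
  have := RankOneTheta.completeSpace_L2Space hν α
  exact ⟨this, RankOneTheta.unboundedSpectrum_landauOperator hν,
    RankOneTheta.eigenspace_ne_bot_iff hν, RankOneTheta.not_finiteDimensional_eigenspace hν,
    RankOneTheta.mem_eigenspace_iff_smooth hν, RankOneTheta.eigenspace_zero hν,
    RankOneTheta.isHilbertSum_eigenspace hν, RankOneTheta.creation_psi hν α,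
    RankOneTheta.exists_eigenBasis hν⟩
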